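/- Let $\Bbbk$ be a field, let $G$ be an abelian group (written multiplicatively), and let $\phi:G\times G\to\Bbbk\setminus\{0\}$ be a commutation factor: $\phi(gh,l)=\phi(g,l)\phi(h,l)$, $\phi(g,hl)=\phi(g,h)\phi(g,l)$ and $\phi(g,h)\phi(h,g)=1$ for all $g,h,l\in G$. Let $\mathrm{Vec}_G$ be the category of (small) $G$-graded $\Bbbk$-vector spaces $V=\bigoplus_{g\in G}V_g$ and linear maps preserving the grading. It is symmetric monoidal with the usual tensor product, $(V\otimes W)_g=\bigoplus_{a\in G}V_a\otimes W_{a^{-1}g}$, unit object $\Bbbk$ concentrated in degree $1_G$, and braiding $c(x\otimes y)=\phi(g,h)\,y\otimes x$ for $x\in X_g$, $y\in Y_h$. Let $\mathrm{Hopf}(\mathrm{Vec}_G)$ be the category of Hopf monoids in $\mathrm{Vec}_G$ (color Hopf algebras), $\mathrm{Hopf_{coc}}(\mathrm{Vec}_G)$ its full subcategory of cocommutative objects ($c\circ\Delta=\Delta$), and $\mathrm{Comon_{coc}}(\mathrm{Vec}_G)$ the category of cocommutative comonoids in $\mathrm{Vec}_G$. Write $m,u,\Delta,\epsilon,S$ for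 multiplication, unit, comultiplication, counit and antipode. Graded subspaces $K\subseteq V$ carry the induced grading $K_g=K\cap V_g$, and quotients by graded subspaces, with projection $\pi$, carry the grading $(V/I)_g=\pi(V_g)$. Then the following hold. 1. $\mathrm{Hopf_{coc}}(\mathrm{Vec}_G)$ is pointed; $\Bbbk$, with its canonical structure of color Hopf algebra, is a zero object. 2. $\mathrm{Hopf_{coc}}(\mathrm{Vec}_G)$ is finitely complete, and even complete. The equalizer of $f,g:A\to B$ is the inclusion into $A$ of the graded subspace $K=\{x\in A\mid(\mathrm{Id}_A\otimes f)(\Delta(x))=(\mathrm{Id}_A\otimes g)(\Delta(x))\}$, which is a color Hopf subalgebra. The binary product of $A$ and $B$ is $A\otimes B$ with $m=(m_A\otimes m_B)(\mathrm{Id}\otimes c_{B,A}\otimes\mathrm{Id})$, $u=u_A\otimes u_B$, $\Delta=(\mathrm{Id}\otimes c_{A,B}\otimes\mathrm{Id})(\Delta_A\otimes\Delta_B)$, $\epsilon=\epsilon_A\otimes\epsilon_B$, $S=S_A\otimes S_B$ (up to the canonical isomorphisms $\Bbbk\otimes\Bbbk\cong\Bbbk$), and with projections $\mathrm{Id}_A\otimes\epsilon_B$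 and $\epsilon_A\otimes\mathrm{Id}_B$; the morphism $T\to A\otimes B$ with components $g:T\to A$ and $h:T\to B$ is $(g\otimes h)\circ\Delta_T$. 3. $\mathrm{Hopf_{coc}}(\mathrm{Vec}_G)$ and $\mathrm{Hopf}(\mathrm{Vec}_G)$ are cocomplete. In each of these two categories: the coequalizer of $f,g:A\to B$ is the projection $B\to B/I$, where $I=B\,\big((f-g)(A)\big)\,B$ is the two-sided ideal of $B$ generated by the elements $f(a)-g(a)$, $a\in A$; the coproduct of a small family $(H_l)_{l\in J}$ has as underlying graded algebra $T\big(\bigoplus_{l\in J}H_l\big)/L$, where $T$ denotes the tensor algebra with the grading in which $x_1\otimes\cdots\otimes x_n$ has degree $h_1\cdots h_n$ for $x_i$ homogeneous of degree $h_i$, and $L$ is the two-sided ideal generated by the elements $x\cdot_{H_l}y-x\otimes y$ and $1_{T}-1_{H_l}$ for $l\in J$ and $x,y\in H_l$ (with $H_l$ regarded as a subspace of $T(\bigoplus_lH_l)$); the coprojection $q_l$ is the composite $H_l\to\bigoplus_lH_l\to T(\bigoplus_lH_l)\to T(\bigoplus_lH_l)/L$. 4. $\mathrm{Hopf_{coc}}(\mathrm{Vec}_G)$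 is locally presentable. 5. $\mathrm{Comon_{coc}}(\mathrm{Vec}_G)$ is finitely complete, with equalizers given by the same subspaces $K$ as in 2, and it is cartesian: $\Bbbk$ is a terminal object, and $A\otimes B$ with the projections $\mathrm{Id}_A\otimes\epsilon_B$ and $\epsilon_A\otimes\mathrm{Id}_B$ is the binary product of $A$ and $B$. The functor $\mathrm{Hopf_{coc}}(\mathrm{Vec}_G)\to\mathrm{Grp}(\mathrm{Comon_{coc}}(\mathrm{Vec}_G))$ to internal groups which keeps the underlying cocommutative comonoid, the multiplication and the unit, takes the antipode as inversion, and is the identity on underlying maps of morphisms, is an isomorphism of categories. 6. $\mathrm{Hopf_{coc}}(\mathrm{Vec}_G)$ is protomodular: it has pullbacks of split epimorphisms along arbitrary morphisms, and all inverse image functors of its fibration of points reflect isomorphisms. -/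

import Mathlib

open CategoryTheory MonoidalCategory Limits
open scoped TensorProduct DirectSum MonObj ComonObj

universe w v u

noncomputable section

/-- A commutation factor (skew-symmetric bicharacter) on an abelian group `G` with values in the
nonzero elements of the field `k`. -/
structure CommutationFactor (k : Type u) (G : Type u) [Field k] [CommGroup G] where
  toFun : G → G → kˣ
  mul_left : ∀ g h l, toFun (g * h) l = toFun g l * toFun h l
  mul_right : ∀ g h l, toFun g (h * l) = toFun g h * toFun g l
  skew : ∀ g h, toFun g h * toFun h g = 1

namespace CommutationFactor

variable {k G : Type u} [Field k] [CommGroup G] (φ : CommutationFactor k G)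

instance : CoeFun (CommutationFactor k G) (fun _ => G → G → kˣ) := ⟨toFun⟩

theorem one_left (g : G) : φ 1 g = 1 := by
  have h := φ.mul_left 1 1 g
  rw [mul_one] at h
  exact (mul_eq_left.mp h.symm)

theorem one_right (g : G) : φ g 1 = 1 := by
  have h := φ.mul_right g 1 1
  rw [mul_one] at h
  exact (mul_eq_left.mp h.symm)

end CommutationFactor

open Classical in
/-- `G`-graded vector spaces over `k`: a vector space which is the (internal) direct sum of a
family of subspaces indexed by `G`. The commutation factor `φ` is only recorded in order to select
the braiding of the category. -/
structure ColorVec {k G : Type u} [Field k] [CommGroup G] (φ : CommutationFactor k G) where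
  carrier : Type u
  [addCommGroup : AddCommGroup carrier]
  [module : Module k carrier]
  /-- the homogeneous components -/
  grading : G → Submodule k carrier
  isInternal : DirectSum.IsInternal grading

namespace ColorVec

/-- A family of subspaces is an internal direct sum as soon as it comes with projections. -/
theorem isInternal_of_proj {k G : Type*} [Field k] {M : Type*} [AddCommGroup M] [Module k M]
    [DecidableEq G]
    (𝒱 : G → Submodule k M) (p : G → M →ₗ[k] M)
    (h1 : ∀ g, ∀ x ∈ 𝒱 g, p g x = x) (h2 : ∀ g h, g ≠ h → ∀ x ∈ 𝒱 h, p g x = 0)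
    (h3 : ⨆ g, 𝒱 g = ⊤) : DirectSum.IsInternal 𝒱 := by
  rw [DirectSum.isInternal_submodule_iff_iSupIndep_and_iSup_eq_top]
  refine ⟨?_, h3⟩
  intro g
  rw [Submodule.disjoint_def]
  intro x hx hx'
  rw [← h1 g x hx]
  have : (⨆ j, ⨆ (_ : j ≠ g), 𝒱 j) ≤ LinearMap.ker (p g) := by
    refine iSup₂_le fun j hj y hy => ?_
    exact h2 g j hj.symm y hy
  exact this hx'

variable {k G : Type u} [Field k] [CommGroup G] {φ : CommutationFactor k G}

attribute [instance] ColorVec.addCommGroup ColorVec.module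

instance : CoeSort (ColorVec φ) (Type u) := ⟨carrier⟩

/-- Morphisms: linear maps preserving the gradings. -/
@[ext]
structure Hom (V W : ColorVec φ) where
  lin : V →ₗ[k] W
  map_mem : ∀ (g : G) (x : V), x ∈ V.grading g → lin x ∈ W.grading g

instance : Category (ColorVec φ) where
  Hom V W := Hom V W
  id V := ⟨LinearMap.id, fun _ _ h => h⟩
  comp f g := ⟨g.lin ∘ₗ f.lin, fun d x h => g.map_mem d _ (f.map_mem d x h)⟩

/-- The linear map underlying a morphism. -/
def Hom.toLin {V W : ColorVec φ} (f : V ⟶ W) : V →ₗ[k] W := Hom.lin f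

/-- Construct a morphism. -/
def ofLin {V W : ColorVec φ} (f : V →ₗ[k] W)
    (hf : ∀ (g : G) (x : V), x ∈ V.grading g → f x ∈ W.grading g) : V ⟶ W := Hom.mk f hf

@[simp] theorem toLin_ofLin {V W : ColorVec φ} (f : V →ₗ[k] W) (hf) :
    Hom.toLin (ofLin f hf) = f := rfl

@[simp] theorem toLin_id (V : ColorVec φ) : Hom.toLin (𝟙 V) = LinearMap.id := rfl

@[simp] theorem toLin_comp {V W Z : ColorVec φ} (f : V ⟶ W) (g : W ⟶ Z) :
    Hom.toLin (f ≫ g) = Hom.toLin g ∘ₗ Hom.toLin f := rfl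

theorem hom_ext {V W : ColorVec φ} {f g : V ⟶ W} (h : Hom.toLin f = Hom.toLin g) : f = g :=
  Hom.ext h

theorem toLin_mem {V W : ColorVec φ} (f : V ⟶ W) {g : G} {x : V} (hx : x ∈ V.grading g) :
    Hom.toLin f x ∈ W.grading g := Hom.map_mem f g x hx

theorem span_homogeneous (V : ColorVec φ) :
    Submodule.span k {x : V | ∃ g, x ∈ V.grading g} = ⊤ := by
  classical
  rw [eq_top_iff, ← V.isInternal.submodule_iSup_eq_top, iSup_le_iff]
  exact fun g x hx => Submodule.subset_span ⟨g, hx⟩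

theorem lin_ext (V : ColorVec φ) {M : Type*} [AddCommGroup M] [Module k M] {f g : V →ₗ[k] M}
    (h : ∀ d, ∀ x ∈ V.grading d, f x = g x) : f = g :=
  LinearMap.ext_on V.span_homogeneous (by rintro x ⟨d, hx⟩; exact h d x hx)

theorem tensor_ext (V W : ColorVec φ) {M : Type*} [AddCommGroup M] [Module k M]
    {f g : V ⊗[k] W →ₗ[k] M}
    (h : ∀ a, ∀ x ∈ V.grading a, ∀ b, ∀ y ∈ W.grading b, f (x ⊗ₜ y) = g (x ⊗ₜ y)) : f = g :=
  TensorProduct.ext <| V.lin_ext fun a x hx => W.lin_ext fun b y hy => h a x hx b y hy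

/-- The linear map on `V` which is given by `f g` on the component of degree `g`. -/
def glue (V : ColorVec φ) {M : Type*} [AddCommGroup M] [Module k M] (f : G → V →ₗ[k] M) :
    V →ₗ[k] M := by
  classical
  exact DirectSum.toModule k G M (fun g => f g ∘ₗ (V.grading g).subtype) ∘ₗ
    (LinearEquiv.ofBijective (DirectSum.coeLinearMap V.grading) V.isInternal).symm.toLinearMap

theorem glue_apply (V : ColorVec φ) {M : Type*} [AddCommGroup M] [Module k M]
    (f : G → V →ₗ[k] M) {g : G} {x : V} (hx : x ∈ V.grading g) : V.glue f x = f g x := by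
  classical
  have h : (LinearEquiv.ofBijective (DirectSum.coeLinearMap V.grading) V.isInternal).symm x =
      DirectSum.lof k G (fun i => V.grading i) g ⟨x, hx⟩ := by
    rw [LinearEquiv.symm_apply_eq]
    exact (DirectSum.coeLinearMap_lof V.grading g ⟨x, hx⟩).symm
  simp only [glue, LinearMap.comp_apply, LinearEquiv.coe_coe]
  rw [h]
  simp

/-- The grading of a tensor product: the component of degree `g` is spanned by the tensors
`x ⊗ y` with `x` of degree `a`, `y` of degree `b` and `a * b = g`. -/
def tensorGrading (V W : ColorVec φ) (g : G) : Submodule k (V ⊗[k] W) :=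
  Submodule.span k {t | ∃ a b, a * b = g ∧ ∃ x ∈ V.grading a, ∃ y ∈ W.grading b, t = x ⊗ₜ y}

theorem tmul_mem {V W : ColorVec φ} {a b : G} {x : V} {y : W} (hx : x ∈ V.grading a)
    (hy : y ∈ W.grading b) : x ⊗ₜ[k] y ∈ tensorGrading V W (a * b) :=
  Submodule.subset_span ⟨a, b, rfl, x, hx, y, hy, rfl⟩

theorem tmul_mem' {V W : ColorVec φ} {a b g : G} {x : V} {y : W} (hx : x ∈ V.grading a)
    (hy : y ∈ W.grading b) (h : a * b = g) : x ⊗ₜ[k] y ∈ tensorGrading V W g :=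
  h ▸ tmul_mem hx hy

theorem map_tensor_mem {V W : ColorVec φ} {M : Type*} [AddCommGroup M] [Module k M]
    (f : V ⊗[k] W →ₗ[k] M) (g : G) (N : Submodule k M)
    (h : ∀ a b, a * b = g → ∀ x ∈ V.grading a, ∀ y ∈ W.grading b, f (x ⊗ₜ y) ∈ N)
    (t : V ⊗[k] W) (ht : t ∈ tensorGrading V W g) : f t ∈ N := by
  have : tensorGrading V W g ≤ N.comap f := by
    refine Submodule.span_le.mpr ?_
    rintro _ ⟨a, b, hab, x, hx, y, hy, rfl⟩
    exact h a b hab x hx y hy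
  exact this ht

/-- The linear map on `V ⊗ W` which is given by `f a b` on `V_a ⊗ W_b`. -/
def glue₂ (V W : ColorVec φ) {M : Type*} [AddCommGroup M] [Module k M]
    (f : G → G → V →ₗ[k] W →ₗ[k] M) : V ⊗[k] W →ₗ[k] M :=
  TensorProduct.lift (V.glue fun a => (W.glue fun b => (f a b).flip).flip)

theorem glue₂_tmul (V W : ColorVec φ) {M : Type*} [AddCommGroup M] [Module k M]
    (f : G → G → V →ₗ[k] W →ₗ[k] M) {a b : G} {x : V} {y : W} (hx : x ∈ V.grading a)
    (hy : y ∈ W.grading b) : glue₂ V W f (x ⊗ₜ y) = f a b x y := by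
  simp only [glue₂, TensorProduct.lift.tmul]
  rw [glue_apply V _ hx, LinearMap.flip_apply, glue_apply W _ hy, LinearMap.flip_apply]

open Classical in
theorem tensorGrading_isInternal (V W : ColorVec φ) :
    DirectSum.IsInternal (tensorGrading V W) := by
  refine isInternal_of_proj _
    (fun g => glue₂ V W fun a b => if a * b = g then TensorProduct.mk k V W else 0) ?_ ?_ ?_
  · intro g x hx
    rw [← sub_eq_zero]
    refine map_tensor_mem (glue₂ V W (fun a b => if a * b = g then TensorProduct.mk k V W else 0)
      - LinearMap.id) g ⊥ ?_ x hx
    intro a b hab x hx y hy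
    simp [glue₂_tmul V W _ hx hy, hab]
  · intro g h hgh x hx
    refine map_tensor_mem (glue₂ V W (fun a b => if a * b = g then TensorProduct.mk k V W else 0))
      h ⊥ ?_ x hx
    intro a b hab x hx y hy
    have : a * b ≠ g := fun e => hgh (e ▸ hab)
    simp [glue₂_tmul V W _ hx hy, this]
  · have : (⨆ g, tensorGrading V W g).mkQ = 0 := by
      refine tensor_ext V W fun a x hx b y hy => ?_
      simp only [Submodule.mkQ_apply, LinearMap.zero_apply, Submodule.Quotient.mk_eq_zero]
      exact Submodule.mem_iSup_of_mem (a * b) (tmul_mem hx hy)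
    rw [← Submodule.ker_mkQ (⨆ g, tensorGrading V W g), this, LinearMap.ker_zero]

/-- The tensor product of graded vector spaces. -/
abbrev tensorObj (V W : ColorVec φ) : ColorVec φ where
  carrier := V ⊗[k] W
  grading := tensorGrading V W
  isInternal := tensorGrading_isInternal V W

variable (φ) in
/-- The grading of the unit object `k`, concentrated in degree `1`. -/
def unitGrading (g : G) : Submodule k k := ⨆ _ : g = 1, ⊤

theorem mem_unitGrading_one (x : k) : x ∈ unitGrading (1 : G) := by
  simp [unitGrading]

theorem mem_unitGrading {g : G} {x : k} : x ∈ unitGrading g ↔ g = 1 ∨ x = 0 := by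
  by_cases h : g = 1 <;> simp [unitGrading, h]

open Classical in
theorem unitGrading_isInternal : DirectSum.IsInternal (unitGrading (k := k) (G := G)) := by
  refine isInternal_of_proj _ (fun g => if g = 1 then LinearMap.id else 0) ?_ ?_ ?_
  · intro g x hx
    rcases mem_unitGrading.mp hx with h | h <;> simp [h]
  · intro g h hgh x hx
    rcases mem_unitGrading.mp hx with rfl | h
    · simp [hgh]
    · simp [h]
  · exact eq_top_iff.mpr fun x _ => Submodule.mem_iSup_of_mem 1 (mem_unitGrading_one x)

variable (φ) in
/-- The unit object: `k` concentrated in degree `1`. -/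
abbrev unit : ColorVec φ where
  carrier := k
  grading := unitGrading
  isInternal := unitGrading_isInternal

/-- Build an isomorphism from a linear equivalence preserving the gradings. -/
def isoMk {V W : ColorVec φ} (e : V ≃ₗ[k] W) (h : ∀ (g : G), ∀ x ∈ V.grading g, e x ∈ W.grading g)
    (h' : ∀ (g : G), ∀ x ∈ W.grading g, e.symm x ∈ V.grading g) : V ≅ W where
  hom := ofLin e.toLinearMap h
  inv := ofLin e.symm.toLinearMap h'
  hom_inv_id := hom_ext (by ext; simp)
  inv_hom_id := hom_ext (by ext; simp)

instance : MonoidalCategoryStruct (ColorVec φ) where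
  tensorObj := tensorObj
  tensorUnit := unit φ
  tensorHom {V V' W W'} f g := ofLin (V := tensorObj V W) (W := tensorObj V' W')
    (TensorProduct.map (Hom.toLin f) (Hom.toLin g)) (fun d => map_tensor_mem _ d _
      fun _ _ hab _ hx _ hy => tmul_mem' (toLin_mem f hx) (toLin_mem g hy) hab)
  whiskerLeft V {W W'} g := ofLin (V := tensorObj V W) (W := tensorObj V W')
    ((Hom.toLin g).lTensor V) (fun d => map_tensor_mem _ d _
      fun _ _ hab _ hx _ hy => tmul_mem' hx (toLin_mem g hy) hab)
  whiskerRight {V V'} f W := ofLin (V := tensorObj V W) (W := tensorObj V' W)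
    ((Hom.toLin f).rTensor W) (fun d => map_tensor_mem _ d _
      fun _ _ hab _ hx _ hy => tmul_mem' (toLin_mem f hx) hy hab)
  associator U V W := isoMk (V := tensorObj (tensorObj U V) W) (W := tensorObj U (tensorObj V W))
    (TensorProduct.assoc k U V W)
    (fun d => map_tensor_mem (V := tensorObj U V) (TensorProduct.assoc k U V W).toLinearMap d
      (tensorGrading U (tensorObj V W) d) fun c e hce t ht z hz => by
        refine map_tensor_mem ((TensorProduct.assoc k U V W).toLinearMap ∘ₗ
          (TensorProduct.mk k (U ⊗[k] V) W).flip z) c _ ?_ t ht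
        intro a b hab x hx y hy
        exact tmul_mem' (W := tensorObj V W) hx (tmul_mem hy hz) (by rw [← hce, ← hab, mul_assoc]))
    (fun d => map_tensor_mem (W := tensorObj V W) (TensorProduct.assoc k U V W).symm.toLinearMap d
      (tensorGrading (tensorObj U V) W d) fun c e hce x hx t ht => by
        refine map_tensor_mem ((TensorProduct.assoc k U V W).symm.toLinearMap ∘ₗ
          (TensorProduct.mk k U (V ⊗[k] W)) x) e _ ?_ t ht
        intro a b hab y hy z hz
        exact tmul_mem' (V := tensorObj U V) (tmul_mem hx hy) hz (by rw [← hce, ← hab, mul_assoc]))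
  leftUnitor V := isoMk (V := tensorObj (unit φ) V) (W := V) (TensorProduct.lid k V)
    (fun d => map_tensor_mem (V := unit φ) (TensorProduct.lid k V).toLinearMap d _
      fun a b hab c hc x hx => by
        rcases mem_unitGrading.mp hc with rfl | rfl
        · rw [one_mul] at hab
          subst hab
          exact Submodule.smul_mem _ _ hx
        · refine (congrArg (· ∈ V.grading d) ?_).mpr (Submodule.zero_mem _)
          exact _root_.zero_smul k x)
    (fun d x hx => tmul_mem' (V := unit φ) (mem_unitGrading_one (1 : k)) hx (one_mul d))
  rightUnitor V := isoMk (V := tensorObj V (unit φ)) (W := V) (TensorProduct.rid k V)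
    (fun d => map_tensor_mem (W := unit φ) (TensorProduct.rid k V).toLinearMap d _
      fun a b hab x hx c hc => by
        rcases mem_unitGrading.mp hc with rfl | rfl
        · rw [mul_one] at hab
          subst hab
          exact Submodule.smul_mem _ _ hx
        · refine (congrArg (· ∈ V.grading d) ?_).mpr (Submodule.zero_mem _)
          exact _root_.zero_smul k x)
    (fun d x hx => tmul_mem' (W := unit φ) hx (mem_unitGrading_one (1 : k)) (mul_one d))


instance : MonoidalCategory (ColorVec φ) :=
  MonoidalCategory.ofTensorHom
    (id_tensorHom_id := fun _ _ => hom_ext (TensorProduct.ext' fun _ _ => rfl))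
    (id_tensorHom := fun _ _ _ _ => hom_ext (TensorProduct.ext' fun _ _ => rfl))
    (tensorHom_id := fun _ _ => hom_ext (TensorProduct.ext' fun _ _ => rfl))
    (tensorHom_comp_tensorHom := fun _ _ _ _ => hom_ext (TensorProduct.ext' fun _ _ => rfl))
    (associator_naturality := fun _ _ _ =>
      hom_ext (TensorProduct.ext_threefold fun _ _ _ => rfl))
    (leftUnitor_naturality := fun f =>
      hom_ext (TensorProduct.ext' fun c x => ((Hom.toLin f).map_smul c x).symm))
    (rightUnitor_naturality := fun f =>
      hom_ext (TensorProduct.ext' fun x c => ((Hom.toLin f).map_smul c x).symm))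
    (pentagon := fun _ _ _ _ => hom_ext (TensorProduct.ext_fourfold fun _ _ _ _ => rfl))
    (triangle := fun _ _ => hom_ext (TensorProduct.ext_threefold fun x c y =>
      (TensorProduct.smul_tmul c x y).symm))

/-- The linear map `V ⊗ W → W ⊗ V` with `x ⊗ y ↦ φ (a, b) y ⊗ x` for `x` of degree `a` and `y` of
degree `b`. -/
def braidLin (V W : ColorVec φ) : V ⊗[k] W →ₗ[k] W ⊗[k] V :=
  glue₂ V W fun a b => (φ a b : k) • (TensorProduct.mk k W V).flip

theorem braidLin_tmul (V W : ColorVec φ) {a b : G} {x : V} {y : W} (hx : x ∈ V.grading a)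
    (hy : y ∈ W.grading b) : braidLin V W (x ⊗ₜ y) = (φ a b : k) • (y ⊗ₜ x) := by
  rw [braidLin, glue₂_tmul V W _ hx hy]
  rfl

theorem braidLin_braidLin (V W : ColorVec φ) : braidLin W V ∘ₗ braidLin V W = LinearMap.id := by
  refine tensor_ext V W fun a x hx b y hy => ?_
  rw [LinearMap.comp_apply, braidLin_tmul V W hx hy, map_smul, braidLin_tmul W V hy hx, smul_smul,
    ← Units.val_mul, φ.skew, Units.val_one, one_smul, LinearMap.id_apply]

theorem braidLin_mem (V W : ColorVec φ) (g : G) (t : V ⊗[k] W) (ht : t ∈ tensorGrading V W g) :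
    braidLin V W t ∈ tensorGrading W V g := by
  refine map_tensor_mem _ g _ (fun a b hab x hx y hy => ?_) t ht
  rw [braidLin_tmul V W hx hy]
  exact Submodule.smul_mem _ _ (tmul_mem' hy hx (by rw [mul_comm, hab]))

/-- The braiding determined by the commutation factor. -/
def braiding (V W : ColorVec φ) : tensorObj V W ≅ tensorObj W V :=
  isoMk (V := tensorObj V W) (W := tensorObj W V)
    (LinearEquiv.ofLinearMap (braidLin V W) (braidLin W V) (braidLin_braidLin W V)
      (braidLin_braidLin V W))
    (braidLin_mem V W) (braidLin_mem W V)

theorem tensor_ext₃ (U V W : ColorVec φ) {M : Type*} [AddCommGroup M] [Module k M]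
    {f g : (U ⊗[k] V) ⊗[k] W →ₗ[k] M}
    (h : ∀ a, ∀ x ∈ U.grading a, ∀ b, ∀ y ∈ V.grading b, ∀ c, ∀ z ∈ W.grading c,
      f (x ⊗ₜ y ⊗ₜ z) = g (x ⊗ₜ y ⊗ₜ z)) : f = g := by
  refine TensorProduct.ext (tensor_ext U V fun a x hx b y hy => W.lin_ext fun c z hz => ?_)
  exact h a x hx b y hy c z hz

theorem tensor_ext₃' (U V W : ColorVec φ) {M : Type*} [AddCommGroup M] [Module k M]
    {f g : U ⊗[k] (V ⊗[k] W) →ₗ[k] M}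
    (h : ∀ a, ∀ x ∈ U.grading a, ∀ b, ∀ y ∈ V.grading b, ∀ c, ∀ z ∈ W.grading c,
      f (x ⊗ₜ (y ⊗ₜ z)) = g (x ⊗ₜ (y ⊗ₜ z))) : f = g := by
  refine TensorProduct.ext (U.lin_ext fun a x hx => tensor_ext V W fun b y hy c z hz => ?_)
  exact h a x hx b y hy c z hz

instance : BraidedCategory (ColorVec φ) where
  braiding := braiding
  braiding_naturality_right U V W f := hom_ext <| tensor_ext U V fun a x hx b y hy => by
    change braidLin U W (x ⊗ₜ Hom.toLin f y) = (Hom.toLin f).rTensor U (braidLin U V (x ⊗ₜ y))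
    rw [braidLin_tmul U V hx hy, braidLin_tmul U W hx (toLin_mem f hy), map_smul]
    rfl
  braiding_naturality_left {U V} f W := hom_ext <| tensor_ext U W fun a x hx b y hy => by
    change braidLin V W (Hom.toLin f x ⊗ₜ y) = (Hom.toLin f).lTensor W (braidLin U W (x ⊗ₜ y))
    rw [braidLin_tmul U W hx hy, braidLin_tmul V W (toLin_mem f hx) hy, map_smul]
    rfl
  hexagon_forward U V W := hom_ext <| tensor_ext₃ U V W fun a x hx b y hy c z hz => by
    change TensorProduct.assoc k V W U (braidLin U (tensorObj V W) (x ⊗ₜ (y ⊗ₜ z))) =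
      (braidLin U W).lTensor V (TensorProduct.assoc k V U W
        ((braidLin U V).rTensor W ((x ⊗ₜ y) ⊗ₜ z)))
    rw [braidLin_tmul U (tensorObj V W) hx (tmul_mem hy hz), LinearMap.rTensor_tmul,
      braidLin_tmul U V hx hy, map_smul, ← TensorProduct.smul_tmul', map_smul, map_smul,
      TensorProduct.assoc_tmul, TensorProduct.assoc_tmul, LinearMap.lTensor_tmul,
      braidLin_tmul U W hx hz, TensorProduct.tmul_smul, smul_smul, φ.mul_right, Units.val_mul]
  hexagon_reverse U V W := hom_ext <| tensor_ext₃' U V W fun a x hx b y hy c z hz => by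
    change (TensorProduct.assoc k W U V).symm (braidLin (tensorObj U V) W ((x ⊗ₜ y) ⊗ₜ z)) =
      (braidLin U W).rTensor V ((TensorProduct.assoc k U W V).symm
        ((braidLin V W).lTensor U (x ⊗ₜ (y ⊗ₜ z))))
    rw [braidLin_tmul (tensorObj U V) W (tmul_mem hx hy) hz, LinearMap.lTensor_tmul,
      braidLin_tmul V W hy hz, map_smul, TensorProduct.tmul_smul, map_smul, map_smul,
      TensorProduct.assoc_symm_tmul, TensorProduct.assoc_symm_tmul, LinearMap.rTensor_tmul,
      braidLin_tmul U W hx hz, ← TensorProduct.smul_tmul', smul_smul, φ.mul_left, Units.val_mul,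
      mul_comm]

instance : SymmetricCategory (ColorVec φ) where
  symmetry V W := hom_ext (braidLin_braidLin V W)

end ColorVec

namespace CommComonCartesian

theorem pair_fst_aux {C : Type u} [Category.{v} C] [MonoidalCategory C] {T A B : C} [ComonObj T] [ComonObj B]
    (f : T ⟶ A) (g : T ⟶ B) (hg : IsComonHom g) :
    (Δ[T] ≫ (f ⊗ₘ g)) ≫ (A ◁ ε[B]) ≫ (ρ_ A).hom = f := by
  rw [← id_tensorHom, Category.assoc, tensorHom_comp_tensorHom_assoc, Category.comp_id,
    hg.hom_counit, ComonObj.comul_counit_hom_assoc, Iso.inv_hom_id, Category.comp_id]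

theorem pair_snd_aux {C : Type u} [Category.{v} C] [MonoidalCategory C] {T A B : C} [ComonObj T] [ComonObj A]
    (f : T ⟶ A) (g : T ⟶ B) (hf : IsComonHom f) :
    (Δ[T] ≫ (f ⊗ₘ g)) ≫ (ε[A] ▷ B) ≫ (λ_ B).hom = g := by
  rw [← tensorHom_id, Category.assoc, tensorHom_comp_tensorHom_assoc, Category.comp_id,
    hf.hom_counit, ComonObj.counit_comul_hom_assoc, Iso.inv_hom_id, Category.comp_id]

variable {C : Type u} [Category.{v} C] [MonoidalCategory C] [SymmetricCategory C]

theorem comul_comul_comul_comm (A : C) [ComonObj A] [IsCommComonObj A] :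
    Δ[A] ≫ (Δ[A] ⊗ₘ Δ[A]) ≫ tensorμ A A A A = Δ[A] ≫ (Δ[A] ⊗ₘ Δ[A]) := by
  let : MonObj (Opposite.op A) := Comon.ComonToMonOpOpObjMon (Comon.mk A)
  have : IsCommMonObj (Opposite.op A) := ⟨Quiver.Hom.unop_inj (by
    change Δ[A] ≫ (β_ A A).hom = Δ[A]
    exact IsCommComonObj.comul_comm A)⟩
  have h := congrArg Quiver.Hom.unop (MonObj.mul_mul_mul_comm (Opposite.op A))
  rw [unop_comp, unop_comp, BraidedCategory.unop_tensorμ, Category.assoc] at h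
  exact h

/-- The comultiplication of a cocommutative comonoid is a morphism of comonoids. -/
theorem isComonHom_comul (A : C) [ComonObj A] [IsCommComonObj A] : IsComonHom Δ[A] where
  hom_counit := by
    rw [Comon.tensorObj_counit, ComonObj.counit_comul_hom_assoc,
      Iso.inv_hom_id, Category.comp_id]
  hom_comul := by
    rw [Comon.tensorObj_comul, comul_comul_comul_comm]

theorem isComonHom_tensorHom {A B A' B' : C} [ComonObj A] [ComonObj B] [ComonObj A'] [ComonObj B']
    (f : A ⟶ A') (g : B ⟶ B') [IsComonHom f] [IsComonHom g] : IsComonHom (f ⊗ₘ g) :=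
  let f' : Comon.mk A ⟶ Comon.mk A' := Comon.Hom.mk f
  let g' : Comon.mk B ⟶ Comon.mk B' := Comon.Hom.mk g
  Comon.Hom.isComonHom_hom (f' ⊗ₘ g')

theorem isComonHom_fst (A B : C) [ComonObj A] [ComonObj B] :
    IsComonHom ((A ◁ ε[B]) ≫ (ρ_ A).hom) where
  hom_counit := by
    rw [Comon.tensorObj_counit, MonoidalCategory.tensorHom_def', unitors_equal, Category.assoc,
      Category.assoc, rightUnitor_naturality]
  hom_comul := by
    rw [Comon.tensorObj_comul, Category.assoc, Category.assoc,
      ← MonoidalCategory.tensorHom_comp_tensorHom, ← id_tensorHom,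
      ← reassoc_of% tensorμ_natural (𝟙 A) (𝟙 A) ε[B] ε[B],
      MonoidalCategory.tensorHom_comp_tensorHom_assoc, ComonObj.counit_comul_hom,
      id_tensorHom_id, Category.comp_id, id_tensorHom, ← rightUnitor_naturality, tensorμ,
      braiding_tensorUnit_right, MonoidalCategory.tensorHom_def']
    monoidal

theorem isComonHom_snd (A B : C) [ComonObj A] [ComonObj B] :
    IsComonHom ((ε[A] ▷ B) ≫ (λ_ B).hom) where
  hom_counit := by
    rw [Comon.tensorObj_counit, MonoidalCategory.tensorHom_def, Category.assoc,
      Category.assoc, leftUnitor_naturality]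
  hom_comul := by
    rw [Comon.tensorObj_comul, Category.assoc, Category.assoc,
      ← MonoidalCategory.tensorHom_comp_tensorHom, ← tensorHom_id,
      ← reassoc_of% tensorμ_natural ε[A] ε[A] (𝟙 B) (𝟙 B),
      MonoidalCategory.tensorHom_comp_tensorHom_assoc, ComonObj.counit_comul_hom,
      id_tensorHom_id, Category.comp_id, tensorHom_id, ← leftUnitor_naturality, tensorμ,
      braiding_tensorUnit_left, MonoidalCategory.tensorHom_def]
    monoidal

theorem isComonHom_pair {T A B : C} [ComonObj T] [IsCommComonObj T] [ComonObj A] [ComonObj B]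
    (f : T ⟶ A) (g : T ⟶ B) (_ : IsComonHom f) (_ : IsComonHom g) :
    IsComonHom (Δ[T] ≫ (f ⊗ₘ g)) :=
  have := isComonHom_comul T
  have := isComonHom_tensorHom f g
  inferInstance

theorem comul_fst_snd (A B : C) [ComonObj A] [ComonObj B] :
    Δ[A ⊗ B] ≫ (((A ◁ ε[B]) ≫ (ρ_ A).hom) ⊗ₘ ((ε[A] ▷ B) ≫ (λ_ B).hom)) = 𝟙 (A ⊗ B) := by
  rw [Comon.tensorObj_comul, Category.assoc, ← tensorHom_comp_tensorHom, ← id_tensorHom,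
    ← tensorHom_id]
  have h := tensorμ_natural (𝟙 A) ε[A] ε[B] (𝟙 B)
  rw [← reassoc_of% h]
  rw [tensorHom_comp_tensorHom_assoc]
  simp only [id_tensorHom, tensorHom_id, ComonObj.comul_counit, ComonObj.counit_comul]
  rw [tensorμ, braiding_tensorUnit_left]
  monoidal

theorem pair_eta_aux {T A B : C} [ComonObj T] [ComonObj A] [ComonObj B]
    (m : T ⟶ A ⊗ B) (hm : IsComonHom m) :
    m = Δ[T] ≫ ((m ≫ (A ◁ ε[B]) ≫ (ρ_ A).hom) ⊗ₘ (m ≫ (ε[A] ▷ B) ≫ (λ_ B).hom)) := by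
  rw [← tensorHom_comp_tensorHom, ← Category.assoc, ← hm.hom_comul, Category.assoc, comul_fst_snd,
    Category.comp_id]

/-- The tensor product of cocommutative comonoids. -/
abbrev tensor (A B : CommComon C) : CommComon C := ⟨A.X ⊗ B.X⟩

/-- A morphism of comonoids, as a morphism of cocommutative comonoids. -/
def homMk {A B : CommComon C} (f : A.X ⟶ B.X) (h : IsComonHom f) : A ⟶ B :=
  ⟨@Comon.Hom.mk _ _ _ A.toComon B.toComon f h⟩

/-- The morphism in `C` underlying a morphism of cocommutative comonoids. -/
def homX {A B : CommComon C} (f : A ⟶ B) : A.X ⟶ B.X := f.hom.hom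

theorem isComonHom_homX {A B : CommComon C} (f : A ⟶ B) : IsComonHom (homX f) :=
  f.hom.isComonHom_hom

theorem homX_ext {A B : CommComon C} {f g : A ⟶ B} (h : homX f = homX g) : f = g :=
  CommComon.hom_ext _ _ h

/-- The morphism to the unit object given by the counit. -/
def toUnit (A : CommComon C) : A ⟶ CommComon.trivial C :=
  ⟨(default : A.toComon ⟶ Comon.trivial C)⟩

/-- The projection `A ⊗ B ⟶ A` induced by the counit of `B`. -/
def fst (A B : CommComon C) : tensor A B ⟶ A :=
  homMk ((A.X ◁ ε[B.X]) ≫ (ρ_ A.X).hom) (isComonHom_fst A.X B.X)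

/-- The projection `A ⊗ B ⟶ B` induced by the counit of `A`. -/
def snd (A B : CommComon C) : tensor A B ⟶ B :=
  homMk ((ε[A.X] ▷ B.X) ≫ (λ_ B.X).hom) (isComonHom_snd A.X B.X)

/-- The pairing of `f` and `g` is `(f ⊗ g) ∘ Δ`. -/
def pair {T A B : CommComon C} (f : T ⟶ A) (g : T ⟶ B) : T ⟶ tensor A B :=
  homMk (Δ[T.X] ≫ (homX f ⊗ₘ homX g))
    (isComonHom_pair _ _ (isComonHom_homX f) (isComonHom_homX g))

theorem toUnit_uniq {A : CommComon C} (f : A ⟶ CommComon.trivial C) : f = toUnit A :=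
  InducedCategory.hom_ext ((Comon.uniqueHomToTrivial A.toComon).uniq f.hom)

theorem pair_fst {T A B : CommComon C} (f : T ⟶ A) (g : T ⟶ B) : pair f g ≫ fst A B = f :=
  homX_ext (pair_fst_aux (homX f) (homX g) (isComonHom_homX g))

theorem pair_snd {T A B : CommComon C} (f : T ⟶ A) (g : T ⟶ B) : pair f g ≫ snd A B = g :=
  homX_ext (pair_snd_aux (homX f) (homX g) (isComonHom_homX f))

theorem pair_eta {T A B : CommComon C} (m : T ⟶ tensor A B) :
    m = pair (m ≫ fst A B) (m ≫ snd A B) :=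
  homX_ext (pair_eta_aux (homX m) (isComonHom_homX m))

/-- Cocommutative comonoids in a symmetric monoidal category form a cartesian monoidal category:
the unit object is terminal and the tensor product is the binary product. -/
instance : CartesianMonoidalCategory (CommComon C) :=
  CartesianMonoidalCategory.ofChosenFiniteProducts
    ⟨asEmptyCone (CommComon.trivial C), IsTerminal.ofUniqueHom toUnit fun _ f => toUnit_uniq f⟩
    fun A B => ⟨BinaryFan.mk (fst A B) (snd A B),
      BinaryFan.isLimitMk (fun s => pair s.fst s.snd) (fun s => pair_fst _ _)
        (fun s => pair_snd _ _) (fun s m h1 h2 => by rw [pair_eta m, h1, h2])⟩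

theorem lift_eq {T A B : CommComon C} (f : T ⟶ A) (g : T ⟶ B) :
    CartesianMonoidalCategory.lift f g = pair f g := by
  refine CartesianMonoidalCategory.hom_ext _ _ ?_ ?_
  · rw [CartesianMonoidalCategory.lift_fst]
    exact (pair_fst f g).symm
  · rw [CartesianMonoidalCategory.lift_snd]
    exact (pair_snd f g).symm

theorem isComonHom_associator (A B D : C) [ComonObj A] [ComonObj B] [ComonObj D] :
    IsComonHom (α_ A B D).hom := by
  have h : IsComonHom ((𝟙 (A ⊗ B) ▷ D) ≫ (α_ A B D).hom ≫ (A ◁ 𝟙 (B ⊗ D))) :=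
    (α_ (Comon.mk A) (Comon.mk B) (Comon.mk D)).hom.isComonHom_hom
  rw [MonoidalCategory.id_whiskerRight, MonoidalCategory.whiskerLeft_id, Category.id_comp,
    Category.comp_id] at h
  exact h

theorem homX_comp {A B D : CommComon C} (f : A ⟶ B) (g : B ⟶ D) :
    homX (f ≫ g) = homX f ≫ homX g := rfl

theorem homX_whiskerRight {A A' : CommComon C} (f : A ⟶ A') (B : CommComon C) :
    homX (f ▷ B) = homX f ▷ B.X := by
  have := isComonHom_homX f
  have h : IsComonHom (homX f ▷ B.X) := by
    rw [← tensorHom_id]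
    exact isComonHom_tensorHom (homX f) (𝟙 B.X)
  have h' : f ▷ B = homMk (A := tensor A B) (B := tensor A' B) (homX f ▷ B.X) h := by
    refine CartesianMonoidalCategory.hom_ext _ _ ?_ ?_
    · rw [CartesianMonoidalCategory.whiskerRight_fst]
      refine homX_ext ?_
      change ((A.X ◁ ε[B.X]) ≫ (ρ_ A.X).hom) ≫ homX f =
        homX f ▷ B.X ≫ (A'.X ◁ ε[B.X]) ≫ (ρ_ A'.X).hom
      rw [← whisker_exchange_assoc, rightUnitor_naturality, Category.assoc]
    · rw [CartesianMonoidalCategory.whiskerRight_snd]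
      refine homX_ext ?_
      change ((ε[A.X] ▷ B.X) ≫ (λ_ B.X).hom) =
        homX f ▷ B.X ≫ (ε[A'.X] ▷ B.X) ≫ (λ_ B.X).hom
      rw [← comp_whiskerRight_assoc, IsComonHom.hom_counit]
  rw [h']
  rfl

theorem homX_whiskerLeft (B : CommComon C) {A A' : CommComon C} (f : A ⟶ A') :
    homX (B ◁ f) = B.X ◁ homX f := by
  have := isComonHom_homX f
  have h : IsComonHom (B.X ◁ homX f) := by
    rw [← id_tensorHom]
    exact isComonHom_tensorHom (𝟙 B.X) (homX f)
  have h' : B ◁ f = homMk (A := tensor B A) (B := tensor B A') (B.X ◁ homX f) h := by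
    refine CartesianMonoidalCategory.hom_ext _ _ ?_ ?_
    · rw [CartesianMonoidalCategory.whiskerLeft_fst]
      refine homX_ext ?_
      change ((B.X ◁ ε[A.X]) ≫ (ρ_ B.X).hom) =
        B.X ◁ homX f ≫ (B.X ◁ ε[A'.X]) ≫ (ρ_ B.X).hom
      rw [← whiskerLeft_comp_assoc, IsComonHom.hom_counit]
    · rw [CartesianMonoidalCategory.whiskerLeft_snd]
      refine homX_ext ?_
      change ((ε[B.X] ▷ A.X) ≫ (λ_ A.X).hom) ≫ homX f =
        B.X ◁ homX f ≫ (ε[B.X] ▷ A'.X) ≫ (λ_ A'.X).hom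
      rw [whisker_exchange_assoc, leftUnitor_naturality, Category.assoc]
  rw [h']
  rfl

theorem homX_leftUnitor (A : CommComon C) : homX (λ_ A).hom = (λ_ A.X).hom := by
  rw [CartesianMonoidalCategory.leftUnitor_hom]
  change (𝟙 (𝟙_ C) ▷ A.X) ≫ (λ_ A.X).hom = (λ_ A.X).hom
  rw [id_whiskerRight, Category.id_comp]

theorem homX_rightUnitor (A : CommComon C) : homX (ρ_ A).hom = (ρ_ A.X).hom := by
  rw [CartesianMonoidalCategory.rightUnitor_hom]
  change (A.X ◁ 𝟙 (𝟙_ C)) ≫ (ρ_ A.X).hom = (ρ_ A.X).hom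
  rw [whiskerLeft_id, Category.id_comp]

theorem homX_associator (A B D : CommComon C) :
    homX (α_ A B D).hom = (α_ A.X B.X D.X).hom := by
  have h' : (α_ A B D).hom = homMk (A := tensor (tensor A B) D) (B := tensor A (tensor B D))
      (α_ A.X B.X D.X).hom (isComonHom_associator _ _ _) := by
    refine CartesianMonoidalCategory.hom_ext _ _ ?_
      (CartesianMonoidalCategory.hom_ext _ _ ?_ ?_)
    · rw [CartesianMonoidalCategory.associator_hom_fst]
      refine homX_ext ?_
      change (((A.X ⊗ B.X) ◁ ε[D.X]) ≫ (ρ_ (A.X ⊗ B.X)).hom) ≫ (A.X ◁ ε[B.X]) ≫ (ρ_ A.X).hom =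
        (α_ A.X B.X D.X).hom ≫ (A.X ◁ ε[B.X ⊗ D.X]) ≫ (ρ_ A.X).hom
      rw [Comon.tensorObj_counit, tensorHom_def']
      monoidal
    · rw [Category.assoc, CartesianMonoidalCategory.associator_hom_snd_fst]
      refine homX_ext ?_
      change (((A.X ⊗ B.X) ◁ ε[D.X]) ≫ (ρ_ (A.X ⊗ B.X)).hom) ≫ (ε[A.X] ▷ B.X) ≫ (λ_ B.X).hom =
        ((α_ A.X B.X D.X).hom ≫ (ε[A.X] ▷ (B.X ⊗ D.X)) ≫ (λ_ (B.X ⊗ D.X)).hom) ≫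
          (B.X ◁ ε[D.X]) ≫ (ρ_ B.X).hom
      rw [Category.assoc, ← rightUnitor_naturality_assoc, whisker_exchange_assoc]
      monoidal
    · rw [Category.assoc, CartesianMonoidalCategory.associator_hom_snd_snd]
      refine homX_ext ?_
      change (ε[A.X ⊗ B.X] ▷ D.X) ≫ (λ_ D.X).hom =
        ((α_ A.X B.X D.X).hom ≫ (ε[A.X] ▷ (B.X ⊗ D.X)) ≫ (λ_ (B.X ⊗ D.X)).hom) ≫
          (ε[B.X] ▷ D.X) ≫ (λ_ D.X).hom
      rw [Comon.tensorObj_counit, MonoidalCategory.tensorHom_def]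
      monoidal
  rw [h']
  rfl

end CommComonCartesian

section HopfCoc

variable (C : Type u) [Category.{v} C] [MonoidalCategory C] [SymmetricCategory C]

/-- The category of cocommutative Hopf monoids in a symmetric monoidal category. -/
abbrev HopfCoc : Type _ := ObjectProperty.FullSubcategory fun H : Hopf C => IsCommComonObj H.X

end HopfCoc

namespace HopfCoc

variable {C : Type u} [Category.{v} C] [MonoidalCategory C] [SymmetricCategory C]

open CommComonCartesian

/-- The morphism in `C` underlying a morphism of Hopf monoids. -/
def underlying {A B : Hopf C} (f : A ⟶ B) : A.X ⟶ B.X := f.hom.hom.hom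

theorem isMonHom_underlying {A B : Hopf C} (f : A ⟶ B) : IsMonHom (underlying f) :=
  f.hom.hom.isMonHom_hom

theorem isComonHom_underlying {A B : Hopf C} (f : A ⟶ B) : IsComonHom (underlying f) where
  hom_counit := congrArg Mon.Hom.hom (IsComonHom.hom_counit (self := f.hom.isComonHom_hom))
  hom_comul := congrArg Mon.Hom.hom (IsComonHom.hom_comul (self := f.hom.isComonHom_hom))

instance (H : HopfCoc C) : IsCommComonObj H.obj.X := H.property

/-- The underlying cocommutative comonoid. -/
abbrev toCommComon (H : HopfCoc C) : CommComon C := ⟨H.obj.X⟩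

theorem isComonHom_antipode (H : HopfCoc C) : IsComonHom (HopfObj.antipode (X := H.obj.X)) where
  hom_counit := HopfObj.antipode_counit _
  hom_comul := by rw [HopfObj.antipode_comul, IsCommComonObj.comul_comm_assoc]

theorem isComonHom_mul (X : C) [BimonObj X] : IsComonHom μ[X] where
  hom_counit := BimonObj.mul_counit X
  hom_comul := by rw [BimonObj.mul_comul, Comon.tensorObj_comul, Category.assoc]

attribute [local instance] ComonObj.instTensorUnit in
theorem isComonHom_one (X : C) [BimonObj X] : IsComonHom η[X] where
  hom_counit := BimonObj.one_counit X
  hom_comul := Bimon.one_comul X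

/-- A cocommutative Hopf monoid is a group object in cocommutative comonoids, with inversion given
by the antipode. -/
instance grpObj (H : HopfCoc C) : GrpObj H.toCommComon where
  one := homMk η[H.obj.X] (isComonHom_one H.obj.X)
  mul := homMk (A := tensor H.toCommComon H.toCommComon) μ[H.obj.X] (isComonHom_mul H.obj.X)
  one_mul := homX_ext (by
    rw [homX_comp, homX_whiskerRight, homX_leftUnitor]
    exact MonObj.one_mul H.obj.X)
  mul_one := homX_ext (by
    rw [homX_comp, homX_whiskerLeft, homX_rightUnitor]
    exact MonObj.mul_one H.obj.X)
  mul_assoc := homX_ext (by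
    rw [homX_comp, homX_whiskerRight, homX_comp, homX_comp, homX_associator, homX_whiskerLeft]
    exact MonObj.mul_assoc H.obj.X)
  inv := homMk HopfObj.antipode H.isComonHom_antipode
  left_inv := by
    rw [lift_eq]
    refine homX_ext ?_
    change (Δ[H.obj.X] ≫ (HopfObj.antipode ⊗ₘ 𝟙 H.obj.X)) ≫ μ[H.obj.X] = ε[H.obj.X] ≫ η[H.obj.X]
    rw [tensorHom_id, Category.assoc, HopfObj.antipode_left]
  right_inv := by
    rw [lift_eq]
    refine homX_ext ?_
    change (Δ[H.obj.X] ≫ (𝟙 H.obj.X ⊗ₘ HopfObj.antipode)) ≫ μ[H.obj.X] = ε[H.obj.X] ≫ η[H.obj.X]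
    rw [id_tensorHom, Category.assoc, HopfObj.antipode_right]

/-- The group object underlying a cocommutative Hopf monoid. -/
abbrev grp (H : HopfCoc C) : Grp (CommComon C) := @Grp.mk _ _ _ H.toCommComon H.grpObj

/-- The morphism of group objects underlying a morphism of cocommutative Hopf monoids. -/
def grpHom {A B : HopfCoc C} (f : A ⟶ B) : A.grp ⟶ B.grp :=
  Grp.homMk'' (A := A.grp) (B := B.grp)
    (homMk (A := A.toCommComon) (B := B.toCommComon) (underlying f.hom) (isComonHom_underlying f.hom))
    (homX_ext (isMonHom_underlying f.hom).one_hom)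
    (homX_ext (by
      rw [homX_comp, homX_comp, MonoidalCategory.tensorHom_def, homX_comp, homX_whiskerLeft,
        homX_whiskerRight, ← MonoidalCategory.tensorHom_def]
      exact (isMonHom_underlying f.hom).mul_hom))

/-- The functor from cocommutative Hopf monoids to group objects in cocommutative comonoids; it is
the identity on underlying objects, structure morphisms and morphisms. -/
def toGrp : HopfCoc C ⥤ Grp (CommComon C) where
  obj H := H.grp
  map f := grpHom f

end HopfCoc

section Protomodular

variable {C : Type w} [Category.{v} C]

/-- A point over `B`: a split epimorphism with codomain `B`, together with a chosen section. -/
structure PointOver (B : C) where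
  X : C
  p : X ⟶ B
  s : B ⟶ X
  fac : s ≫ p = 𝟙 B

/-- Morphisms of points over a fixed object. -/
@[ext]
structure PointOver.Hom {B : C} (P Q : PointOver B) where
  f : P.X ⟶ Q.X
  f_p : f ≫ Q.p = P.p
  s_f : P.s ≫ f = Q.s

instance (B : C) : Category (PointOver B) where
  Hom := PointOver.Hom
  id P := ⟨𝟙 P.X, Category.id_comp _, Category.comp_id _⟩
  comp f g := ⟨f.f ≫ g.f, by rw [Category.assoc, g.f_p, f.f_p],
    by rw [← Category.assoc, f.s_f, g.s_f]⟩
  id_comp f := PointOver.Hom.ext (Category.id_comp _)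
  comp_id f := PointOver.Hom.ext (Category.comp_id _)
  assoc f g h := PointOver.Hom.ext (Category.assoc _ _ _)

variable (C) in
/-- Every split epimorphism has a pullback along every morphism with the same codomain. -/
class HasPullbacksOfSplitEpis : Prop where
  hasPullback : ∀ {A B : C} (P : PointOver B) (f : A ⟶ B), HasPullback P.p f

attribute [instance] HasPullbacksOfSplitEpis.hasPullback

theorem PointOver.inverseImage_aux {A B : C} (P : PointOver B) (f : A ⟶ B) :
    (f ≫ P.s) ≫ P.p = 𝟙 A ≫ f := by
  rw [Category.assoc, P.fac, Category.comp_id, Category.id_comp]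

theorem PointOver.inverseImage_aux' {A B : C} (P : PointOver B) (f : A ⟶ B) [HasPullback P.p f]
    {Q : PointOver B} (g : P ⟶ Q) :
    (pullback.fst P.p f ≫ g.f) ≫ Q.p = pullback.snd P.p f ≫ f := by
  rw [Category.assoc, g.f_p, pullback.condition]

/-- The morphism of pullbacks induced by a morphism of points. -/
def PointOver.pullbackMap [HasPullbacksOfSplitEpis C] {A B : C} (f : A ⟶ B) {P Q : PointOver B}
    (g : P ⟶ Q) : pullback P.p f ⟶ pullback Q.p f :=
  pullback.lift (pullback.fst P.p f ≫ g.f) (pullback.snd P.p f) (P.inverseImage_aux' f g)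

theorem PointOver.pullbackMap_fst [HasPullbacksOfSplitEpis C] {A B : C} (f : A ⟶ B)
    {P Q : PointOver B} (g : P ⟶ Q) :
    pullbackMap f g ≫ pullback.fst Q.p f = pullback.fst P.p f ≫ g.f := pullback.lift_fst _ _ _

theorem PointOver.pullbackMap_snd [HasPullbacksOfSplitEpis C] {A B : C} (f : A ⟶ B)
    {P Q : PointOver B} (g : P ⟶ Q) :
    pullbackMap f g ≫ pullback.snd Q.p f = pullback.snd P.p f := pullback.lift_snd _ _ _

/-- The inverse image functor `f^* : Pt(B) ⥤ Pt(A)` of the fibration of points along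
`f : A ⟶ B`. -/
def PointOver.inverseImage [HasPullbacksOfSplitEpis C] {A B : C} (f : A ⟶ B) :
    PointOver B ⥤ PointOver A where
  obj P :=
    { X := pullback P.p f
      p := pullback.snd P.p f
      s := pullback.lift (f ≫ P.s) (𝟙 A) (P.inverseImage_aux f)
      fac := pullback.lift_snd _ _ _ }
  map {P Q} g :=
    { f := pullbackMap f g
      f_p := pullbackMap_snd f g
      s_f := pullback.hom_ext
        (by rw [Category.assoc, pullbackMap_fst, pullback.lift_fst_assoc, pullback.lift_fst,
          Category.assoc, g.s_f])
        (by rw [Category.assoc, pullbackMap_snd, pullback.lift_snd, pullback.lift_snd]) }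
  map_id P := PointOver.Hom.ext (pullback.hom_ext
    ((pullbackMap_fst f (𝟙 P)).trans ((Category.comp_id _).trans (Category.id_comp _).symm))
    ((pullbackMap_snd f (𝟙 P)).trans (Category.id_comp _).symm))
  map_comp {P Q R} g h := PointOver.Hom.ext (pullback.hom_ext
    (by
      change pullbackMap f (g ≫ h) ≫ _ = (pullbackMap f g ≫ pullbackMap f h) ≫ _
      rw [Category.assoc, pullbackMap_fst, pullbackMap_fst, ← Category.assoc, pullbackMap_fst,
        Category.assoc]
      rfl)
    (by
      change pullbackMap f (g ≫ h) ≫ _ = (pullbackMap f g ≫ pullbackMap f h) ≫ _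
      rw [Category.assoc, pullbackMap_snd, pullbackMap_snd, pullbackMap_snd]))

variable (C) in
/-- A category is protomodular if it has pullbacks of split epimorphisms along arbitrary morphisms
and all inverse image functors of its fibration of points reflect isomorphisms. -/
class IsProtomodular : Prop extends HasPullbacksOfSplitEpis C where
  reflectsIsomorphisms : ∀ {A B : C} (f : A ⟶ B),
    (PointOver.inverseImage f).ReflectsIsomorphisms

end Protomodular

/-- Cocommutativity of a Hopf monoid, with the structure given explicitly. -/
abbrev HopfIsCocommutative {C : Type w} [Category.{v} C] [MonoidalCategory C] [SymmetricCategory C]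
    {X : C} (h : HopfObj X) : Prop := @IsCommComonObj C _ _ _ X h.toComonObj

/-- The cocommutative Hopf monoid with underlying object `X` and structure `h`. -/
abbrev HopfCoc.of {C : Type w} [Category.{v} C] [MonoidalCategory C] [SymmetricCategory C]
    {X : C} (h : HopfObj X) (hc : HopfIsCocommutative h) : HopfCoc C := ⟨@Hopf.mk _ _ _ _ X h, hc⟩

section TensorHopf

variable {C : Type w} [Category.{v} C] [MonoidalCategory C] [BraidedCategory C]

/-- The unit object with the structure of Hopf monoid for which all structure morphisms are the
canonical ones. -/
structure IsUnitHopf (h : HopfObj (𝟙_ C)) : Prop where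
  mul_eq : h.mul = (λ_ (𝟙_ C)).hom
  one_eq : h.one = 𝟙 (𝟙_ C)
  comul_eq : h.comul = (λ_ (𝟙_ C)).inv
  counit_eq : h.counit = 𝟙 (𝟙_ C)
  antipode_eq : h.antipode = 𝟙 (𝟙_ C)

/-- The structure of Hopf monoid `h` on `A ⊗ B` is the tensor product of those of `A` and `B`. Here
`tensorμ X Y Z W` is the morphism `(X ⊗ Y) ⊗ (Z ⊗ W) ⟶ (X ⊗ Z) ⊗ (Y ⊗ W)` induced by the braiding of
`Y` and `Z`. -/
structure IsTensorHopf (A B : C) [HopfObj A] [HopfObj B] (h : HopfObj (A ⊗ B)) : Prop where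
  mul_eq : h.mul = tensorμ A B A B ≫ (μ[A] ⊗ₘ μ[B])
  one_eq : h.one = (ρ_ (𝟙_ C)).inv ≫ (η[A] ⊗ₘ η[B])
  comul_eq : h.comul = (Δ[A] ⊗ₘ Δ[B]) ≫ tensorμ A A B B
  counit_eq : h.counit = (ε[A] ⊗ₘ ε[B]) ≫ (ρ_ (𝟙_ C)).hom
  antipode_eq : h.antipode = (HopfObj.antipode (X := A) ⊗ₘ HopfObj.antipode (X := B))

end TensorHopf

namespace ColorVec

variable {k G : Type u} [Field k] [CommGroup G] {φ : CommutationFactor k G}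

/-- The product of two elements of a graded algebra. -/
def mulElt (A : ColorVec φ) [MonObj A] (x y : A) : A := Hom.toLin μ[A] (x ⊗ₜ[k] y)

/-- The unit element of a graded algebra. -/
def oneElt (A : ColorVec φ) [MonObj A] : A := Hom.toLin η[A] (1 : k)

/-- The comultiplication of a graded coalgebra, as a linear map. -/
def comulLin (A : ColorVec φ) [ComonObj A] : A →ₗ[k] A ⊗[k] A := Hom.toLin Δ[A]

/-- `i` identifies `V` with the graded subspace `K` of `W`, with the induced grading
`K_g = K ∩ W_g`. -/
structure IsGradedSubspace {V W : ColorVec φ} (i : V →ₗ[k] W) (K : Submodule k W) : Prop where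
  injective : Function.Injective i
  range_eq : LinearMap.range i = K
  grading_eq : ∀ g, (V.grading g).map i = K ⊓ W.grading g

/-- `p` identifies `W` with the quotient `V / I`, where `I` is a graded subspace of `V`, with the
induced grading `(V / I)_g = p (V_g)`. -/
structure IsGradedQuotient {V W : ColorVec φ} (p : V →ₗ[k] W) (I : Submodule k V) : Prop where
  surjective : Function.Surjective p
  ker_eq : LinearMap.ker p = I
  grading_eq : ∀ g, W.grading g = (V.grading g).map p

/-- For linear maps `f g : A → B` on a graded coalgebra, the subspace of all `x` in `A` with
`(Id ⊗ f) (Δ x) = (Id ⊗ g) (Δ x)`. -/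
def equalizerSubspace (A : ColorVec φ) [ComonObj A] {B : ColorVec φ} (f g : A →ₗ[k] B) :
    Submodule k A :=
  LinearMap.eqLocus (f.lTensor A ∘ₗ A.comulLin) (g.lTensor A ∘ₗ A.comulLin)

/-- The two-sided ideal `B S B` generated by a set `S` in a graded algebra `B`. -/
def idealGenerated (B : ColorVec φ) [MonObj B] (S : Set B) : Submodule k B :=
  Submodule.span k {z | ∃ x : B, ∃ s ∈ S, ∃ y : B, z = B.mulElt (B.mulElt x s) y}

/-- The component of degree `g` of a direct sum of graded vector spaces. -/
def directSumGrading {J : Type u} (V : J → ColorVec φ) (g : G) :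
    Submodule k (⨁ l, (V l : Type u)) where
  carrier := {v | ∀ l, v l ∈ (V l).grading g}
  add_mem' hv hw l := Submodule.add_mem _ (hv l) (hw l)
  zero_mem' _ := Submodule.zero_mem _
  smul_mem' c _ hv l := Submodule.smul_mem _ c (hv l)

/-- The component of degree `g` of the tensor algebra of a graded vector space, spanned by the
products `x₁ ⊗ ⋯ ⊗ xₙ` with `xᵢ` homogeneous of degree `hᵢ` and `h₁ ⋯ hₙ = g`. -/
def tensorAlgebraGrading {V : Type u} [AddCommGroup V] [Module k V] (𝒱 : G → Submodule k V)
    (g : G) : Submodule k (TensorAlgebra k V) :=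
  Submodule.span k {t | ∃ l : List (G × V), (∀ p ∈ l, p.2 ∈ 𝒱 p.1) ∧
    (l.map Prod.fst).prod = g ∧ t = (l.map fun p => TensorAlgebra.ι k p.2).prod}

open Classical in
/-- The canonical map of the algebra `V l` to the tensor algebra of the direct sum of all `V l`. -/
def toTensorAlgebra {J : Type u} (V : J → ColorVec φ) (l : J) :
    V l →ₗ[k] TensorAlgebra k (⨁ l, (V l : Type u)) :=
  TensorAlgebra.ι k ∘ₗ DirectSum.lof k J (fun l => (V l : Type u)) l

/-- The two-sided ideal of the tensor algebra of `⨁ l, V l` generated by the elements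
`x y - x ⊗ y` and `1 - 1_{V l}`, for `x`, `y` in `V l`. -/
def coproductIdeal {J : Type u} (V : J → ColorVec φ) [∀ l, MonObj (V l)] :
    TwoSidedIdeal (TensorAlgebra k (⨁ l, (V l : Type u))) :=
  TwoSidedIdeal.span
    ({t | ∃ l, ∃ x y : V l, t = toTensorAlgebra V l ((V l).mulElt x y) -
        toTensorAlgebra V l x * toTensorAlgebra V l y} ∪
      {t | ∃ l, t = 1 - toTensorAlgebra V l (V l).oneElt})

/-- The graded algebra `P`, together with the maps `q l : V l → P`, is the quotient of the tensor
algebra of `⨁ l, V l` by the ideal `coproductIdeal V`; the quotient map is `ν`. -/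
def IsTensorAlgebraQuotient {J : Type u} (V : J → ColorVec φ) [∀ l, MonObj (V l)]
    (P : ColorVec φ) [MonObj P] (q : ∀ l, V l →ₗ[k] P) : Prop :=
  ∃ ν : TensorAlgebra k (⨁ l, (V l : Type u)) →ₗ[k] P,
    ν 1 = P.oneElt ∧ (∀ s t, ν (s * t) = P.mulElt (ν s) (ν t)) ∧
    Function.Surjective ν ∧ (∀ t, ν t = 0 ↔ t ∈ coproductIdeal V) ∧
    (∀ g, P.grading g = (tensorAlgebraGrading (directSumGrading V) g).map ν) ∧
    ∀ l x, ν (toTensorAlgebra V l x) = q l x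

end ColorVec

/-- The linear map underlying a morphism of color Hopf algebras. -/
def ColorHopf.lin {k G : Type u} [Field k] [CommGroup G] {φ : CommutationFactor k G}
    {A B : Hopf (ColorVec φ)} (f : A ⟶ B) : A.X →ₗ[k] B.X :=
  ColorVec.Hom.toLin (HopfCoc.underlying f)

end

/-! Two facts about graded vector spaces over a field carry everything. The tensor product is exact
in each variable, so kernels, quotients and filtered colimits are compatible with it.
Degree-preserving maps commute with the projections to homogeneous components, so the subspaces and
quotients met here are graded automatically.

Limits. Let `K` be the subspace of `A` on which `(Id ⊗ f)Δ` and `(Id ⊗ g)Δ` agree. Coassociativity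
and exactness give `Δ(K) ⊆ A ⊗ K`; cocommutativity turns this into `Δ(K) ⊆ K ⊗ A`; over a field the
intersection of the two is `K ⊗ K` (`range_map_eq_inf`, `exists_eqComul`). A comonoid morphism
equalizing `f` and `g` lands in `K`, so `K` is the equalizer of comonoids. For Hopf monoids, `(Id ⊗
f)Δ` is multiplicative and compatible with the antipodes, so `K` is closed under all operations. The
tensor product is the binary product because the comultiplication of a cocommutative comonoid is a
comonoid morphism.

Colimits. Comultiplication and counit are algebra maps, and the antipode is an algebra map to the
opposite algebra. Hence coequalizers and coproducts are those of graded algebras, and the remaining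
structure comes from their universal properties. Two points need work for coproducts. The grading is
a direct sum because it is read off from an algebra map to the group algebra `P[G]`
(`exists_coprodCoaction`). The antipode identity is not an equation between algebra maps; instead,
the elements satisfying it are closed under products (`antipode_left_mulElt`,
`antipode_right_mulElt`).

Groups and protomodularity. Cocommutative Hopf monoids are the group objects in cocommutative
comonoids, by repackaging the same data. The functor to comonoids is conservative and preserves
finite limits, so protomodularity follows from the short five lemma for groups, carried out on
generalized elements (`isProtomodular_of_grpObj`).

Local presentability. Filtered colimits are computed on underlying spaces, since tensor products
commute with them. Therefore a color Hopf algebra of dimension less than `κ` is `κ`-presentable. A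
countable subset can be closed under all operations and remain countable, so each color Hopf algebra
is the `ℵ₁`-directed union of its Hopf subalgebras of countable dimension. Up to isomorphism these
form a set. Completeness is then a formal consequence. -/

noncomputable section

/-! ### Completeness of locally presentable categories -/

/-- A locally presentable category is complete, being reflective in a category of presheaves. -/
theorem hasLimits_of_isLocallyPresentable (C : Type w) [Category.{u} C]
    [IsLocallyPresentable.{u} C] : HasLimits C := by
  obtain ⟨κ, _, _⟩ := IsLocallyPresentable.exists_cardinal.{u} C
  let P := isCardinalPresentable C κ
  let F : SmallModel.{u} P.FullSubcategory ⥤ C :=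
    (equivSmallModel.{u} P.FullSubcategory).inverse ⋙ P.ι
  -- The `κ`-presentable objects generate `C` under `κ`-filtered colimits, so a small model of them
  -- is dense.
  have : F.IsDense := inferInstance
  let R := Presheaf.restrictedULiftYoneda.{u} F
  have hR : R.Full ∧ R.Faithful := ⟨inferInstance, inferInstance⟩
  obtain ⟨_, _⟩ := hR
  -- Density is the full faithfulness of `R`. As `C` is cocomplete, `F` extends along the Yoneda
  -- embedding, and the extension is left adjoint to `R`.
  let L := (uliftYoneda.{u}).leftKanExtension F
  let : Reflective R :=
    { L := L
      adj := Presheaf.uliftYonedaAdjunction.{u} L (uliftYoneda.{u}.leftKanExtensionUnit F) }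
  exact hasLimits_of_reflective R

/-! ### Transport of monoid and comonoid structures along monomorphisms and joint epimorphisms -/

section MonoComon
variable {C : Type w} [Category.{v} C] [MonoidalCategory C]

/-- A comonoid structure on a subobject of a comonoid. -/
abbrev ComonObj.ofMono {K X : C} [ComonObj X] (i : K ⟶ X) (h3 : Mono (i ⊗ₘ (i ⊗ₘ i)))
    (hl : Mono (𝟙_ C ◁ i)) (hr : Mono (i ▷ 𝟙_ C))
    (d : K ⟶ K ⊗ K) (hd : d ≫ (i ⊗ₘ i) = i ≫ Δ[X]) : ComonObj K where
  counit := i ≫ ε[X]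
  comul := d
  counit_comul := by
    rw [← cancel_mono (𝟙_ C ◁ i)]
    have : (i ≫ ε[X]) ▷ K ≫ 𝟙_ C ◁ i = (i ⊗ₘ i) ≫ ε[X] ▷ X := by
      rw [MonoidalCategory.tensorHom_def, Category.assoc, whisker_exchange, comp_whiskerRight,
        Category.assoc]
    rw [Category.assoc, this, reassoc_of% hd, ComonObj.counit_comul]
    simp
  comul_counit := by
    rw [← cancel_mono (i ▷ 𝟙_ C)]
    have : K ◁ (i ≫ ε[X]) ≫ i ▷ 𝟙_ C = (i ⊗ₘ i) ≫ X ◁ ε[X] := by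
      rw [MonoidalCategory.tensorHom_def', Category.assoc, ← whisker_exchange, whiskerLeft_comp,
        Category.assoc]
    rw [Category.assoc, this, reassoc_of% hd, ComonObj.comul_counit]
    simp
  comul_assoc := by
    rw [← cancel_mono (i ⊗ₘ (i ⊗ₘ i))]
    have h1 : K ◁ d ≫ (i ⊗ₘ (i ⊗ₘ i)) = (i ⊗ₘ i) ≫ X ◁ Δ[X] := by
      rw [← id_tensorHom, tensorHom_comp_tensorHom, hd, ← id_tensorHom, tensorHom_comp_tensorHom,
        Category.id_comp, Category.comp_id]
    have h2 : d ▷ K ≫ ((i ⊗ₘ i) ⊗ₘ i) = (i ⊗ₘ i) ≫ Δ[X] ▷ X := by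
      rw [← tensorHom_id, tensorHom_comp_tensorHom, hd, ← tensorHom_id, tensorHom_comp_tensorHom,
        Category.id_comp, Category.comp_id]
    rw [Category.assoc, Category.assoc, Category.assoc, ← associator_naturality, reassoc_of% h2,
      h1, reassoc_of% hd, reassoc_of% hd, ComonObj.comul_assoc]

/-- Morphisms with a common codomain are jointly epimorphic. -/
def JointlyEpi {J : Type*} {X : J → C} {Q : C} (p : ∀ i, X i ⟶ Q) : Prop :=
  ∀ ⦃Z : C⦄ (f g : Q ⟶ Z), (∀ i, p i ≫ f = p i ≫ g) → f = g

/-- The structure of monoid on an object which is jointly covered by monoids, provided that the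
structure morphisms descend. -/
abbrev MonObj.ofJointlyEpi {J : Type*} {X : J → C} [∀ i, MonObj (X i)] {Q : C}
    (p : ∀ i, X i ⟶ Q) (h3 : JointlyEpi fun i => (p i ⊗ₘ p i) ⊗ₘ p i)
    (hl : JointlyEpi fun i => 𝟙_ C ◁ p i) (hr : JointlyEpi fun i => p i ▷ 𝟙_ C)
    (m : Q ⊗ Q ⟶ Q) (hm : ∀ i, (p i ⊗ₘ p i) ≫ m = μ[X i] ≫ p i)
    (e : 𝟙_ C ⟶ Q) (he : ∀ i, η[X i] ≫ p i = e) : MonObj Q where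
  one := e
  mul := m
  one_mul := hl _ _ fun i => by
    beta_reduce
    rw [← tensorHom_id, ← id_tensorHom, tensorHom_comp_tensorHom_assoc, Category.id_comp,
      Category.comp_id, ← he i]
    have h1 : (η[X i] ≫ p i ⊗ₘ p i) = η[X i] ▷ X i ≫ (p i ⊗ₘ p i) := by
      rw [← tensorHom_id, tensorHom_comp_tensorHom, Category.id_comp]
    rw [h1, Category.assoc, hm, MonObj.one_mul_assoc, id_tensorHom, leftUnitor_naturality]
  mul_one := hr _ _ fun i => by
    beta_reduce
    rw [← tensorHom_id, ← id_tensorHom, tensorHom_comp_tensorHom_assoc, Category.id_comp,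
      Category.comp_id, ← he i]
    have h1 : (p i ⊗ₘ η[X i] ≫ p i) = X i ◁ η[X i] ≫ (p i ⊗ₘ p i) := by
      rw [← id_tensorHom, tensorHom_comp_tensorHom, Category.id_comp]
    rw [h1, Category.assoc, hm, MonObj.mul_one_assoc, tensorHom_id, rightUnitor_naturality]
  mul_assoc := h3 _ _ fun i => by
    beta_reduce
    rw [associator_naturality_assoc, ← tensorHom_id, ← id_tensorHom,
      tensorHom_comp_tensorHom_assoc, tensorHom_comp_tensorHom_assoc, hm, Category.comp_id]
    have h1 : (μ[X i] ≫ p i ⊗ₘ p i) = μ[X i] ▷ X i ≫ (p i ⊗ₘ p i) := by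
      rw [← tensorHom_id, tensorHom_comp_tensorHom, Category.id_comp]
    have h2 : (p i ⊗ₘ μ[X i] ≫ p i) = X i ◁ μ[X i] ≫ (p i ⊗ₘ p i) := by
      rw [← id_tensorHom, tensorHom_comp_tensorHom, Category.id_comp]
    rw [h1, h2, Category.assoc, Category.assoc, hm, MonObj.mul_assoc_assoc]

/-- The structure of comonoid on an object which is jointly covered by comonoids, provided that
the structure morphisms descend. -/
abbrev ComonObj.ofJointlyEpi {J : Type*} {X : J → C} [∀ i, ComonObj (X i)] {Q : C}
    (p : ∀ i, X i ⟶ Q) (h1 : JointlyEpi p)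
    (d : Q ⟶ Q ⊗ Q) (hd : ∀ i, p i ≫ d = Δ[X i] ≫ (p i ⊗ₘ p i))
    (c : Q ⟶ 𝟙_ C) (hc : ∀ i, p i ≫ c = ε[X i]) : ComonObj Q where
  counit := c
  comul := d
  counit_comul := h1 _ _ fun i => by
    rw [reassoc_of% hd, ← tensorHom_id, tensorHom_comp_tensorHom, hc, Category.comp_id,
      MonoidalCategory.tensorHom_def, ComonObj.counit_comul_assoc, leftUnitor_inv_naturality]
  comul_counit := h1 _ _ fun i => by
    rw [reassoc_of% hd, ← id_tensorHom, tensorHom_comp_tensorHom, hc, Category.comp_id,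
      MonoidalCategory.tensorHom_def', ComonObj.comul_counit_assoc, rightUnitor_inv_naturality]
  comul_assoc := h1 _ _ fun i => by
    rw [reassoc_of% hd, reassoc_of% hd, ← tensorHom_id, ← id_tensorHom, tensorHom_comp_tensorHom,
      tensorHom_comp_tensorHom_assoc, hd, Category.comp_id]
    have h1 : (Δ[X i] ≫ (p i ⊗ₘ p i) ⊗ₘ p i) = Δ[X i] ▷ X i ≫ ((p i ⊗ₘ p i) ⊗ₘ p i) := by
      rw [← tensorHom_id, tensorHom_comp_tensorHom, Category.id_comp]
    have h2 : (p i ⊗ₘ Δ[X i] ≫ (p i ⊗ₘ p i)) = X i ◁ Δ[X i] ≫ (p i ⊗ₘ (p i ⊗ₘ p i)) := by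
      rw [← id_tensorHom, tensorHom_comp_tensorHom, Category.id_comp]
    rw [h1, h2, Category.assoc, associator_naturality, ComonObj.comul_assoc_assoc]

variable [SymmetricCategory C]

theorem isCommComonObj_of_mono {K X : C} [ComonObj X] [IsCommComonObj X] [ComonObj K]
    (i : K ⟶ X) (h2 : Mono (i ⊗ₘ i)) (hi : IsComonHom i) : IsCommComonObj K where
  comul_comm := by
    rw [← cancel_mono (i ⊗ₘ i), Category.assoc, ← BraidedCategory.braiding_naturality,
      ← reassoc_of% hi.hom_comul, IsCommComonObj.comul_comm, hi.hom_comul]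

theorem isCommComonObj_of_epi {X Q : C} [ComonObj X] [IsCommComonObj X] [ComonObj Q]
    (p : X ⟶ Q) (h2 : Epi p) (hp : IsComonHom p) : IsCommComonObj Q where
  comul_comm := by
    rw [← cancel_epi p, reassoc_of% hp.hom_comul, BraidedCategory.braiding_naturality,
      IsCommComonObj.comul_comm_assoc, hp.hom_comul]

end MonoComon

/-! ### Transport of Hopf structures; the opposite monoid -/

section SubHopf
variable {C : Type w} [Category.{v} C] [MonoidalCategory C] [BraidedCategory C]

/-- The structure of Hopf monoid on a subobject which is closed under all operations. -/
abbrev HopfObj.ofMono {K X : C} [HopfObj X] (i : K ⟶ X) (h1 : Mono i) (h2 : Mono (i ⊗ₘ i))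
    (h3 : Mono (i ⊗ₘ (i ⊗ₘ i)))
    (hl : Mono (𝟙_ C ◁ i)) (hr : Mono (i ▷ 𝟙_ C))
    (d : K ⟶ K ⊗ K) (hd : d ≫ (i ⊗ₘ i) = i ≫ Δ[X])
    (m : K ⊗ K ⟶ K) (hm : m ≫ i = (i ⊗ₘ i) ≫ μ[X])
    (e : 𝟙_ C ⟶ K) (he : e ≫ i = η[X])
    (s : K ⟶ K) (hs : s ≫ i = i ≫ HopfObj.antipode) : HopfObj K where
  toComonObj := ComonObj.ofMono i h3 hl hr d hd
  one := e
  mul := m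
  one_mul := by
    rw [← cancel_mono i, Category.assoc, hm, ← tensorHom_id, tensorHom_comp_tensorHom_assoc, he,
      Category.id_comp, MonoidalCategory.tensorHom_def', Category.assoc, MonObj.one_mul, leftUnitor_naturality]
  mul_one := by
    rw [← cancel_mono i, Category.assoc, hm, ← id_tensorHom, tensorHom_comp_tensorHom_assoc, he,
      Category.id_comp, MonoidalCategory.tensorHom_def, Category.assoc, MonObj.mul_one, rightUnitor_naturality]
  mul_assoc := by
    rw [← cancel_mono i]
    simp only [Category.assoc]
    rw [hm, ← tensorHom_id, tensorHom_comp_tensorHom_assoc, hm, ← id_tensorHom,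
      tensorHom_comp_tensorHom_assoc, hm]
    have h1 : ((i ⊗ₘ i) ≫ μ[X] ⊗ₘ 𝟙 K ≫ i) = ((i ⊗ₘ i) ⊗ₘ i) ≫ μ[X] ▷ X := by
      rw [← tensorHom_id, tensorHom_comp_tensorHom, Category.id_comp, Category.comp_id]
    have h2 : (𝟙 K ≫ i ⊗ₘ (i ⊗ₘ i) ≫ μ[X]) = (i ⊗ₘ (i ⊗ₘ i)) ≫ X ◁ μ[X] := by
      rw [← id_tensorHom, tensorHom_comp_tensorHom, Category.id_comp, Category.comp_id]
    rw [h1, h2, Category.assoc, Category.assoc, MonObj.mul_assoc, associator_naturality_assoc]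
  mul_comul := by
    rw [← cancel_mono (i ⊗ₘ i)]
    change (m ≫ d) ≫ _ = ((d ⊗ₘ d) ≫ tensorμ K K K K ≫ (m ⊗ₘ m)) ≫ _
    rw [Category.assoc, hd, reassoc_of% hm, BimonObj.mul_comul]
    simp only [Category.assoc, tensorHom_comp_tensorHom]
    rw [hm, ← tensorHom_comp_tensorHom, ← tensorμ_natural_assoc, tensorHom_comp_tensorHom_assoc,
      tensorHom_comp_tensorHom_assoc, hd]
  one_comul := by
    rw [← cancel_mono (i ⊗ₘ i)]
    change (e ≫ d) ≫ _ = ((λ_ (𝟙_ C)).inv ≫ (e ⊗ₘ e)) ≫ _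
    rw [Category.assoc, hd, reassoc_of% he, Category.assoc, tensorHom_comp_tensorHom, he]
    exact Bimon.one_comul X
  mul_counit := by
    change m ≫ i ≫ ε[X] = ((i ≫ ε[X]) ⊗ₘ (i ≫ ε[X])) ≫ (λ_ (𝟙_ C)).hom
    rw [reassoc_of% hm, Bimon.mul_counit, tensorHom_comp_tensorHom_assoc]
  one_counit := by
    change e ≫ i ≫ ε[X] = _
    rw [reassoc_of% he, BimonObj.one_counit]
  antipode := s
  antipode_left := by
    rw [← cancel_mono i]
    change (d ≫ s ▷ K ≫ m) ≫ i = ((i ≫ ε[X]) ≫ e) ≫ i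
    simp only [Category.assoc]
    rw [hm, he, ← tensorHom_id, tensorHom_comp_tensorHom_assoc, hs, Category.id_comp]
    have h1 : (i ≫ HopfObj.antipode ⊗ₘ i) = (i ⊗ₘ i) ≫ HopfObj.antipode ▷ X := by
      rw [← tensorHom_id, tensorHom_comp_tensorHom, Category.comp_id]
    rw [h1, Category.assoc, reassoc_of% hd, HopfObj.antipode_left]
  antipode_right := by
    rw [← cancel_mono i]
    change (d ≫ K ◁ s ≫ m) ≫ i = ((i ≫ ε[X]) ≫ e) ≫ i
    simp only [Category.assoc]
    rw [hm, he, ← id_tensorHom, tensorHom_comp_tensorHom_assoc, hs, Category.id_comp]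
    have h1 : (i ⊗ₘ i ≫ HopfObj.antipode) = (i ⊗ₘ i) ≫ X ◁ HopfObj.antipode := by
      rw [← id_tensorHom, tensorHom_comp_tensorHom, Category.comp_id]
    rw [h1, Category.assoc, reassoc_of% hd, HopfObj.antipode_right]

/-- The structure of Hopf monoid on an object which is jointly covered by Hopf monoids, provided
that the structure morphisms descend. -/
abbrev HopfObj.ofJointlyEpi {J : Type*} {X : J → C} [∀ i, HopfObj (X i)] {Q : C}
    (p : ∀ i, X i ⟶ Q) (h1 : JointlyEpi p) (h2 : JointlyEpi fun i => p i ⊗ₘ p i)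
    (h3 : JointlyEpi fun i => (p i ⊗ₘ p i) ⊗ₘ p i)
    (hl : JointlyEpi fun i => 𝟙_ C ◁ p i) (hr : JointlyEpi fun i => p i ▷ 𝟙_ C)
    (d : Q ⟶ Q ⊗ Q) (hd : ∀ i, p i ≫ d = Δ[X i] ≫ (p i ⊗ₘ p i))
    (c : Q ⟶ 𝟙_ C) (hc : ∀ i, p i ≫ c = ε[X i])
    (m : Q ⊗ Q ⟶ Q) (hm : ∀ i, (p i ⊗ₘ p i) ≫ m = μ[X i] ≫ p i)
    (e : 𝟙_ C ⟶ Q) (he : ∀ i, η[X i] ≫ p i = e) (hne : Nonempty J)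
    (s : Q ⟶ Q) (hs : ∀ i, p i ≫ s = HopfObj.antipode ≫ p i) : HopfObj Q where
  toMonObj := MonObj.ofJointlyEpi p h3 hl hr m hm e he
  toComonObj := ComonObj.ofJointlyEpi p h1 d hd c hc
  mul_comul := h2 _ _ fun i => by
    change _ ≫ m ≫ d = _ ≫ (d ⊗ₘ d) ≫ tensorμ _ _ _ _ ≫ (m ⊗ₘ m)
    rw [tensorHom_comp_tensorHom_assoc, hd, ← tensorHom_comp_tensorHom_assoc,
      tensorμ_natural_assoc, tensorHom_comp_tensorHom, hm, reassoc_of% hm, hd,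
      BimonObj.mul_comul_assoc, tensorHom_comp_tensorHom]
  one_comul := by
    -- The axioms on the unit have source `𝟙_ C`, so they cannot be tested on a cover of `Q`; one
    -- member of the family is needed to write `e` as `η ≫ p i`.
    obtain ⟨i⟩ := hne
    change e ≫ d = (λ_ (𝟙_ C)).inv ≫ (e ⊗ₘ e)
    rw [← he i, Category.assoc, hd, Bimon.one_comul_assoc, tensorHom_comp_tensorHom]
  mul_counit := h2 _ _ fun i => by
    beta_reduce
    change _ ≫ m ≫ c = _ ≫ (c ⊗ₘ c) ≫ (λ_ (𝟙_ C)).hom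
    rw [reassoc_of% hm, hc, Bimon.mul_counit, tensorHom_comp_tensorHom_assoc, hc]
  one_counit := by
    obtain ⟨i⟩ := hne
    change e ≫ c = _
    rw [← he i, Category.assoc, hc, BimonObj.one_counit]
  antipode := s
  antipode_left := h1 _ _ fun i => by
    change p i ≫ d ≫ s ▷ Q ≫ m = p i ≫ c ≫ e
    rw [reassoc_of% hd, reassoc_of% hc, ← tensorHom_id, tensorHom_comp_tensorHom_assoc, hs,
      Category.comp_id]
    have h1 : (HopfObj.antipode ≫ p i ⊗ₘ p i) = HopfObj.antipode ▷ X i ≫ (p i ⊗ₘ p i) := by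
      rw [← tensorHom_id, tensorHom_comp_tensorHom, Category.id_comp]
    rw [h1, Category.assoc, hm, HopfObj.antipode_left_assoc, he]
  antipode_right := h1 _ _ fun i => by
    change p i ≫ d ≫ Q ◁ s ≫ m = p i ≫ c ≫ e
    rw [reassoc_of% hd, reassoc_of% hc, ← id_tensorHom, tensorHom_comp_tensorHom_assoc, hs,
      Category.comp_id]
    have h1 : (p i ⊗ₘ HopfObj.antipode ≫ p i) = X i ◁ HopfObj.antipode ≫ (p i ⊗ₘ p i) := by
      rw [← id_tensorHom, tensorHom_comp_tensorHom, Category.id_comp]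
    rw [h1, Category.assoc, hm, HopfObj.antipode_right_assoc, he]

/-- By the hexagon identities this is the Yang–Baxter equation. It yields the associativity of the
opposite multiplication. -/
theorem braiding_whiskerRight_braiding (M : C) :
    (β_ M M).hom ▷ M ≫ (β_ (M ⊗ M) M).hom =
      (α_ M M M).hom ≫ M ◁ (β_ M M).hom ≫ (β_ M (M ⊗ M)).hom ≫ (α_ M M M).hom := by
  rw [BraidedCategory.braiding_tensor_left_hom, BraidedCategory.braiding_tensor_right_hom]
  simp only [Category.assoc, Iso.inv_hom_id, Category.comp_id]
  rw [← cancel_epi (α_ M M M).inv, Iso.inv_hom_id_assoc]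
  exact BraidedCategory.yang_baxter M M M

/-- The opposite monoid. -/
abbrev MonObj.opposite (M : C) [MonObj M] : MonObj M where
  one := η[M]
  mul := (β_ M M).hom ≫ μ[M]
  one_mul := by
    rw [BraidedCategory.braiding_naturality_left_assoc, MonObj.mul_one, braiding_rightUnitor]
  mul_one := by
    rw [BraidedCategory.braiding_naturality_right_assoc, MonObj.one_mul, braiding_leftUnitor]
  mul_assoc := by
    rw [comp_whiskerRight, Category.assoc, BraidedCategory.braiding_naturality_left_assoc,
      whiskerLeft_comp, Category.assoc, BraidedCategory.braiding_naturality_right_assoc,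
      MonObj.mul_assoc, reassoc_of% braiding_whiskerRight_braiding]

theorem isMonHom_opposite {M N : C} [MonObj M] [MonObj N] (f : M ⟶ N) (hf : IsMonHom f) :
    @IsMonHom _ _ _ _ _ (MonObj.opposite M) (MonObj.opposite N) f :=
  @IsMonHom.mk _ _ _ _ _ (MonObj.opposite M) (MonObj.opposite N) f hf.one_hom (by
    change ((β_ M M).hom ≫ μ[M]) ≫ f = (f ⊗ₘ f) ≫ (β_ N N).hom ≫ μ[N]
    rw [Category.assoc, hf.mul_hom, BraidedCategory.braiding_naturality_assoc])

/-- Antimultiplicativity of the antipode, phrased so that universal properties of algebras apply to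
it, with the opposite monoid as target. -/
theorem isMonHom_antipode (A : C) [HopfObj A] :
    @IsMonHom _ _ _ _ _ _ (MonObj.opposite A) (HopfObj.antipode (X := A)) :=
  @IsMonHom.mk _ _ _ _ _ _ (MonObj.opposite A) _ (HopfObj.one_antipode A) (HopfObj.mul_antipode A)

end SubHopf

/-! ### Morphisms of Hopf monoids -/

section HomMk
variable {C : Type w} [Category.{v} C] [MonoidalCategory C] [BraidedCategory C]

/-- A morphism of monoids and comonoids between Hopf monoids, as a morphism of Hopf monoids. -/
def Hopf.homMk {A B : Hopf C} (f : A.X ⟶ B.X) (h : IsMonHom f) (h' : IsComonHom f) : A ⟶ B :=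
  ⟨Comon.Hom.mk' (M := (A.toBimon : Comon (Mon C))) (N := (B.toBimon : Comon (Mon C)))
    (@Mon.Hom.mk _ _ _ A.toBimon.X B.toBimon.X f h)
    (Mon.Hom.ext h'.hom_counit) (Mon.Hom.ext h'.hom_comul)⟩

end HomMk

section HomMk'
variable {C : Type u} [Category.{v} C] [MonoidalCategory C] [SymmetricCategory C]

theorem HopfCoc.underlying_ext {A B : Hopf C} {f g : A ⟶ B} (h : underlying f = underlying g) :
    f = g := InducedCategory.hom_ext (Bimon.ext h)

/-- A morphism of cocommutative Hopf monoids from a morphism of monoids and comonoids. -/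
def HopfCoc.homMk {A B : HopfCoc C} (f : A.obj.X ⟶ B.obj.X) (h : IsMonHom f) (h' : IsComonHom f) :
    A ⟶ B := ObjectProperty.homMk (Hopf.homMk f h h')

theorem HopfCoc.hom_ext {A B : HopfCoc C} {f g : A ⟶ B}
    (h : underlying f.hom = underlying g.hom) : f = g :=
  ObjectProperty.hom_ext _ (underlying_ext h)

/-- The underlying morphisms give the same pullbacks: an isomorphism can be tested on underlying
objects. -/
theorem HopfCoc.isIso_of_underlying {A B : HopfCoc C} (f : A ⟶ B) [IsIso (underlying f.hom)] :
    IsIso f := by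
  have := isMonHom_underlying f.hom
  have := isComonHom_underlying f.hom
  refine ⟨HopfCoc.homMk (inv (underlying f.hom)) ⟨?_, ?_⟩ ⟨?_, ?_⟩, ?_, ?_⟩
  · rw [IsIso.comp_inv_eq, IsMonHom.one_hom]
  · rw [IsIso.comp_inv_eq, Category.assoc, IsMonHom.mul_hom, tensorHom_comp_tensorHom_assoc]
    simp
  · rw [IsIso.inv_comp_eq, IsComonHom.hom_counit]
  · rw [IsIso.inv_comp_eq, ← Category.assoc, IsComonHom.hom_comul, Category.assoc,
      tensorHom_comp_tensorHom]
    simp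
  · exact HopfCoc.hom_ext (IsIso.hom_inv_id (underlying f.hom))
  · exact HopfCoc.hom_ext (IsIso.inv_hom_id (underlying f.hom))

end HomMk'

/-! ### Cocommutative Hopf monoids as group objects -/

section ToGrp
variable {C : Type u} [Category.{v} C] [MonoidalCategory C] [SymmetricCategory C]

open CommComonCartesian

namespace HopfCoc

theorem homX_lift {T A B : CommComon C} (f : T ⟶ A) (g : T ⟶ B) :
    homX (CartesianMonoidalCategory.lift f g) = Δ[T.X] ≫ (homX f ⊗ₘ homX g) := by
  rw [lift_eq]
  rfl

/-- The Hopf monoid underlying a group object in cocommutative comonoids. -/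
abbrev hopfObjOfGrp (A : Grp (CommComon C)) : HopfObj A.X.X where
  one := homX η[A.X]
  mul := homX μ[A.X]
  one_mul := by
    have := congrArg homX (MonObj.one_mul A.X)
    rw [homX_comp, homX_whiskerRight, homX_leftUnitor] at this
    exact this
  mul_one := by
    have := congrArg homX (MonObj.mul_one A.X)
    rw [homX_comp, homX_whiskerLeft, homX_rightUnitor] at this
    exact this
  mul_assoc := by
    have := congrArg homX (MonObj.mul_assoc A.X)
    rw [homX_comp, homX_whiskerRight, homX_comp, homX_comp, homX_associator,
      homX_whiskerLeft] at this
    exact this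
  mul_comul := by
    have := (isComonHom_homX μ[A.X]).hom_comul
    change _ = Δ[A.X.X ⊗ A.X.X] ≫ _ at this
    rw [Comon.tensorObj_comul, Category.assoc] at this
    exact this
  one_comul := by
    have := (isComonHom_homX η[A.X]).hom_comul
    exact this
  mul_counit := (isComonHom_homX μ[A.X]).hom_counit
  one_counit := (isComonHom_homX η[A.X]).hom_counit
  antipode := homX ι[A.X]
  antipode_left := by
    have := congrArg homX (GrpObj.left_inv A.X)
    rw [homX_comp, homX_lift, Category.assoc] at this
    rw [← tensorHom_id]
    exact this
  antipode_right := by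
    have := congrArg homX (GrpObj.right_inv A.X)
    rw [homX_comp, homX_lift, Category.assoc] at this
    rw [← id_tensorHom]
    exact this

/-- The cocommutative Hopf monoid underlying a group object in cocommutative comonoids. -/
abbrev ofGrp (A : Grp (CommComon C)) : HopfCoc C :=
  HopfCoc.of (hopfObjOfGrp A) (inferInstanceAs (IsCommComonObj A.X.X))

/-- Both passages only regroup the same structure morphisms, so they are mutually inverse on the
nose. This strictness gives an isomorphism of categories and not merely an equivalence. -/
theorem toGrp_obj_ofGrp (A : Grp (CommComon C)) : (toGrp (C := C)).obj (ofGrp A) = A := rfl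

theorem ofGrp_toGrp_obj (H : HopfCoc C) : ofGrp ((toGrp (C := C)).obj H) = H := rfl

theorem toGrp_bijective : Function.Bijective (toGrp (C := C)).obj :=
  Function.bijective_iff_has_inverse.mpr ⟨ofGrp, ofGrp_toGrp_obj, toGrp_obj_ofGrp⟩

instance : (toGrp (C := C)).Faithful where
  map_injective {A B _ _} h := HopfCoc.hom_ext (congrArg (fun t : A.grp ⟶ B.grp => homX t.hom.hom) h)

instance : (toGrp (C := C)).Full where
  map_surjective {A B} f := by
    have h1 := congrArg homX (IsMonHom.one_hom f.hom.hom)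
    have h2 := congrArg homX (IsMonHom.mul_hom f.hom.hom)
    rw [homX_comp, homX_comp, MonoidalCategory.tensorHom_def, homX_comp, homX_whiskerLeft,
        homX_whiskerRight, ← MonoidalCategory.tensorHom_def] at h2
    exact ⟨HopfCoc.homMk (homX f.hom.hom) ⟨h1, h2⟩ (isComonHom_homX f.hom.hom), rfl⟩

theorem toGrp_isEquivalence : (toGrp (C := C)).IsEquivalence where
  essSurj := ⟨fun A => ⟨ofGrp A, ⟨Iso.refl _⟩⟩⟩

end HopfCoc

end ToGrp

/-! ### Terminal object, binary products of comonoids, and the zero object -/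

section Cartesian
variable {C : Type u} [Category.{v} C] [MonoidalCategory C] [SymmetricCategory C]
open CommComonCartesian

theorem CommComon.isTerminal_trivial : Nonempty (IsTerminal (CommComon.trivial C)) :=
  ⟨IsTerminal.ofUniqueHom toUnit fun _ f => toUnit_uniq f⟩

theorem CommComon.isLimit_fst_snd (A B : CommComon C) :
    Nonempty (IsLimit (BinaryFan.mk (fst A B) (snd A B))) :=
  ⟨BinaryFan.isLimitMk (fun s => pair s.fst s.snd) (fun s => pair_fst _ _)
        (fun s => pair_snd _ _) (fun s m h1 h2 => by rw [pair_eta m, h1, h2])⟩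

/-- The unit object as a Hopf monoid. -/
abbrev unitHopf (C : Type u) [Category.{v} C] [MonoidalCategory C] [BraidedCategory C] :
    HopfObj (𝟙_ C) where
  toMonObj := MonObj.instTensorUnit
  toComonObj := ComonObj.instTensorUnit C
  mul_comul := by
    change (λ_ (𝟙_ C)).hom ≫ (λ_ (𝟙_ C)).inv = ((λ_ (𝟙_ C)).inv ⊗ₘ (λ_ (𝟙_ C)).inv) ≫
      tensorμ _ _ _ _ ≫ ((λ_ (𝟙_ C)).hom ⊗ₘ (λ_ (𝟙_ C)).hom)
    rw [tensorμ, braiding_tensorUnit_left]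
    monoidal
  one_comul := by
    change 𝟙 _ ≫ (λ_ (𝟙_ C)).inv = (λ_ (𝟙_ C)).inv ≫ (𝟙 _ ⊗ₘ 𝟙 _)
    simp
  mul_counit := by
    change (λ_ (𝟙_ C)).hom ≫ 𝟙 _ = (𝟙 _ ⊗ₘ 𝟙 _) ≫ (λ_ (𝟙_ C)).hom
    simp
  one_counit := Category.comp_id _
  antipode := 𝟙 _
  antipode_left := by
    change (λ_ (𝟙_ C)).inv ≫ 𝟙 _ ▷ _ ≫ (λ_ (𝟙_ C)).hom = 𝟙 _ ≫ 𝟙 _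
    simp
  antipode_right := by
    change (λ_ (𝟙_ C)).inv ≫ _ ◁ 𝟙 _ ≫ (λ_ (𝟙_ C)).hom = 𝟙 _ ≫ 𝟙 _
    simp

theorem isCocommutative_unitHopf : HopfIsCocommutative (unitHopf C) :=
  inferInstanceAs (IsCommComonObj (CommComon.trivial C).X)

theorem isZero_unitHopf :
    IsZero (HopfCoc.of (unitHopf C) isCocommutative_unitHopf) :=
  let := unitHopf C
  {
  unique_to H := ⟨⟨⟨HopfCoc.homMk η[H.obj.X] ⟨Category.id_comp _, by
      change (λ_ (𝟙_ C)).hom ≫ η[H.obj.X] = (η[H.obj.X] ⊗ₘ η[H.obj.X]) ≫ μ[H.obj.X]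
      rw [MonoidalCategory.tensorHom_def', Category.assoc, MonObj.one_mul, leftUnitor_naturality]⟩
      (HopfCoc.isComonHom_one H.obj.X)⟩, fun f => HopfCoc.hom_ext (by
        have h := (HopfCoc.isMonHom_underlying f.hom).one_hom
        change 𝟙 _ ≫ _ = _ at h
        rw [Category.id_comp] at h
        exact h)⟩⟩
  unique_from H := ⟨⟨⟨HopfCoc.homMk (B := HopfCoc.of (unitHopf C) isCocommutative_unitHopf) ε[H.obj.X] ⟨BimonObj.one_counit H.obj.X, BimonObj.mul_counit _⟩
      ⟨Category.comp_id _, by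
        change ε[H.obj.X] ≫ (λ_ (𝟙_ C)).inv = Δ[H.obj.X] ≫ (ε[H.obj.X] ⊗ₘ ε[H.obj.X])
        rw [MonoidalCategory.tensorHom_def, ComonObj.counit_comul_assoc,
          leftUnitor_inv_naturality]⟩⟩,
      fun f => HopfCoc.hom_ext (by
        have h := (HopfCoc.isComonHom_underlying f.hom).hom_counit
        change _ ≫ 𝟙 _ = _ at h
        rw [Category.comp_id] at h
        exact h)⟩⟩ }

theorem isUnitHopf_unitHopf : IsUnitHopf (unitHopf C) := ⟨rfl, rfl, rfl, rfl, rfl⟩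

end Cartesian

/-! ### Tensor products of Hopf monoids as binary products -/

section Tensor
variable {C : Type u} [Category.{v} C] [MonoidalCategory C] [SymmetricCategory C]

/-- The tensor product of bimonoids. -/
abbrev tensorBimon (A B : C) [BimonObj A] [BimonObj B] : BimonObj (A ⊗ B) :=
  let M : Bimon C := MonoidalCategoryStruct.tensorObj (C := Comon (Mon C)) (Bimon.mk' A)
    (Bimon.mk' B)
  -- The bimonoid axioms are those of `M`, the tensor product of comonoids in the category of
  -- monoids; its counit and comultiplication agree definitionally with those of the comonoid `A ⊗
  -- B`.
  have h : ε[A ⊗ B] = ε[M.X].hom := rfl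
  have h' : Δ[A ⊗ B] = Δ[M.X].hom := rfl
  { toMonObj := inferInstance
    toComonObj := inferInstance
    mul_comul := by
      rw [h']
      exact BimonObj.mul_comul M.X.X
    one_comul := by
      rw [h']
      exact BimonObj.one_comul M.X.X
    mul_counit := by
      rw [h]
      exact BimonObj.mul_counit M.X.X
    one_counit := by
      rw [h]
      exact BimonObj.one_counit M.X.X }

/-- The inverse of `tensorμ` uses the inverse braiding, which in a symmetric category is again the
braiding. -/
theorem tensorμ_tensorμ (A B D E : C) :
    tensorμ A B D E ≫ tensorμ A D B E = 𝟙 ((A ⊗ B) ⊗ D ⊗ E) := by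
  rw [← tensorμ_tensorδ, tensorμ, tensorδ, tensorμ]
  simp [SymmetricCategory.braiding_swap_eq_inv_braiding]

/-- The tensor product of Hopf monoids. -/
abbrev tensorHopf (A B : C) [HopfObj A] [HopfObj B] : HopfObj (A ⊗ B) where
  toBimonObj := tensorBimon A B
  antipode := HopfObj.antipode (X := A) ⊗ₘ HopfObj.antipode (X := B)
  antipode_left := by
    change Δ[A ⊗ B] ≫ _ ≫ (tensorμ A B A B ≫ (μ[A] ⊗ₘ μ[B])) =
      ε[A ⊗ B] ≫ ((λ_ (𝟙_ C)).inv ≫ (η[A] ⊗ₘ η[B]))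
    -- The interchange in the comultiplication moves past the antipodes by naturality and cancels
    -- the one in the multiplication. What remains is the tensor product of the two antipode axioms.
    rw [Comon.tensorObj_comul, Comon.tensorObj_counit, ← tensorHom_id, ← id_tensorHom_id,
      tensorμ_natural_assoc, Category.assoc, reassoc_of% tensorμ_tensorμ]
    simp only [tensorHom_id, tensorHom_comp_tensorHom,
      Category.assoc, HopfObj.antipode_left, Iso.hom_inv_id_assoc]
  antipode_right := by
    change Δ[A ⊗ B] ≫ _ ≫ (tensorμ A B A B ≫ (μ[A] ⊗ₘ μ[B])) =
      ε[A ⊗ B] ≫ ((λ_ (𝟙_ C)).inv ≫ (η[A] ⊗ₘ η[B]))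
    rw [Comon.tensorObj_comul, Comon.tensorObj_counit, ← id_tensorHom, ← id_tensorHom_id,
      tensorμ_natural_assoc, Category.assoc, reassoc_of% tensorμ_tensorμ]
    simp only [id_tensorHom, tensorHom_comp_tensorHom,
      Category.assoc, HopfObj.antipode_right, Iso.hom_inv_id_assoc]

theorem isTensorHopf_tensorHopf (A B : C) [HopfObj A] [HopfObj B] :
    IsTensorHopf A B (tensorHopf A B) where
  mul_eq := rfl
  one_eq := by
    rw [← unitors_inv_equal]
    rfl
  comul_eq := Comon.tensorObj_comul _ _
  counit_eq := by
    rw [← unitors_equal]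
    exact Comon.tensorObj_counit _ _
  antipode_eq := rfl

open CommComonCartesian

/-- The tensor product of cocommutative Hopf monoids. -/
abbrev HopfCoc.tensor (A B : HopfCoc C) : HopfCoc C :=
  HopfCoc.of (tensorHopf A.obj.X B.obj.X)
    (inferInstanceAs (IsCommComonObj (A.obj.X ⊗ B.obj.X)))

theorem isMonHom_rightUnitor_hom (A : C) [MonObj A] : IsMonHom (ρ_ A).hom :=
  (ρ_ (Mon.mk A)).hom.isMonHom_hom

theorem isMonHom_leftUnitor_hom (A : C) [MonObj A] : IsMonHom (λ_ A).hom :=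
  (λ_ (Mon.mk A)).hom.isMonHom_hom

theorem isMonHom_tensorHom {A B A' B' : C} [MonObj A] [MonObj B] [MonObj A'] [MonObj B']
    (f : A ⟶ A') (g : B ⟶ B') [IsMonHom f] [IsMonHom g] : IsMonHom (f ⊗ₘ g) :=
  (MonoidalCategoryStruct.tensorHom (C := Mon C) (X₁ := Mon.mk A) (Y₁ := Mon.mk A')
    (X₂ := Mon.mk B) (Y₂ := Mon.mk B') (Mon.Hom.mk f) (Mon.Hom.mk g)).isMonHom_hom

theorem isMonHom_counit (A : C) [BimonObj A] : IsMonHom ε[A] :=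
  ⟨BimonObj.one_counit A, BimonObj.mul_counit A⟩

theorem isMonHom_comul (A : C) [BimonObj A] : IsMonHom Δ[A] :=
  ⟨BimonObj.one_comul A, by
    rw [BimonObj.mul_comul]
    rfl⟩

namespace HopfCoc

/-- The first projection. -/
def fst (A B : HopfCoc C) : tensor A B ⟶ A :=
  have := isMonHom_rightUnitor_hom A.obj.X
  have := isMonHom_counit B.obj.X
  have := isMonHom_tensorHom (𝟙 A.obj.X) ε[B.obj.X]
  HopfCoc.homMk ((A.obj.X ◁ ε[B.obj.X]) ≫ (ρ_ A.obj.X).hom)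
    (by rw [← id_tensorHom]; infer_instance) (isComonHom_fst A.obj.X B.obj.X)

/-- The second projection. -/
def snd (A B : HopfCoc C) : tensor A B ⟶ B :=
  have := isMonHom_leftUnitor_hom B.obj.X
  have := isMonHom_counit A.obj.X
  have := isMonHom_tensorHom ε[A.obj.X] (𝟙 B.obj.X)
  HopfCoc.homMk ((ε[A.obj.X] ▷ B.obj.X) ≫ (λ_ B.obj.X).hom)
    (by rw [← tensorHom_id]; infer_instance) (isComonHom_snd A.obj.X B.obj.X)

/-- The pairing of two morphisms. -/
def pair {T A B : HopfCoc C} (f : T ⟶ A) (g : T ⟶ B) : T ⟶ tensor A B :=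
  have := isMonHom_underlying f.hom
  have := isMonHom_underlying g.hom
  have := isMonHom_comul T.obj.X
  have := isMonHom_tensorHom (underlying f.hom) (underlying g.hom)
  HopfCoc.homMk (Δ[T.obj.X] ≫ (underlying f.hom ⊗ₘ underlying g.hom)) inferInstance
    (isComonHom_pair _ _ (isComonHom_underlying f.hom) (isComonHom_underlying g.hom))

theorem pair_fst {T A B : HopfCoc C} (f : T ⟶ A) (g : T ⟶ B) : pair f g ≫ fst A B = f :=
  HopfCoc.hom_ext (pair_fst_aux _ _ (isComonHom_underlying g.hom))

theorem pair_snd {T A B : HopfCoc C} (f : T ⟶ A) (g : T ⟶ B) : pair f g ≫ snd A B = g :=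
  HopfCoc.hom_ext (pair_snd_aux _ _ (isComonHom_underlying f.hom))

theorem pair_eta {T A B : HopfCoc C} (m : T ⟶ tensor A B) :
    m = pair (m ≫ fst A B) (m ≫ snd A B) :=
  HopfCoc.hom_ext (pair_eta_aux (underlying m.hom) (isComonHom_underlying m.hom))

theorem isLimit_fst_snd (A B : HopfCoc C) : Nonempty (IsLimit (BinaryFan.mk (fst A B) (snd A B))) :=
  ⟨BinaryFan.isLimitMk (fun s => pair s.fst s.snd) (fun s => pair_fst _ _)
        (fun s => pair_snd _ _) (fun s m h1 h2 => by rw [pair_eta m, h1, h2])⟩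

end HopfCoc

end Tensor

/-! ### Homogeneous components, graded subspaces and quotients -/

namespace ColorVec

variable {k G : Type u} [Field k] [CommGroup G] {φ : CommutationFactor k G}

/-- The projection to the component of degree `g`. -/
def proj (V : ColorVec φ) (g : G) : V →ₗ[k] V := by
  classical
  exact V.glue fun h => if h = g then LinearMap.id else 0

theorem proj_of_mem {V : ColorVec φ} {g : G} {x : V} (hx : x ∈ V.grading g) :
    V.proj g x = x := by
  classical
  simp [proj, glue_apply V _ hx]

theorem proj_of_mem_ne {V : ColorVec φ} {g h : G} {x : V} (hx : x ∈ V.grading h) (hgh : g ≠ h) :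
    V.proj g x = 0 := by
  classical
  simp [proj, glue_apply V _ hx, hgh.symm]

theorem proj_mem (V : ColorVec φ) (g : G) (x : V) : V.proj g x ∈ V.grading g := by
  have hx : x ∈ Submodule.span k {x : V | ∃ g, x ∈ V.grading g} := by
    rw [V.span_homogeneous]
    trivial
  induction hx using Submodule.span_induction with
  | mem x hx =>
    obtain ⟨h, hx⟩ := hx
    by_cases hgh : g = h
    · subst hgh
      rwa [proj_of_mem hx]
    · rw [proj_of_mem_ne hx hgh]
      exact Submodule.zero_mem _
  | zero => simp
  | add x y _ _ hx hy =>
    rw [map_add]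
    exact Submodule.add_mem _ hx hy
  | smul c x _ hx =>
    rw [map_smul]
    exact Submodule.smul_mem _ _ hx

/-- Quantifying over all `t` containing `s` makes the statement additive in `x`; it also forces the
components of `x` outside `s` to vanish. -/
theorem exists_sum_proj (V : ColorVec φ) (x : V) :
    ∃ s : Finset G, ∀ t : Finset G, s ⊆ t → ∑ g ∈ t, V.proj g x = x := by
  classical
  have hx : x ∈ Submodule.span k {x : V | ∃ g, x ∈ V.grading g} := by
    rw [V.span_homogeneous]
    trivial
  induction hx using Submodule.span_induction with
  | mem x hx =>
    obtain ⟨h, hx⟩ := hx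
    refine ⟨{h}, fun t ht => ?_⟩
    rw [Finset.sum_eq_single h, proj_of_mem hx]
    · exact fun g _ hg => proj_of_mem_ne hx hg
    · exact fun hh => absurd (ht (Finset.mem_singleton_self h)) hh
  | zero => exact ⟨∅, by simp⟩
  | add x y _ _ hx hy =>
    obtain ⟨s, hs⟩ := hx
    obtain ⟨s', hs'⟩ := hy
    refine ⟨s ∪ s', fun t ht => ?_⟩
    simp only [map_add, Finset.sum_add_distrib]
    rw [hs t (Finset.union_subset_left ht), hs' t (Finset.union_subset_right ht)]
  | smul c x _ hx =>
    obtain ⟨s, hs⟩ := hx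
    exact ⟨s, fun t ht => by simp only [map_smul, ← Finset.smul_sum, hs t ht]⟩

/-- Preserving degrees implies commuting with the projections. In this form the grading passes to
equalizers, preimages and images. -/
theorem toLin_proj {V W : ColorVec φ} (f : V ⟶ W) (g : G) (x : V) :
    Hom.toLin f (V.proj g x) = W.proj g (Hom.toLin f x) := by
  have : Hom.toLin f ∘ₗ V.proj g = W.proj g ∘ₗ Hom.toLin f := by
    refine V.lin_ext fun h x hx => ?_
    rw [LinearMap.comp_apply, LinearMap.comp_apply]
    by_cases hgh : g = h
    · subst hgh
      rw [proj_of_mem hx, proj_of_mem (toLin_mem f hx)]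
    · rw [proj_of_mem_ne hx hgh, proj_of_mem_ne (toLin_mem f hx) hgh, map_zero]
  exact LinearMap.congr_fun this x

/-- A graded subspace: a subspace containing the homogeneous components of its elements. -/
def IsHomogeneous (V : ColorVec φ) (W : Submodule k V) : Prop :=
  ∀ g, ∀ x ∈ W, V.proj g x ∈ W

theorem isHomogeneous_span {V : ColorVec φ} {S : Set V} (hS : ∀ x ∈ S, ∃ g, x ∈ V.grading g) :
    V.IsHomogeneous (Submodule.span k S) := by
  intro g x hx
  induction hx using Submodule.span_induction with
  | mem x hx =>
    obtain ⟨h, hx'⟩ := hS x hx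
    by_cases hgh : g = h
    · subst hgh
      rw [proj_of_mem hx']
      exact Submodule.subset_span hx
    · rw [proj_of_mem_ne hx' hgh]
      exact Submodule.zero_mem _
  | zero => simp
  | add x y _ _ hx hy =>
    rw [map_add]
    exact Submodule.add_mem _ hx hy
  | smul c x _ hx =>
    rw [map_smul]
    exact Submodule.smul_mem _ _ hx

theorem isHomogeneous_eqLocus {V W : ColorVec φ} (f g : V ⟶ W) :
    V.IsHomogeneous (LinearMap.eqLocus (Hom.toLin f) (Hom.toLin g)) := by
  intro d x hx
  rw [LinearMap.mem_eqLocus] at hx ⊢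
  rw [toLin_proj, toLin_proj, hx]

open Classical in
/-- A graded subspace as an object. -/
abbrev subObj (V : ColorVec φ) (W : Submodule k V) (hW : V.IsHomogeneous W) : ColorVec φ where
  carrier := W
  grading g := (V.grading g).comap W.subtype
  isInternal := by
    refine isInternal_of_proj _ (fun g => (V.proj g).restrict (hW g)) ?_ ?_ ?_
    · intro g x hx
      exact Subtype.ext (proj_of_mem hx)
    · intro g h hgh x hx
      exact Subtype.ext (proj_of_mem_ne hx hgh)
    · rw [eq_top_iff]
      intro x _
      obtain ⟨s, hs⟩ := V.exists_sum_proj x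
      have : x = ∑ g ∈ s, (V.proj g).restrict (hW g) x := by
        refine Subtype.ext ?_
        rw [AddSubmonoidClass.coe_finsetSum]
        exact (hs s subset_rfl).symm
      rw [this]
      exact Submodule.sum_mem _ fun g _ => Submodule.mem_iSup_of_mem g (V.proj_mem g x)

/-- The inclusion of a graded subspace. -/
def subι (V : ColorVec φ) (W : Submodule k V) (hW : V.IsHomogeneous W) : V.subObj W hW ⟶ V :=
  ofLin (V := V.subObj W hW) W.subtype fun _ _ h => h

open Classical in
/-- The quotient by a graded subspace as an object. -/
abbrev quotObj (V : ColorVec φ) (W : Submodule k V) (hW : V.IsHomogeneous W) : ColorVec φ where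
  carrier := V ⧸ W
  grading g := (V.grading g).map W.mkQ
  isInternal := by
    refine isInternal_of_proj _ (fun g => W.mapQ W (V.proj g) (hW g)) ?_ ?_ ?_
    · rintro g _ ⟨x, hx, rfl⟩
      rw [Submodule.mkQ_apply, Submodule.mapQ_apply, proj_of_mem hx]
    · rintro g h hgh _ ⟨x, hx, rfl⟩
      rw [Submodule.mkQ_apply, Submodule.mapQ_apply, proj_of_mem_ne hx hgh]
      rfl
    · rw [← Submodule.map_iSup, V.isInternal.submodule_iSup_eq_top, Submodule.map_top,
        Submodule.range_mkQ]

/-- The projection to the quotient by a graded subspace. -/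
def quotπ (V : ColorVec φ) (W : Submodule k V) (hW : V.IsHomogeneous W) : V ⟶ V.quotObj W hW :=
  ofLin (W := V.quotObj W hW) W.mkQ fun _ x h => ⟨x, h, rfl⟩

theorem mono_of_injective {V W : ColorVec φ} (f : V ⟶ W) (hf : Function.Injective (Hom.toLin f)) :
    Mono f :=
  ⟨fun _ _ h => hom_ext (LinearMap.ext fun x =>
    hf (LinearMap.congr_fun (congrArg Hom.toLin h) x))⟩

theorem epi_of_surjective {V W : ColorVec φ} (f : V ⟶ W)
    (hf : Function.Surjective (Hom.toLin f)) : Epi f :=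
  ⟨fun _ _ h => hom_ext (LinearMap.ext fun y => by
    obtain ⟨x, rfl⟩ := hf y
    exact LinearMap.congr_fun (congrArg Hom.toLin h) x)⟩

theorem injective_tensorHom {V W V' W' : ColorVec φ} {f : V ⟶ W} {g : V' ⟶ W'}
    (hf : Function.Injective (Hom.toLin f)) (hg : Function.Injective (Hom.toLin g)) :
    Function.Injective (Hom.toLin (f ⊗ₘ g)) :=
  TensorProduct.map_injective_of_flat_flat (Hom.toLin f) (Hom.toLin g) hf hg

theorem surjective_tensorHom {V W V' W' : ColorVec φ} {f : V ⟶ W} {g : V' ⟶ W'}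
    (hf : Function.Surjective (Hom.toLin f)) (hg : Function.Surjective (Hom.toLin g)) :
    Function.Surjective (Hom.toLin (f ⊗ₘ g)) :=
  TensorProduct.map_surjective hf hg

theorem injective_whiskerLeft {V W : ColorVec φ} {f : V ⟶ W}
    (hf : Function.Injective (Hom.toLin f)) (Z : ColorVec φ) :
    Function.Injective (Hom.toLin (Z ◁ f)) :=
  Module.Flat.lTensor_preserves_injective_linearMap (Hom.toLin f) hf

theorem injective_whiskerRight {V W : ColorVec φ} {f : V ⟶ W}
    (hf : Function.Injective (Hom.toLin f)) (Z : ColorVec φ) :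
    Function.Injective (Hom.toLin (f ▷ Z)) :=
  Module.Flat.rTensor_preserves_injective_linearMap (Hom.toLin f) hf

/-- Since `f` commutes with the projections, `x` and its component of degree `g` have the same
image. Hence an injective morphism carries the induced grading, and lifts through it preserve
degrees. -/
theorem mem_grading_of_injective {V W : ColorVec φ} {f : V ⟶ W}
    (hf : Function.Injective (Hom.toLin f)) {g : G} {x : V}
    (hx : Hom.toLin f x ∈ W.grading g) : x ∈ V.grading g := by
  have : V.proj g x = x := hf (by rw [toLin_proj, proj_of_mem hx])
  rw [← this]
  exact V.proj_mem g x

theorem exists_mem_grading_of_surjective {V W : ColorVec φ} {f : V ⟶ W} {g : G} {y : W}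
    (hy : y ∈ W.grading g) (h : ∃ x, Hom.toLin f x = y) :
    ∃ x ∈ V.grading g, Hom.toLin f x = y := by
  obtain ⟨x, rfl⟩ := h
  exact ⟨V.proj g x, V.proj_mem g x, by rw [toLin_proj, proj_of_mem hy]⟩

theorem isGradedSubspace_of_injective {V W : ColorVec φ} {f : V ⟶ W}
    (hf : Function.Injective (Hom.toLin f)) {K : Submodule k W}
    (hK : LinearMap.range (Hom.toLin f) = K) : IsGradedSubspace (Hom.toLin f) K where
  injective := hf
  range_eq := hK
  grading_eq g := by
    refine le_antisymm ?_ ?_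
    · rintro _ ⟨x, hx, rfl⟩
      exact ⟨hK ▸ ⟨x, rfl⟩, toLin_mem f hx⟩
    · rintro y ⟨hy, hy'⟩
      rw [← hK] at hy
      obtain ⟨x, rfl⟩ := hy
      exact ⟨x, mem_grading_of_injective hf hy', rfl⟩

theorem isGradedQuotient_of_surjective {V W : ColorVec φ} {f : V ⟶ W}
    (hf : Function.Surjective (Hom.toLin f)) {K : Submodule k V}
    (hK : LinearMap.ker (Hom.toLin f) = K) : IsGradedQuotient (Hom.toLin f) K where
  surjective := hf
  ker_eq := hK
  grading_eq g := by
    refine le_antisymm (fun y hy => ?_) ?_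
    · obtain ⟨x, hx, rfl⟩ := exists_mem_grading_of_surjective hy (hf y)
      exact ⟨x, hx, rfl⟩
    · rintro _ ⟨x, hx, rfl⟩
      exact toLin_mem f hx

/-- A morphism factors through an injective morphism as soon as it does on elements. -/
theorem exists_lift {T V W : ColorVec φ} {i : V ⟶ W} (hi : Function.Injective (Hom.toLin i))
    (f : T ⟶ W) (hf : ∀ t, Hom.toLin f t ∈ LinearMap.range (Hom.toLin i)) :
    ∃ f' : T ⟶ V, f' ≫ i = f := by
  let e := LinearEquiv.ofInjective (Hom.toLin i) hi
  have he : ∀ t, Hom.toLin i (e.symm ⟨_, hf t⟩) = Hom.toLin f t := fun t =>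
    congrArg Subtype.val (e.apply_symm_apply ⟨_, hf t⟩)
  refine ⟨ofLin (e.symm.toLinearMap ∘ₗ (Hom.toLin f).codRestrict _ hf) fun g x hx =>
    mem_grading_of_injective hi ?_, hom_ext (LinearMap.ext fun t => he t)⟩
  exact (he x).symm ▸ toLin_mem f hx

/-- A morphism factors through a surjective morphism as soon as it kills its kernel. -/
theorem exists_desc {T V W : ColorVec φ} {p : V ⟶ W} (hp : Function.Surjective (Hom.toLin p))
    (f : V ⟶ T) (hf : LinearMap.ker (Hom.toLin p) ≤ LinearMap.ker (Hom.toLin f)) :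
    ∃ f' : W ⟶ T, p ≫ f' = f := by
  let e := (Hom.toLin p).quotKerEquivOfSurjective hp
  let f₀ := (LinearMap.ker (Hom.toLin p)).liftQ (Hom.toLin f) hf ∘ₗ e.symm.toLinearMap
  have he : ∀ x, f₀ (Hom.toLin p x) = Hom.toLin f x := fun x => by
    have : e.symm (Hom.toLin p x) = Submodule.Quotient.mk x := by
      rw [LinearEquiv.symm_apply_eq]
      rfl
    simp [f₀, this]
  refine ⟨ofLin f₀ fun g y hy => ?_, hom_ext (LinearMap.ext fun t => he t)⟩
  obtain ⟨x, hx, rfl⟩ := exists_mem_grading_of_surjective hy (hp y)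
  rw [he]
  exact toLin_mem f hx

/-- The identity `(W ⊗ V) ∩ (V ⊗ W) = V ⊗ V` inside `W ⊗ W`, a consequence of flatness. It is what
makes the equalizer subspace a subcoalgebra. -/
theorem range_map_eq_inf {V W : Type*} [AddCommGroup V] [Module k V] [AddCommGroup W] [Module k W]
    {i : V →ₗ[k] W} (hi : Function.Injective i) {t : W ⊗[k] W}
    (h1 : t ∈ LinearMap.range (i.lTensor W)) (h2 : t ∈ LinearMap.range (i.rTensor W)) :
    t ∈ LinearMap.range (TensorProduct.map i i) := by
  obtain ⟨s, rfl⟩ := h1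
  obtain ⟨r, hr⟩ := h2
  let π := (LinearMap.range i).mkQ
  have hex : Function.Exact i π := LinearMap.exact_map_mkQ_range i
  have h3 : π.rTensor W (i.lTensor W s) = 0 := by
    rw [← hr, ← LinearMap.rTensor_comp_apply, hex.linearMap_comp_eq_zero, LinearMap.rTensor_zero,
      LinearMap.zero_apply]
  -- The map `(W / V) ⊗ V → (W / V) ⊗ W` is injective, so the vanishing in `h3` already holds before
  -- applying `i` to the second factor. By exactness `s` then comes from `V ⊗ V`.
  have h4 : π.rTensor V s = 0 := by
    apply Module.Flat.lTensor_preserves_injective_linearMap (M := W ⧸ LinearMap.range i) i hi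
    rw [map_zero, ← h3, ← LinearMap.comp_apply, ← LinearMap.comp_apply,
      LinearMap.lTensor_comp_rTensor, LinearMap.rTensor_comp_lTensor]
  obtain ⟨q, rfl⟩ := (Module.Flat.rTensor_exact V hex s).mp h4
  exact ⟨q, by rw [← LinearMap.comp_apply, LinearMap.lTensor_comp_rTensor]⟩

end ColorVec

/-! ### Equalizers of cocommutative graded coalgebras -/

namespace ColorVec

variable {k G : Type u} [Field k] [CommGroup G] {φ : CommutationFactor k G}

section Equalizer

variable (A : ColorVec φ) [ComonObj A] {B : ColorVec φ} (f g : A ⟶ B)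

theorem isHomogeneous_equalizerSubspace :
    A.IsHomogeneous (equalizerSubspace A (Hom.toLin f) (Hom.toLin g)) :=
  isHomogeneous_eqLocus (Δ[A] ≫ A ◁ f) (Δ[A] ≫ A ◁ g)

/-- The subspace `equalizerSubspace`, as an object. -/
abbrev eqObj : ColorVec φ := A.subObj _ (isHomogeneous_equalizerSubspace A f g)

/-- The inclusion of `equalizerSubspace`. -/
def eqι : A.eqObj f g ⟶ A := A.subι _ (isHomogeneous_equalizerSubspace A f g)

theorem eqι_injective : Function.Injective (Hom.toLin (A.eqι f g)) := Subtype.val_injective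

theorem range_eqι : LinearMap.range (Hom.toLin (A.eqι f g)) =
    equalizerSubspace A (Hom.toLin f) (Hom.toLin g) := Submodule.range_subtype _

theorem eqι_comp : A.eqι f g ≫ Δ[A] ≫ A ◁ f = A.eqι f g ≫ Δ[A] ≫ A ◁ g :=
  hom_ext (LinearMap.ext fun x => x.2)

/-- Applying the counit to the first tensor factor of the defining equation recovers `f x = g x`. -/
theorem eqι_condition : A.eqι f g ≫ f = A.eqι f g ≫ g := by
  have h := congrArg (· ≫ ε[A] ▷ B ≫ (λ_ B).hom) (A.eqι_comp f g)
  simpa only [Category.assoc, whisker_exchange_assoc, ComonObj.counit_comul_assoc,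
    leftUnitor_naturality, Iso.inv_hom_id_assoc] using h

theorem exists_eqLift {T : ColorVec φ} (h : T ⟶ A) (w : h ≫ Δ[A] ≫ A ◁ f = h ≫ Δ[A] ≫ A ◁ g) :
    ∃ h' : T ⟶ A.eqObj f g, h' ≫ A.eqι f g = h := by
  refine exists_lift (A.eqι_injective f g) h fun t => ?_
  rw [range_eqι]
  exact LinearMap.congr_fun (congrArg Hom.toLin w) t

/-- For a comonoid morphism `h`, the map `(Id ⊗ f)Δh` equals `(h ⊗ fh)Δ`, which depends on `f` only
through `fh`. Hence comonoid morphisms equalizing `f` and `g` land in the equalizer subspace. -/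
theorem comp_comul_whiskerLeft {T : ColorVec φ} [ComonObj T] (h : T ⟶ A) (hh : IsComonHom h)
    (w : h ≫ f = h ≫ g) : h ≫ Δ[A] ≫ A ◁ f = h ≫ Δ[A] ≫ A ◁ g := by
  rw [reassoc_of% hh.hom_comul, reassoc_of% hh.hom_comul, ← id_tensorHom, ← id_tensorHom,
    tensorHom_comp_tensorHom, tensorHom_comp_tensorHom, w]

/-- The equalizer subspace `K` is a kernel, so flatness and coassociativity put `Δ(K)` in `A ⊗ K`.
Cocommutativity puts it in `K ⊗ A` as well, and the intersection is `K ⊗ K`. -/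
theorem exists_eqComul [IsCommComonObj A] :
    ∃ d : A.eqObj f g ⟶ A.eqObj f g ⊗ A.eqObj f g,
      d ≫ (A.eqι f g ⊗ₘ A.eqι f g) = A.eqι f g ≫ Δ[A] := by
  let i := A.eqι f g
  refine exists_lift (injective_tensorHom (A.eqι_injective f g) (A.eqι_injective f g)) _
    fun x => ?_
  let t : A ⊗[k] A := Hom.toLin (A.eqι f g ≫ Δ[A]) x
  -- By coassociativity the left side depends on `h` only through `(Id ⊗ h)Δ`, which is the same for
  -- `f` and `g` on the subspace.
  have hc : ∀ h : A ⟶ B, Δ[A] ≫ A ◁ (Δ[A] ≫ A ◁ h) =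
      (Δ[A] ≫ A ◁ h) ≫ Δ[A] ▷ B ≫ (α_ A A B).hom := by
    intro h
    rw [whiskerLeft_comp, ComonObj.comul_assoc_assoc, Category.assoc, whisker_exchange_assoc]
    monoidal
  have h1 : (Hom.toLin (Δ[A] ≫ A ◁ f) - Hom.toLin (Δ[A] ≫ A ◁ g)).lTensor A t = 0 := by
    rw [LinearMap.lTensor_sub, LinearMap.sub_apply, sub_eq_zero]
    have : A.eqι f g ≫ Δ[A] ≫ A ◁ (Δ[A] ≫ A ◁ f) = A.eqι f g ≫ Δ[A] ≫ A ◁ (Δ[A] ≫ A ◁ g) := by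
      rw [hc, hc, ← Category.assoc, A.eqι_comp f g, Category.assoc]
    exact LinearMap.congr_fun (congrArg Hom.toLin this) x
  have hex : Function.Exact (Hom.toLin (A.eqι f g))
      (Hom.toLin (Δ[A] ≫ A ◁ f) - Hom.toLin (Δ[A] ≫ A ◁ g)) := by
    intro y
    rw [LinearMap.sub_apply, sub_eq_zero]
    constructor
    · intro hy
      have : y ∈ LinearMap.range (Hom.toLin (A.eqι f g)) := by
        rw [range_eqι]
        exact hy
      exact this
    · rintro ⟨z, rfl⟩
      exact z.2
  obtain ⟨s, hs⟩ := (Module.Flat.lTensor_exact A hex t).mp h1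
  -- The braiding sends `A ⊗ K` to `K ⊗ A` and fixes `t`, which is a value of the cocommutative `Δ`.
  have h2 : t ∈ LinearMap.range ((Hom.toLin (A.eqι f g)).rTensor A) := by
    refine ⟨Hom.toLin (β_ _ _).hom s, ?_⟩
    have e1 : (β_ A (A.eqObj f g)).hom ≫ A.eqι f g ▷ A = A ◁ A.eqι f g ≫ (β_ A A).hom :=
      (BraidedCategory.braiding_naturality_right _ _).symm
    have e2 : (A.eqι f g ≫ Δ[A]) ≫ (β_ A A).hom = A.eqι f g ≫ Δ[A] := by
      rw [Category.assoc, IsCommComonObj.comul_comm]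
    have e3 : Hom.toLin (A.eqι f g ▷ A) (Hom.toLin (β_ A (A.eqObj f g)).hom s) =
        Hom.toLin (β_ A A).hom (Hom.toLin (A ◁ A.eqι f g) s) :=
      LinearMap.congr_fun (congrArg Hom.toLin e1) s
    have e4 : Hom.toLin (A ◁ A.eqι f g) s = t := hs
    rw [e4] at e3
    exact e3.trans (LinearMap.congr_fun (congrArg Hom.toLin e2) x)
  exact range_map_eq_inf (A.eqι_injective f g) ⟨s, hs⟩ h2

theorem mono_eqι : Mono (A.eqι f g) := mono_of_injective _ (A.eqι_injective f g)

theorem mono_of_injective₂ {V W : ColorVec φ} {i : V ⟶ W}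
    (hi : Function.Injective (Hom.toLin i)) : Mono (i ⊗ₘ i) :=
  mono_of_injective _ (injective_tensorHom hi hi)

theorem mono_of_injective₃ {V W : ColorVec φ} {i : V ⟶ W}
    (hi : Function.Injective (Hom.toLin i)) : Mono (i ⊗ₘ (i ⊗ₘ i)) :=
  mono_of_injective _ (injective_tensorHom hi (injective_tensorHom hi hi))

/-- The comonoid structure on the equalizer. -/
abbrev eqComon [IsCommComonObj A] : ComonObj (A.eqObj f g) :=
  ComonObj.ofMono (A.eqι f g) (mono_of_injective₃ (A.eqι_injective f g))
    (mono_of_injective _ (injective_whiskerLeft (A.eqι_injective f g) _))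
    (mono_of_injective _ (injective_whiskerRight (A.eqι_injective f g) _))
    (A.exists_eqComul f g).choose (A.exists_eqComul f g).choose_spec

theorem isComonHom_of_comp_mono {T K A : ColorVec φ} [ComonObj T] [ComonObj K] [ComonObj A]
    {i : K ⟶ A} (hi : Function.Injective (Hom.toLin i)) (hi' : IsComonHom i) {h : T ⟶ K}
    (hh : IsComonHom (h ≫ i)) : IsComonHom h where
  hom_counit := by
    rw [← hi'.hom_counit, ← Category.assoc, hh.hom_counit]
  hom_comul := by
    have := mono_of_injective₂ hi
    rw [← cancel_mono (i ⊗ₘ i), Category.assoc, ← hi'.hom_comul, ← Category.assoc, hh.hom_comul,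
      Category.assoc, tensorHom_comp_tensorHom]

theorem isMonHom_of_comp_mono {T K A : ColorVec φ} [MonObj T] [MonObj K] [MonObj A]
    {i : K ⟶ A} (hi : Function.Injective (Hom.toLin i)) (hi' : IsMonHom i) {h : T ⟶ K}
    (hh : IsMonHom (h ≫ i)) : IsMonHom h where
  one_hom := by
    have := mono_of_injective _ hi
    rw [← cancel_mono i, Category.assoc, hh.one_hom, hi'.one_hom]
  mul_hom := by
    have := mono_of_injective _ hi
    rw [← cancel_mono i, Category.assoc, hh.mul_hom, Category.assoc, hi'.mul_hom,
      tensorHom_comp_tensorHom_assoc]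

theorem isComonHom_eqι [IsCommComonObj A] :
    letI := A.eqComon f g
    IsComonHom (A.eqι f g) :=
  letI := A.eqComon f g
  { hom_counit := rfl
    hom_comul := (A.exists_eqComul f g).choose_spec.symm }

end Equalizer

section CommComon

open CommComonCartesian

variable {A B : CommComon (ColorVec φ)} (f g : A ⟶ B)

/-- The equalizer of two morphisms of cocommutative comonoids. -/
def commComonEq : CommComon (ColorVec φ) :=
  letI := A.X.eqComon (homX f) (homX g)
  { X := A.X.eqObj (homX f) (homX g)
    comon := A.X.eqComon (homX f) (homX g)
    comm := isCommComonObj_of_mono (A.X.eqι (homX f) (homX g))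
      (mono_of_injective₂ (A.X.eqι_injective (homX f) (homX g)))
      (A.X.isComonHom_eqι (homX f) (homX g)) }

/-- The inclusion of the equalizer. -/
def commComonEqι : commComonEq f g ⟶ A :=
  CommComonCartesian.homMk (A := commComonEq f g) (A.X.eqι (homX f) (homX g))
    (A.X.isComonHom_eqι (homX f) (homX g))

theorem commComonEqι_condition : commComonEqι f g ≫ f = commComonEqι f g ≫ g :=
  homX_ext (A.X.eqι_condition (homX f) (homX g))

theorem isLimit_commComonEqι : Nonempty (IsLimit (Fork.ofι _ (commComonEqι_condition f g))) := by
  have h : ∀ s : Fork f g, ∃ l : s.pt ⟶ commComonEq f g, l ≫ commComonEqι f g = s.ι := by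
    intro s
    obtain ⟨l, hl⟩ := A.X.exists_eqLift (homX f) (homX g) (homX s.ι)
      (A.X.comp_comul_whiskerLeft _ _ _ (isComonHom_homX s.ι) (congrArg homX s.condition))
    let := A.X.eqComon (homX f) (homX g)
    exact ⟨homMk (B := commComonEq f g) l (isComonHom_of_comp_mono
      (A.X.eqι_injective (homX f) (homX g)) (A.X.isComonHom_eqι (homX f) (homX g))
        (hl ▸ isComonHom_homX s.ι)), homX_ext hl⟩
  choose l hl using h
  refine ⟨Fork.IsLimit.mk _ l hl fun s m hm => homX_ext ?_⟩
  have := A.X.mono_eqι (homX f) (homX g)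
  exact (cancel_mono (A.X.eqι (homX f) (homX g))).mp (congrArg homX (hm.trans (hl s).symm))

theorem isGradedSubspace_commComonEqι : IsGradedSubspace (Hom.toLin (homX (commComonEqι f g)))
    (equalizerSubspace A.X (Hom.toLin (homX f)) (Hom.toLin (homX g))) :=
  isGradedSubspace_of_injective (A.X.eqι_injective (homX f) (homX g))
    (A.X.range_eqι (homX f) (homX g))

instance : HasEqualizers (CommComon (ColorVec φ)) :=
  have : ∀ {A B : CommComon (ColorVec φ)} {f g : A ⟶ B}, HasLimit (parallelPair f g) :=
    ⟨⟨⟨_, (isLimit_commComonEqι _ _).some⟩⟩⟩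
  hasEqualizers_of_hasLimit_parallelPair _

instance : HasFiniteLimits (CommComon (ColorVec φ)) :=
  hasFiniteLimits_of_hasEqualizers_and_finite_products

end CommComon

/-! ### Equalizers of cocommutative color Hopf algebras -/

section HopfCoc

open HopfCoc

variable {A B : HopfCoc (ColorVec φ)} (f g : A ⟶ B)

/-- The inclusion of the underlying object of the equalizer. -/
abbrev hopfEqι' := A.obj.X.eqι (underlying f.hom) (underlying g.hom)

/-- For a bialgebra morphism `h`, the map `(Id ⊗ h)Δ` is multiplicative from `A` to `A ⊗ B`. The
locus where two multiplicative maps agree is closed under products. -/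
theorem exists_hopfEq_mul : ∃ m, m ≫ hopfEqι' f g = (hopfEqι' f g ⊗ₘ hopfEqι' f g) ≫ μ[A.obj.X] := by
  refine A.obj.X.exists_eqLift _ _ _ ?_
  have h : ∀ h : A ⟶ B, μ[A.obj.X] ≫ Δ[A.obj.X] ≫ A.obj.X ◁ underlying h.hom =
      ((Δ[A.obj.X] ≫ A.obj.X ◁ underlying h.hom) ⊗ₘ (Δ[A.obj.X] ≫ A.obj.X ◁ underlying h.hom)) ≫
        tensorμ _ _ _ _ ≫ (μ[A.obj.X] ⊗ₘ μ[B.obj.X]) := by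
    intro h
    have := isMonHom_underlying h.hom
    rw [← tensorHom_comp_tensorHom_assoc, ← id_tensorHom, tensorμ_natural_assoc,
      BimonObj.mul_comul_assoc, tensorHom_comp_tensorHom, id_tensorHom_id,
      tensorHom_comp_tensorHom, Category.id_comp, ← IsMonHom.mul_hom, Category.comp_id]
  rw [Category.assoc, Category.assoc, h, h, tensorHom_comp_tensorHom_assoc,
    tensorHom_comp_tensorHom_assoc, A.obj.X.eqι_comp]

theorem exists_hopfEq_one : ∃ m, m ≫ hopfEqι' f g = η[A.obj.X] := by
  refine A.obj.X.exists_eqLift _ _ _ ?_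
  let := ComonObj.instTensorUnit (ColorVec φ)
  have := isMonHom_underlying f.hom
  have := isMonHom_underlying g.hom
  refine A.obj.X.comp_comul_whiskerLeft _ _ _ (isComonHom_one A.obj.X) ?_
  rw [IsMonHom.one_hom, IsMonHom.one_hom]

/-- Cocommutativity makes the antipode of `A` a comonoid morphism, so `(Id ⊗ h)Δ` intertwines `S`
with `S ⊗ S`. Without it the tensor factors would be exchanged. -/
theorem exists_hopfEq_antipode :
    ∃ m, m ≫ hopfEqι' f g = hopfEqι' f g ≫ HopfObj.antipode (X := A.obj.X) := by
  refine A.obj.X.exists_eqLift _ _ _ ?_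
  have h : ∀ h : A ⟶ B, HopfObj.antipode (X := A.obj.X) ≫ Δ[A.obj.X] ≫
      A.obj.X ◁ underlying h.hom = (Δ[A.obj.X] ≫ A.obj.X ◁ underlying h.hom) ≫
        (HopfObj.antipode (X := A.obj.X) ⊗ₘ HopfObj.antipode (X := B.obj.X)) := by
    intro h
    have : IsBimonHom (underlying h.hom) :=
      { __ := isMonHom_underlying h.hom, __ := isComonHom_underlying h.hom }
    rw [reassoc_of% (isComonHom_antipode A).hom_comul, ← id_tensorHom, Category.assoc,
      tensorHom_comp_tensorHom, tensorHom_comp_tensorHom,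
      HopfObj.hom_antipode (underlying h.hom), Category.comp_id, Category.id_comp]
  rw [Category.assoc, Category.assoc, h, h, ← Category.assoc, A.obj.X.eqι_comp, Category.assoc]

/-- The structure of Hopf monoid on the equalizer. -/
abbrev hopfEqObj : HopfObj (A.obj.X.eqObj (underlying f.hom) (underlying g.hom)) :=
  have hi := A.obj.X.eqι_injective (underlying f.hom) (underlying g.hom)
  HopfObj.ofMono (hopfEqι' f g) (mono_of_injective _ hi) (mono_of_injective₂ hi)
    (mono_of_injective₃ hi) (mono_of_injective _ (injective_whiskerLeft hi _))
    (mono_of_injective _ (injective_whiskerRight hi _))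
    (A.obj.X.exists_eqComul _ _).choose (A.obj.X.exists_eqComul _ _).choose_spec
    (exists_hopfEq_mul f g).choose (exists_hopfEq_mul f g).choose_spec
    (exists_hopfEq_one f g).choose (exists_hopfEq_one f g).choose_spec
    (exists_hopfEq_antipode f g).choose (exists_hopfEq_antipode f g).choose_spec

theorem isComonHom_hopfEqι' :
    letI := hopfEqObj f g
    IsComonHom (hopfEqι' f g) :=
  A.obj.X.isComonHom_eqι (underlying f.hom) (underlying g.hom)

/-- The equalizer of two morphisms of cocommutative color Hopf algebras. -/
abbrev hopfEq : HopfCoc (ColorVec φ) :=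
  letI := hopfEqObj f g
  HopfCoc.of (hopfEqObj f g) (isCommComonObj_of_mono (hopfEqι' f g)
      (mono_of_injective₂ (A.obj.X.eqι_injective _ _)) (isComonHom_hopfEqι' f g))

/-- The inclusion of the equalizer. -/
def hopfEqι : hopfEq f g ⟶ A :=
  letI := hopfEqObj f g
  HopfCoc.homMk (A := hopfEq f g) (hopfEqι' f g)
    ⟨(exists_hopfEq_one f g).choose_spec, (exists_hopfEq_mul f g).choose_spec⟩
    (isComonHom_hopfEqι' f g)

theorem hopfEqι_condition : hopfEqι f g ≫ f = hopfEqι f g ≫ g :=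
  HopfCoc.hom_ext (A.obj.X.eqι_condition (underlying f.hom) (underlying g.hom))

theorem isLimit_hopfEqι : Nonempty (IsLimit (Fork.ofι _ (hopfEqι_condition f g))) := by
  have h : ∀ s : Fork f g, ∃ l : s.pt ⟶ hopfEq f g, l ≫ hopfEqι f g = s.ι := by
    intro s
    let := hopfEqObj f g
    obtain ⟨l, hl⟩ := A.obj.X.exists_eqLift (underlying f.hom) (underlying g.hom)
      (underlying s.ι.hom) (A.obj.X.comp_comul_whiskerLeft _ _ _ (isComonHom_underlying s.ι.hom)
        (congrArg (fun t => underlying t.hom) s.condition))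
    have hi := A.obj.X.eqι_injective (underlying f.hom) (underlying g.hom)
    exact ⟨HopfCoc.homMk (B := hopfEq f g) l
      (isMonHom_of_comp_mono hi (isMonHom_underlying (hopfEqι f g).hom)
        (hl ▸ isMonHom_underlying s.ι.hom))
      (isComonHom_of_comp_mono hi (isComonHom_hopfEqι' f g)
        (hl ▸ isComonHom_underlying s.ι.hom)), HopfCoc.hom_ext hl⟩
  choose l hl using h
  refine ⟨Fork.IsLimit.mk _ l hl fun s m hm => HopfCoc.hom_ext ?_⟩
  have := A.obj.X.mono_eqι (underlying f.hom) (underlying g.hom)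
  exact (cancel_mono (A.obj.X.eqι (underlying f.hom) (underlying g.hom))).mp
    (congrArg (fun t => underlying t.hom) (hm.trans (hl s).symm))

theorem isGradedSubspace_hopfEqι : IsGradedSubspace (ColorHopf.lin (hopfEqι f g).hom)
    (equalizerSubspace A.obj.X (ColorHopf.lin f.hom) (ColorHopf.lin g.hom)) :=
  isGradedSubspace_of_injective (A.obj.X.eqι_injective _ _) (A.obj.X.range_eqι _ _)

end HopfCoc

end ColorVec

/-! ### Graded algebras and their two-sided ideals -/

namespace ColorVec

variable {k G : Type u} [Field k] [CommGroup G] {φ : CommutationFactor k G}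

section Algebra

variable (A : ColorVec φ) [MonObj A]

theorem mulElt_assoc (x y z : A) : A.mulElt (A.mulElt x y) z = A.mulElt x (A.mulElt y z) :=
  LinearMap.congr_fun (congrArg Hom.toLin (MonObj.mul_assoc A)) ((x ⊗ₜ[k] y) ⊗ₜ[k] z)

theorem oneElt_mulElt (x : A) : A.mulElt A.oneElt x = x := by
  have h := LinearMap.congr_fun (congrArg Hom.toLin (MonObj.one_mul A)) ((1 : k) ⊗ₜ[k] x)
  exact h.trans (one_smul k x)

theorem mulElt_oneElt (x : A) : A.mulElt x A.oneElt = x := by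
  have h := LinearMap.congr_fun (congrArg Hom.toLin (MonObj.mul_one A)) (x ⊗ₜ[k] (1 : k))
  exact h.trans (one_smul k x)

/-- The ring underlying a graded algebra. -/
abbrev ring : Ring A where
  __ := A.addCommGroup
  mul := A.mulElt
  one := A.oneElt
  mul_assoc := A.mulElt_assoc
  one_mul := A.oneElt_mulElt
  mul_one := A.mulElt_oneElt
  zero_mul x := by
    change Hom.toLin μ[A] (0 ⊗ₜ[k] x) = 0
    rw [TensorProduct.zero_tmul, map_zero]
  mul_zero x := by
    change Hom.toLin μ[A] (x ⊗ₜ[k] 0) = 0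
    rw [TensorProduct.tmul_zero, map_zero]
  left_distrib x y z := by
    change Hom.toLin μ[A] (x ⊗ₜ[k] (y + z)) = _
    rw [TensorProduct.tmul_add, map_add]
    rfl
  right_distrib x y z := by
    change Hom.toLin μ[A] ((x + y) ⊗ₜ[k] z) = _
    rw [TensorProduct.add_tmul, map_add]
    rfl
  zsmul := A.addCommGroup.zsmul

attribute [local instance] ring

/-- The algebra underlying a graded algebra. -/
abbrev algebra : Algebra k A :=
  Algebra.ofModule
    (fun r x y => by
      change Hom.toLin μ[A] ((r • x) ⊗ₜ[k] y) = r • Hom.toLin μ[A] (x ⊗ₜ[k] y)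
      rw [← TensorProduct.smul_tmul', map_smul])
    (fun r x y => by
      change Hom.toLin μ[A] (x ⊗ₜ[k] (r • y)) = r • Hom.toLin μ[A] (x ⊗ₜ[k] y)
      rw [TensorProduct.tmul_smul, map_smul])

attribute [local instance] algebra

variable {A} {B : ColorVec φ} [MonObj B]

theorem map_mulElt (f : A ⟶ B) [IsMonHom f] (x y : A) :
    Hom.toLin f (A.mulElt x y) = B.mulElt (Hom.toLin f x) (Hom.toLin f y) :=
  LinearMap.congr_fun (congrArg Hom.toLin (IsMonHom.mul_hom f)) (x ⊗ₜ[k] y)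

theorem map_oneElt (f : A ⟶ B) [IsMonHom f] : Hom.toLin f A.oneElt = B.oneElt :=
  LinearMap.congr_fun (congrArg Hom.toLin (IsMonHom.one_hom f)) (1 : k)

/-- A morphism of monoids, as a homomorphism of algebras. -/
abbrev toAlgHom (f : A ⟶ B) [IsMonHom f] : A →ₐ[k] B :=
  AlgHom.ofLinearMap (Hom.toLin f) (map_oneElt f) (map_mulElt f)

theorem mul_mem_grading {a b : G} {x y : A} (hx : x ∈ A.grading a) (hy : y ∈ A.grading b) :
    x * y ∈ A.grading (a * b) :=
  toLin_mem μ[A] (tmul_mem hx hy)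

theorem one_mem_grading : (1 : A) ∈ A.grading 1 :=
  toLin_mem η[A] (mem_unitGrading_one (1 : k))

theorem isMonHom_of_map {f : A ⟶ B} (h1 : Hom.toLin f 1 = 1)
    (h2 : ∀ x y : A, Hom.toLin f (x * y) = Hom.toLin f x * Hom.toLin f y) : IsMonHom f where
  one_hom := hom_ext (LinearMap.ext_ring h1)
  mul_hom := hom_ext (TensorProduct.ext' h2)

theorem idealGenerated_eq (S : Set A) :
    A.idealGenerated S = Submodule.span k {z | ∃ x : A, ∃ s ∈ S, ∃ y : A, z = x * s * y} := rfl

theorem mul_mem_idealGenerated (S : Set A) (x : A) {z : A} (hz : z ∈ A.idealGenerated S) :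
    x * z ∈ A.idealGenerated S := by
  rw [idealGenerated_eq] at hz ⊢
  induction hz using Submodule.span_induction with
  | mem z hz =>
    obtain ⟨a, s, hs, b, rfl⟩ := hz
    exact Submodule.subset_span ⟨x * a, s, hs, b, by simp only [mul_assoc]⟩
  | zero => simp
  | add z w _ _ hz hw =>
    rw [mul_add]
    exact Submodule.add_mem _ hz hw
  | smul c z _ hz =>
    rw [mul_smul_comm]
    exact Submodule.smul_mem _ _ hz

theorem mul_mem_idealGenerated' (S : Set A) (x : A) {z : A} (hz : z ∈ A.idealGenerated S) :
    z * x ∈ A.idealGenerated S := by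
  rw [idealGenerated_eq] at hz ⊢
  induction hz using Submodule.span_induction with
  | mem z hz =>
    obtain ⟨a, s, hs, b, rfl⟩ := hz
    exact Submodule.subset_span ⟨a, s, hs, b * x, by simp only [mul_assoc]⟩
  | zero => simp
  | add z w _ _ hz hw =>
    rw [add_mul]
    exact Submodule.add_mem _ hz hw
  | smul c z _ hz =>
    rw [smul_mul_assoc]
    exact Submodule.smul_mem _ _ hz

theorem subset_idealGenerated (S : Set A) : S ⊆ A.idealGenerated S := fun s hs => by
  rw [idealGenerated_eq]
  exact Submodule.subset_span ⟨1, s, hs, 1, by simp⟩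

/-- Expanding `x`, `s` and `y` into components writes `x s y` as a sum of products of homogeneous
elements; by hypothesis the components of `s` are again generators. -/
theorem isHomogeneous_idealGenerated {S : Set A} (hS : ∀ s ∈ S, ∀ g, A.proj g s ∈ S) :
    A.IsHomogeneous (A.idealGenerated S) := by
  let S' : Set A := {z | ∃ x : A, ∃ s ∈ S, ∃ y : A, z = x * s * y ∧ (∃ a, x ∈ A.grading a) ∧
    (∃ a, s ∈ A.grading a) ∧ ∃ a, y ∈ A.grading a}
  have h : A.idealGenerated S = Submodule.span k S' := by
    rw [idealGenerated_eq]
    refine le_antisymm (Submodule.span_le.mpr ?_) (Submodule.span_mono ?_)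
    · rintro _ ⟨x, s, hs, y, rfl⟩
      obtain ⟨tx, hx⟩ := A.exists_sum_proj x
      obtain ⟨ts, hs'⟩ := A.exists_sum_proj s
      obtain ⟨ty, hy⟩ := A.exists_sum_proj y
      rw [← hx tx subset_rfl, ← hs' ts subset_rfl, ← hy ty subset_rfl, Finset.sum_mul_sum,
        Finset.sum_mul]
      simp only [Finset.sum_mul, Finset.mul_sum]
      refine Submodule.sum_mem _ fun a _ => Submodule.sum_mem _ fun b _ =>
        Submodule.sum_mem _ fun c _ => Submodule.subset_span
          ⟨_, _, hS s hs _, _, rfl, ⟨_, A.proj_mem _ _⟩, ⟨_, A.proj_mem _ _⟩, ⟨_, A.proj_mem _ _⟩⟩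
    · rintro _ ⟨x, s, hs, y, rfl, -⟩
      exact ⟨x, s, hs, y, rfl⟩
  rw [h]
  refine isHomogeneous_span ?_
  rintro _ ⟨x, s, hs, y, rfl, ⟨a, hx⟩, ⟨b, hs'⟩, ⟨c, hy⟩⟩
  exact ⟨_, mul_mem_grading (mul_mem_grading hx hs') hy⟩

theorem idealGenerated_le_ker {S : Set A} (f : A ⟶ B) [IsMonHom f]
    (hS : ∀ s ∈ S, Hom.toLin f s = 0) : A.idealGenerated S ≤ LinearMap.ker (Hom.toLin f) := by
  rw [idealGenerated_eq]
  refine Submodule.span_le.mpr ?_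
  rintro _ ⟨x, s, hs, y, rfl⟩
  change toAlgHom f (x * s * y) = 0
  have : toAlgHom f s = 0 := hS s hs
  rw [map_mul, map_mul, this, mul_zero, zero_mul]

end Algebra

section Surjective

theorem jointlyEpi_of_surjective {V W : ColorVec φ} {p : V ⟶ W}
    (hp : Function.Surjective (Hom.toLin p)) : JointlyEpi fun _ : Unit => p := by
  intro Z f g h
  have := epi_of_surjective p hp
  exact (cancel_epi p).mp (h ())

/-- By right exactness, the kernel of `p ⊗ p` is `ker p ⊗ V + V ⊗ ker p`. -/
theorem exists_desc₂ {V W T : ColorVec φ} {p : V ⟶ W} (hp : Function.Surjective (Hom.toLin p))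
    (f : V ⊗ V ⟶ T)
    (h1 : ∀ x y, Hom.toLin p x = 0 → Hom.toLin f (x ⊗ₜ[k] y) = 0)
    (h2 : ∀ x y, Hom.toLin p y = 0 → Hom.toLin f (x ⊗ₜ[k] y) = 0) :
    ∃ f' : W ⊗ W ⟶ T, (p ⊗ₘ p) ≫ f' = f := by
  refine exists_desc (surjective_tensorHom hp hp) f ?_
  have hex := (Hom.toLin p).exact_subtype_ker_map
  change LinearMap.ker (TensorProduct.map (Hom.toLin p) (Hom.toLin p)) ≤ _
  rw [TensorProduct.map_ker hex hp hex hp, sup_le_iff]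
  constructor
  · rintro _ ⟨t, rfl⟩
    have : Hom.toLin f ∘ₗ (LinearMap.ker (Hom.toLin p)).subtype.lTensor V = 0 :=
      TensorProduct.ext' fun x y => h2 x y y.2
    exact LinearMap.congr_fun this t
  · rintro _ ⟨t, rfl⟩
    have : Hom.toLin f ∘ₗ (LinearMap.ker (Hom.toLin p)).subtype.rTensor V = 0 :=
      TensorProduct.ext' fun x y => h1 x y x.2
    exact LinearMap.congr_fun this t

theorem isMonHom_of_epi_comp {A Q T : ColorVec φ} [MonObj A] [MonObj Q] [MonObj T] {p : A ⟶ Q}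
    (hp : Function.Surjective (Hom.toLin p)) (hp' : IsMonHom p) {h : Q ⟶ T}
    (hh : IsMonHom (p ≫ h)) : IsMonHom h where
  one_hom := by
    rw [← hp'.one_hom, Category.assoc, hh.one_hom]
  mul_hom := by
    have := epi_of_surjective _ (surjective_tensorHom hp hp)
    rw [← cancel_epi (p ⊗ₘ p), ← reassoc_of% hp'.mul_hom, hh.mul_hom,
      tensorHom_comp_tensorHom_assoc]

theorem isComonHom_of_epi_comp {A Q T : ColorVec φ} [ComonObj A] [ComonObj Q] [ComonObj T]
    {p : A ⟶ Q} (hp : Function.Surjective (Hom.toLin p)) (hp' : IsComonHom p) {h : Q ⟶ T}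
    (hh : IsComonHom (p ≫ h)) : IsComonHom h where
  hom_counit := by
    have := epi_of_surjective _ hp
    rw [← cancel_epi p, ← Category.assoc, hh.hom_counit, hp'.hom_counit]
  hom_comul := by
    have := epi_of_surjective _ hp
    rw [← cancel_epi p, ← Category.assoc, hh.hom_comul, ← Category.assoc, hp'.hom_comul,
      Category.assoc, tensorHom_comp_tensorHom]

end Surjective

/-! ### Coequalizers of color Hopf algebras -/

section Coequalizer

open HopfCoc

attribute [local instance] ring algebra

variable {A B : Hopf (ColorVec φ)} (f g : A ⟶ B)

/-- The ideal generated by the differences of two morphisms. -/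
abbrev coeqIdeal : Submodule k B.X :=
  B.X.idealGenerated {b | ∃ a, b = ColorHopf.lin f a - ColorHopf.lin g a}

theorem isHomogeneous_coeqIdeal : B.X.IsHomogeneous (coeqIdeal f g) := by
  refine isHomogeneous_idealGenerated ?_
  rintro _ ⟨a, rfl⟩ d
  exact ⟨A.X.proj d a, by rw [map_sub, ColorHopf.lin, ColorHopf.lin, toLin_proj, toLin_proj]⟩

/-- The underlying object of the coequalizer. -/
abbrev coeqObj : ColorVec φ := B.X.quotObj _ (isHomogeneous_coeqIdeal f g)

/-- The projection to the underlying object of the coequalizer. -/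
def coeqπ : B.X ⟶ coeqObj f g := B.X.quotπ _ (isHomogeneous_coeqIdeal f g)

theorem coeqπ_surjective : Function.Surjective (Hom.toLin (coeqπ f g)) :=
  Submodule.mkQ_surjective _

theorem ker_coeqπ : LinearMap.ker (Hom.toLin (coeqπ f g)) = coeqIdeal f g := Submodule.ker_mkQ _

theorem coeqπ_eq_zero {x : B.X} : Hom.toLin (coeqπ f g) x = 0 ↔ x ∈ coeqIdeal f g :=
  Submodule.Quotient.mk_eq_zero _

/-- The target is an arbitrary graded algebra. Taking `Q ⊗ Q`, the unit object and the opposite of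
`Q` for the quotient `Q` yields its comultiplication, counit and antipode, with no separate check
that the ideal is a Hopf ideal. -/
theorem exists_coeqDesc {Z : ColorVec φ} [MonObj Z] (h : B.X ⟶ Z) (hh : IsMonHom h)
    (w : underlying f ≫ h = underlying g ≫ h) : ∃ h', coeqπ f g ≫ h' = h := by
  refine exists_desc (coeqπ_surjective f g) h ?_
  rw [ker_coeqπ]
  refine idealGenerated_le_ker h ?_
  rintro _ ⟨a, rfl⟩
  rw [map_sub, sub_eq_zero]
  exact LinearMap.congr_fun (congrArg Hom.toLin w) a

theorem coeqπ_condition : underlying f ≫ coeqπ f g = underlying g ≫ coeqπ f g :=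
  hom_ext (LinearMap.ext fun a => by
    rw [← sub_eq_zero]
    refine (map_sub (Hom.toLin (coeqπ f g)) _ _).symm.trans ?_
    rw [coeqπ_eq_zero]
    exact subset_idealGenerated _ ⟨a, rfl⟩)

theorem exists_coeqMul : ∃ m, (coeqπ f g ⊗ₘ coeqπ f g) ≫ m = μ[B.X] ≫ coeqπ f g :=
  exists_desc₂ (coeqπ_surjective f g) _
    (fun _ y hx => (coeqπ_eq_zero f g).mpr
      (mul_mem_idealGenerated' _ y ((coeqπ_eq_zero f g).mp hx)))
    (fun x _ hy => (coeqπ_eq_zero f g).mpr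
      (mul_mem_idealGenerated _ x ((coeqπ_eq_zero f g).mp hy)))

theorem jointlyEpi_coeqπ₃ :
    JointlyEpi fun _ : Unit => (coeqπ f g ⊗ₘ coeqπ f g) ⊗ₘ coeqπ f g :=
  jointlyEpi_of_surjective (surjective_tensorHom
    (surjective_tensorHom (coeqπ_surjective f g) (coeqπ_surjective f g)) (coeqπ_surjective f g))

theorem jointlyEpi_whiskerLeft {V W : ColorVec φ} {p : V ⟶ W}
    (hp : Function.Surjective (Hom.toLin p)) (Z : ColorVec φ) :
    JointlyEpi fun _ : Unit => Z ◁ p :=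
  jointlyEpi_of_surjective (LinearMap.lTensor_surjective Z hp)

theorem jointlyEpi_whiskerRight {V W : ColorVec φ} {p : V ⟶ W}
    (hp : Function.Surjective (Hom.toLin p)) (Z : ColorVec φ) :
    JointlyEpi fun _ : Unit => p ▷ Z :=
  jointlyEpi_of_surjective (LinearMap.rTensor_surjective Z hp)

/-- The monoid structure on the coequalizer. -/
abbrev coeqMon : MonObj (coeqObj f g) :=
  MonObj.ofJointlyEpi (fun _ : Unit => coeqπ f g) (jointlyEpi_coeqπ₃ f g)
    (jointlyEpi_whiskerLeft (coeqπ_surjective f g) _)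
    (jointlyEpi_whiskerRight (coeqπ_surjective f g) _)
    (exists_coeqMul f g).choose (fun _ => (exists_coeqMul f g).choose_spec)
    (η[B.X] ≫ coeqπ f g) (fun _ => rfl)

theorem isMonHom_coeqπ :
    letI := coeqMon f g
    IsMonHom (coeqπ f g) :=
  letI := coeqMon f g
  { one_hom := rfl
    mul_hom := (exists_coeqMul f g).choose_spec.symm }

theorem exists_coeqComul :
    ∃ d, coeqπ f g ≫ d = Δ[B.X] ≫ (coeqπ f g ⊗ₘ coeqπ f g) := by
  let := coeqMon f g
  have := isMonHom_coeqπ f g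
  have := isMonHom_comul B.X
  have := isMonHom_tensorHom (coeqπ f g) (coeqπ f g)
  refine exists_coeqDesc f g _ inferInstance ?_
  rw [reassoc_of% (isComonHom_underlying f).hom_comul, reassoc_of% (isComonHom_underlying g).hom_comul,
    tensorHom_comp_tensorHom, tensorHom_comp_tensorHom, coeqπ_condition]

theorem exists_coeqCounit : ∃ d, coeqπ f g ≫ d = ε[B.X] := by
  refine exists_coeqDesc f g _ (isMonHom_counit B.X) ?_
  rw [(isComonHom_underlying f).hom_counit, (isComonHom_underlying g).hom_counit]

theorem exists_coeqAntipode :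
    ∃ s, coeqπ f g ≫ s = HopfObj.antipode (X := B.X) ≫ coeqπ f g := by
  have h1 : IsBimonHom (underlying f) :=
    { __ := isMonHom_underlying f, __ := isComonHom_underlying f }
  have h2 : IsBimonHom (underlying g) :=
    { __ := isMonHom_underlying g, __ := isComonHom_underlying g }
  have w : underlying f ≫ HopfObj.antipode (X := B.X) ≫ coeqπ f g =
      underlying g ≫ HopfObj.antipode (X := B.X) ≫ coeqπ f g := by
    rw [← Category.assoc, ← Category.assoc, HopfObj.hom_antipode (underlying f),
      HopfObj.hom_antipode (underlying g), Category.assoc, Category.assoc, coeqπ_condition]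
  -- The antipode followed by the projection reverses products, so it is an algebra map to the
  -- opposite of the quotient, where the universal property of the quotient applies.
  let M := coeqMon f g
  have hp := isMonHom_opposite (coeqπ f g) (isMonHom_coeqπ f g)
  have hs := isMonHom_antipode B.X
  exact @exists_coeqDesc _ _ _ _ _ _ _ f g _ (MonObj.opposite (coeqObj f g))
    (HopfObj.antipode (X := B.X) ≫ coeqπ f g)
    (@IsMonHom.mk _ _ _ _ _ _ (MonObj.opposite (coeqObj f g)) _
      (by rw [← Category.assoc, hs.one_hom, hp.one_hom])
      (by rw [← Category.assoc, hs.mul_hom, Category.assoc, hp.mul_hom,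
            tensorHom_comp_tensorHom_assoc])) w

/-- The Hopf monoid structure on the coequalizer. -/
abbrev coeqHopfObj : HopfObj (coeqObj f g) :=
  HopfObj.ofJointlyEpi (fun _ : Unit => coeqπ f g)
    (jointlyEpi_of_surjective (coeqπ_surjective f g))
    (jointlyEpi_of_surjective (surjective_tensorHom (coeqπ_surjective f g) (coeqπ_surjective f g)))
    (jointlyEpi_coeqπ₃ f g)
    (jointlyEpi_whiskerLeft (coeqπ_surjective f g) _)
    (jointlyEpi_whiskerRight (coeqπ_surjective f g) _)
    (exists_coeqComul f g).choose (fun _ => (exists_coeqComul f g).choose_spec)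
    (exists_coeqCounit f g).choose (fun _ => (exists_coeqCounit f g).choose_spec)
    (exists_coeqMul f g).choose (fun _ => (exists_coeqMul f g).choose_spec)
    (η[B.X] ≫ coeqπ f g) (fun _ => rfl) ⟨()⟩
    (exists_coeqAntipode f g).choose (fun _ => (exists_coeqAntipode f g).choose_spec)

theorem isComonHom_coeqπ :
    letI := coeqHopfObj f g
    IsComonHom (coeqπ f g) :=
  letI := coeqHopfObj f g
  { hom_counit := (exists_coeqCounit f g).choose_spec
    hom_comul := (exists_coeqComul f g).choose_spec }

/-- The coequalizer of two morphisms of color Hopf algebras. -/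
abbrev hopfCoeq : Hopf (ColorVec φ) := @Hopf.mk _ _ _ _ (coeqObj f g) (coeqHopfObj f g)

/-- The projection to the coequalizer. -/
def hopfCoeqπ : B ⟶ hopfCoeq f g :=
  letI := coeqHopfObj f g
  Hopf.homMk (B := hopfCoeq f g) (coeqπ f g) (isMonHom_coeqπ f g) (isComonHom_coeqπ f g)

theorem hopfCoeqπ_condition : f ≫ hopfCoeqπ f g = g ≫ hopfCoeqπ f g :=
  underlying_ext (coeqπ_condition f g)

theorem exists_hopfCoeqDesc {Z : Hopf (ColorVec φ)} (h : B ⟶ Z) (w : f ≫ h = g ≫ h) :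
    ∃ l : hopfCoeq f g ⟶ Z, hopfCoeqπ f g ≫ l = h := by
  let := coeqHopfObj f g
  obtain ⟨l, hl⟩ := exists_coeqDesc f g (underlying h) (isMonHom_underlying h)
    (congrArg underlying w)
  exact ⟨Hopf.homMk (A := hopfCoeq f g) l
    (isMonHom_of_epi_comp (coeqπ_surjective f g) (isMonHom_coeqπ f g)
      (hl ▸ isMonHom_underlying h))
    (isComonHom_of_epi_comp (coeqπ_surjective f g) (isComonHom_coeqπ f g)
      (hl ▸ isComonHom_underlying h)), underlying_ext hl⟩

theorem hopfCoeqπ_cancel {Z : Hopf (ColorVec φ)} {l m : hopfCoeq f g ⟶ Z}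
    (h : hopfCoeqπ f g ≫ l = hopfCoeqπ f g ≫ m) : l = m := by
  have := epi_of_surjective _ (coeqπ_surjective f g)
  exact underlying_ext ((cancel_epi (coeqπ f g)).mp (congrArg underlying h))

theorem isColimit_hopfCoeqπ : Nonempty (IsColimit (Cofork.ofπ _ (hopfCoeqπ_condition f g))) := by
  choose l hl using fun s : Cofork f g => exists_hopfCoeqDesc f g s.π s.condition
  exact ⟨Cofork.IsColimit.mk _ l hl fun s m hm => hopfCoeqπ_cancel f g (hm.trans (hl s).symm)⟩

theorem isGradedQuotient_hopfCoeqπ :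
    IsGradedQuotient (ColorHopf.lin (hopfCoeqπ f g)) (coeqIdeal f g) :=
  isGradedQuotient_of_surjective (coeqπ_surjective f g) (ker_coeqπ f g)

instance : HasCoequalizers (Hopf (ColorVec φ)) :=
  have : ∀ {A B : Hopf (ColorVec φ)} {f g : A ⟶ B}, HasColimit (parallelPair f g) :=
    ⟨⟨⟨_, (isColimit_hopfCoeqπ _ _).some⟩⟩⟩
  hasCoequalizers_of_hasColimit_parallelPair _

end Coequalizer

section CoequalizerCoc

open HopfCoc

variable {A B : HopfCoc (ColorVec φ)} (f g : A ⟶ B)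

/-- The coequalizer of two morphisms of cocommutative color Hopf algebras. -/
abbrev hopfCocCoeq : HopfCoc (ColorVec φ) where
  obj := hopfCoeq f.hom g.hom
  property :=
    letI := coeqHopfObj f.hom g.hom
    isCommComonObj_of_epi (coeqπ f.hom g.hom) (epi_of_surjective _ (coeqπ_surjective f.hom g.hom))
      (isComonHom_coeqπ f.hom g.hom)

/-- The projection to the coequalizer. -/
def hopfCocCoeqπ : B ⟶ hopfCocCoeq f g := ObjectProperty.homMk (hopfCoeqπ f.hom g.hom)

theorem hopfCocCoeqπ_condition : f ≫ hopfCocCoeqπ f g = g ≫ hopfCocCoeqπ f g :=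
  ObjectProperty.hom_ext _ (hopfCoeqπ_condition f.hom g.hom)

theorem isColimit_hopfCocCoeqπ :
    Nonempty (IsColimit (Cofork.ofπ _ (hopfCocCoeqπ_condition f g))) := by
  choose l hl using fun s : Cofork f g =>
    exists_hopfCoeqDesc f.hom g.hom s.π.hom (congrArg (·.hom) s.condition)
  exact ⟨Cofork.IsColimit.mk _ (fun s => ObjectProperty.homMk (l s))
    (fun s => ObjectProperty.hom_ext _ (hl s))
    fun s m hm => ObjectProperty.hom_ext _ (hopfCoeqπ_cancel f.hom g.hom
      ((congrArg (·.hom) hm).trans (hl s).symm))⟩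

instance : HasCoequalizers (HopfCoc (ColorVec φ)) :=
  have : ∀ {A B : HopfCoc (ColorVec φ)} {f g : A ⟶ B}, HasColimit (parallelPair f g) :=
    ⟨⟨⟨_, (isColimit_hopfCocCoeqπ _ _).some⟩⟩⟩
  hasCoequalizers_of_hasColimit_parallelPair _

end CoequalizerCoc

end ColorVec

/-! ### Coproducts of graded algebras -/

namespace ColorVec

variable {k G : Type u} [Field k] [CommGroup G] {φ : CommutationFactor k G}

attribute [local instance] ring algebra

section Coproduct

variable {J : Type u} (V : J → ColorVec φ) [∀ l, MonObj (V l)]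

/-- The quotient of the tensor algebra of `⨁ l, V l` by the ideal `coproductIdeal V`: the coproduct
of the algebras `V l`. -/
abbrev CoprodAlg : Type u := (coproductIdeal V).ringCon.Quotient

/-- The quotient map. -/
abbrev coprodMk : TensorAlgebra k (⨁ l, (V l : Type u)) →ₐ[k] CoprodAlg V :=
  (coproductIdeal V).ringCon.mkₐ k

theorem coprodMk_surjective : Function.Surjective (coprodMk V) := RingCon.mkₐ_surjective _

theorem coprodMk_eq_zero {t} : coprodMk V t = 0 ↔ t ∈ coproductIdeal V := by
  rw [← map_zero (coprodMk V)]
  exact (RingCon.eq _).trans (TwoSidedIdeal.mem_iff _ _).symm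

/-- The coprojections. -/
def coprodInj (l : J) : V l →ₗ[k] CoprodAlg V := (coprodMk V).toLinearMap ∘ₗ toTensorAlgebra V l

theorem coprodInj_mul (l : J) (x y : V l) :
    coprodInj V l (x * y) = coprodInj V l x * coprodInj V l y := by
  rw [← sub_eq_zero]
  change coprodMk V _ - coprodMk V _ * coprodMk V _ = 0
  rw [← map_mul, ← map_sub, coprodMk_eq_zero]
  exact TwoSidedIdeal.subset_span (Or.inl ⟨l, x, y, rfl⟩)

theorem coprodInj_one (l : J) : coprodInj V l 1 = 1 := by
  rw [eq_comm, ← sub_eq_zero]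
  change 1 - coprodMk V _ = 0
  rw [← map_one (coprodMk V), ← map_sub, coprodMk_eq_zero]
  exact TwoSidedIdeal.subset_span (Or.inr ⟨l, rfl⟩)

open Classical in
theorem exists_coprodLift {S : Type*} [Ring S] [Algebra k S] (f : ∀ l, V l →ₗ[k] S)
    (hmul : ∀ l (x y : V l), f l (x * y) = f l x * f l y) (hone : ∀ l, f l 1 = 1) :
    ∃ F : CoprodAlg V →ₐ[k] S, ∀ l x, F (coprodInj V l x) = f l x := by
  let F₀ : TensorAlgebra k (⨁ l, (V l : Type u)) →ₐ[k] S :=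
    TensorAlgebra.lift k (DirectSum.toModule k J S f)
  have hF₀ (l : J) (x : V l) : F₀ (toTensorAlgebra V l x) = f l x := by
    simp [F₀, toTensorAlgebra]
  have h : coproductIdeal V ≤ TwoSidedIdeal.ker F₀ := by
    refine TwoSidedIdeal.span_le.mpr ?_
    rintro _ (⟨l, x, y, rfl⟩ | ⟨l, rfl⟩)
    · refine (TwoSidedIdeal.mem_ker _).mpr ?_
      rw [map_sub, map_mul, hF₀, hF₀, hF₀, sub_eq_zero]
      exact hmul l x y
    · refine (TwoSidedIdeal.mem_ker _).mpr ?_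
      rw [map_sub, map_one, hF₀, sub_eq_zero]
      exact (hone l).symm
  refine ⟨(coproductIdeal V).ringCon.liftₐ F₀ fun x y hxy => ?_, hF₀⟩
  have := h ((TwoSidedIdeal.rel_iff _ _ _).mp hxy)
  rw [TwoSidedIdeal.mem_ker, map_sub, sub_eq_zero] at this
  exact this

open Classical in
theorem coprodMk_ι_eq (v : ⨁ l, (V l : Type u)) :
    coprodMk V (TensorAlgebra.ι k v) = DirectSum.toModule k J (CoprodAlg V) (coprodInj V) v := by
  have : (coprodMk V).toLinearMap ∘ₗ TensorAlgebra.ι k =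
      DirectSum.toModule k J (CoprodAlg V) (coprodInj V) := by
    refine DirectSum.linearMap_ext _ fun l => LinearMap.ext fun x => ?_
    simp [coprodInj, toTensorAlgebra]
  exact LinearMap.congr_fun this v

open Classical in
theorem coprodMk_ι_mem {N : Submodule k (CoprodAlg V)} {v : ⨁ l, (V l : Type u)}
    (h : ∀ l, coprodInj V l (v l) ∈ N) : coprodMk V (TensorAlgebra.ι k v) ∈ N := by
  rw [coprodMk_ι_eq, ← DirectSum.sum_support_of v, map_sum]
  refine Submodule.sum_mem _ fun l _ => ?_
  have := DirectSum.toModule_lof k (φ := coprodInj V) l (v l)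
  exact this.symm ▸ h l

/-- The images of the coprojections generate the algebra. This serves as the induction principle for
the coproduct: `N` will be the locus where two maps agree or where the antipode identity holds. -/
theorem coprod_eq_top {N : Submodule k (CoprodAlg V)} (h1 : 1 ∈ N)
    (hmul : ∀ x ∈ N, ∀ y ∈ N, x * y ∈ N) (hq : ∀ l x, coprodInj V l x ∈ N) : N = ⊤ := by
  let S : Subalgebra k (CoprodAlg V) := N.toSubalgebra h1 fun x y hx hy => hmul x hx y hy
  have : (⊤ : Subalgebra k _) ≤ S.comap (coprodMk V) := by
    rw [← TensorAlgebra.adjoin_range_ι, Algebra.adjoin_le_iff]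
    rintro _ ⟨v, rfl⟩
    exact coprodMk_ι_mem V fun l => hq l _
  rw [eq_top_iff]
  intro x _
  obtain ⟨t, rfl⟩ := coprodMk_surjective V x
  exact this (Algebra.mem_top (x := t))

/-- The grading of the coproduct. -/
def coprodGrading (g : G) : Submodule k (CoprodAlg V) :=
  (tensorAlgebraGrading (directSumGrading V) g).map (coprodMk V).toLinearMap

open Classical in
theorem coprodInj_mem {l : J} {g : G} {x : V l} (hx : x ∈ (V l).grading g) :
    coprodInj V l x ∈ coprodGrading V g := by
  refine ⟨_, Submodule.subset_span ⟨[(g, DirectSum.lof k J (fun l => (V l : Type u)) l x)], ?_, ?_, rfl⟩, ?_⟩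
  · simp only [List.mem_singleton, forall_eq]
    intro l'
    by_cases h : l = l'
    · subst h
      rw [DirectSum.lof_apply]
      exact hx
    · rw [DirectSum.lof_eq_of, DirectSum.of_eq_of_ne _ _ _ (Ne.symm h)]
      exact Submodule.zero_mem _
  · simp
  · simp [coprodInj, toTensorAlgebra]

theorem one_mem_coprodGrading : 1 ∈ coprodGrading V 1 :=
  ⟨1, Submodule.subset_span ⟨[], by simp, by simp, by simp⟩, map_one (coprodMk V)⟩

theorem mul_mem_coprodGrading {a b : G} {x y : CoprodAlg V} (hx : x ∈ coprodGrading V a)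
    (hy : y ∈ coprodGrading V b) : x * y ∈ coprodGrading V (a * b) := by
  obtain ⟨s, hs, rfl⟩ := hx
  obtain ⟨t, ht, rfl⟩ := hy
  refine ⟨s * t, ?_, map_mul (coprodMk V) s t⟩
  have : tensorAlgebraGrading (directSumGrading V) a * tensorAlgebraGrading (directSumGrading V) b ≤
      tensorAlgebraGrading (directSumGrading V) (a * b) := by
    rw [tensorAlgebraGrading, tensorAlgebraGrading, Submodule.span_mul_span]
    refine Submodule.span_mono ?_
    rintro _ ⟨_, ⟨l, hl, rfl, rfl⟩, _, ⟨l', hl', rfl, rfl⟩, rfl⟩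
    refine ⟨l ++ l', ?_, by simp, by simp⟩
    intro p hp
    rcases List.mem_append.mp hp with h | h
    exacts [hl p h, hl' p h]
  exact this (Submodule.mul_mem_mul hs ht)

/-- The grading is the smallest multiplicative family for which the coprojections preserve degrees,
because each component is spanned by products of homogeneous generators. -/
theorem coprodGrading_le {𝒩 : G → Submodule k (CoprodAlg V)} (h1 : 1 ∈ 𝒩 1)
    (hmul : ∀ a b, ∀ x ∈ 𝒩 a, ∀ y ∈ 𝒩 b, x * y ∈ 𝒩 (a * b))
    (hq : ∀ l g, ∀ x ∈ (V l).grading g, coprodInj V l x ∈ 𝒩 g) (g : G) :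
    coprodGrading V g ≤ 𝒩 g := by
  rw [coprodGrading, tensorAlgebraGrading, Submodule.map_span_le]
  rintro _ ⟨l, hl, rfl, rfl⟩
  change coprodMk V _ ∈ _
  induction l with
  | nil => simpa using h1
  | cons p l ih =>
    rw [List.map_cons, List.prod_cons, List.map_cons, List.prod_cons, map_mul]
    exact hmul _ _ _ (coprodMk_ι_mem V fun j => hq j _ _ (hl p (by simp) j)) _
      (ih fun q hq => hl q (by simp [hq]))

theorem iSup_coprodGrading : ⨆ g, coprodGrading V g = ⊤ := by
  refine coprod_eq_top V (Submodule.mem_iSup_of_mem 1 (one_mem_coprodGrading V)) ?_ ?_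
  · intro x hx y hy
    have : (⨆ g, coprodGrading V g) * (⨆ g, coprodGrading V g) ≤ ⨆ g, coprodGrading V g := by
      rw [Submodule.iSup_mul, iSup_le_iff]
      intro a
      rw [Submodule.mul_iSup, iSup_le_iff]
      intro b
      rw [Submodule.mul_le]
      exact fun x hx y hy => Submodule.mem_iSup_of_mem _ (mul_mem_coprodGrading V hx hy)
    exact this (Submodule.mul_mem_mul hx hy)
  · intro l x
    have : Submodule.span k {x : V l | ∃ g, x ∈ (V l).grading g} ≤
        (⨆ g, coprodGrading V g).comap (coprodInj V l) := by
      rw [Submodule.span_le]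
      rintro x ⟨g, hx⟩
      exact Submodule.mem_iSup_of_mem g (coprodInj_mem V hx)
    rw [span_homogeneous] at this
    exact this (Submodule.mem_top (x := x))

/-- A `G`-grading of an algebra amounts to a coaction `x ↦ x · g` of the group algebra. On the
coproduct such an algebra map exists by the universal property, so independence of the components
needs no analysis of the defining ideal. -/
theorem exists_coprodCoaction : ∃ δ : CoprodAlg V →ₐ[k] MonoidAlgebra (CoprodAlg V) G,
    ∀ g, ∀ x ∈ coprodGrading V g, δ x = MonoidAlgebra.single g x := by
  have hf (l : J) {g : G} {x : V l} (hx : x ∈ (V l).grading g) :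
      (V l).glue (fun g => (MonoidAlgebra.lsingle (R := k) g : CoprodAlg V →ₗ[k] _) ∘ₗ coprodInj V l) x = MonoidAlgebra.single g (coprodInj V l x) := by
    rw [glue_apply _ _ hx]
    rfl
  obtain ⟨δ, hδ⟩ := exists_coprodLift V
    (fun l => (V l).glue fun g => (MonoidAlgebra.lsingle (R := k) g : CoprodAlg V →ₗ[k] _) ∘ₗ coprodInj V l)
    (fun l x y => by
      have := tensor_ext (V l) (V l)
        (f := ((V l).glue fun g => (MonoidAlgebra.lsingle (R := k) g : CoprodAlg V →ₗ[k] _) ∘ₗ coprodInj V l) ∘ₗ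
          LinearMap.mul' k (V l))
        (g := LinearMap.mul' k _ ∘ₗ TensorProduct.map
          ((V l).glue fun g => (MonoidAlgebra.lsingle (R := k) g : CoprodAlg V →ₗ[k] _) ∘ₗ coprodInj V l)
          ((V l).glue fun g => (MonoidAlgebra.lsingle (R := k) g : CoprodAlg V →ₗ[k] _) ∘ₗ coprodInj V l))
        (fun a x hx b y hy => by
          simp only [LinearMap.comp_apply, LinearMap.mul'_apply, TensorProduct.map_tmul]
          rw [hf l (mul_mem_grading hx hy), hf l hx, hf l hy, MonoidAlgebra.single_mul_single,
            coprodInj_mul])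
      exact LinearMap.congr_fun this (x ⊗ₜ y))
    (fun l => by
      rw [hf l one_mem_grading, coprodInj_one]
      rfl)
  refine ⟨δ, fun g x hx => ?_⟩
  -- The subspaces on which `δ x = x · g` form a multiplicative family containing the homogeneous
  -- generators, so they contain the grading.
  refine coprodGrading_le V (𝒩 := fun g => LinearMap.eqLocus δ.toLinearMap (MonoidAlgebra.lsingle (R := k) g))
    ?_ ?_ ?_ g hx
  · exact map_one δ
  · intro a b x hx y hy
    change δ _ = MonoidAlgebra.single _ _
    change δ _ = MonoidAlgebra.single _ _ at hx
    change δ _ = MonoidAlgebra.single _ _ at hy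
    rw [map_mul, hx, hy, MonoidAlgebra.single_mul_single]
  · intro l g x hx
    change δ _ = MonoidAlgebra.single _ _
    rw [hδ, hf l hx]

open Classical in
theorem isInternal_coprodGrading : DirectSum.IsInternal (coprodGrading V) := by
  obtain ⟨δ, hδ⟩ := exists_coprodCoaction V
  -- The projection to degree `g` is the coefficient of the coaction at `g`.
  refine isInternal_of_proj _ (fun g =>
    { toFun := fun x => (δ x).coeff g
      map_add' := fun x y => by rw [map_add]; rfl
      map_smul' := fun c x => by rw [map_smul]; rfl }) ?_ ?_ (iSup_coprodGrading V)
  · intro g x hx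
    simp [hδ g x hx]
  · intro g h hgh x hx
    simp [hδ h x hx, hgh.symm]

end Coproduct

end ColorVec

/-! ### The bimonoid structure on the coproduct -/

namespace ColorVec

variable {k G : Type u} [Field k] [CommGroup G] {φ : CommutationFactor k G}

attribute [local instance] ring algebra

section CoproductMon

variable {J : Type u} (V : J → ColorVec φ) [∀ l, MonObj (V l)]

/-- The coproduct of graded algebras. -/
abbrev coprodObj : ColorVec φ where
  carrier := CoprodAlg V
  grading := coprodGrading V
  isInternal := isInternal_coprodGrading V

/-- The graded algebra structure on the coproduct. -/
instance coprodMon : MonObj (coprodObj V) where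
  one := ofLin (V := unit φ) (W := coprodObj V) (Algebra.linearMap k (CoprodAlg V))
    (fun g x hx => by
      rcases mem_unitGrading.mp hx with rfl | rfl
      · rw [Algebra.linearMap_apply, Algebra.algebraMap_eq_smul_one]
        exact Submodule.smul_mem _ _ (one_mem_coprodGrading V)
      · rw [map_zero]
        exact Submodule.zero_mem _)
  mul := ofLin (V := tensorObj (coprodObj V) (coprodObj V)) (LinearMap.mul' k (CoprodAlg V))
    (fun g => map_tensor_mem _ g _ fun a b hab x hx y hy => by
      rw [LinearMap.mul'_apply, ← hab]
      exact mul_mem_coprodGrading V hx hy)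
  one_mul := hom_ext (TensorProduct.ext' fun c x => by
    change algebraMap k (CoprodAlg V) c * x = c • x
    exact (Algebra.smul_def (A := CoprodAlg V) _ _).symm)
  mul_one := hom_ext (TensorProduct.ext' fun x c => by
    change x * algebraMap k (CoprodAlg V) c = c • x
    rw [← Algebra.commutes]
    exact (Algebra.smul_def (A := CoprodAlg V) _ _).symm)
  mul_assoc := hom_ext (TensorProduct.ext_threefold fun x y z => mul_assoc (G := CoprodAlg V) x y z)

/-- The coprojections. -/
def coprodι (l : J) : V l ⟶ coprodObj V := ofLin (coprodInj V l) fun _ _ hx => coprodInj_mem V hx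

theorem coprod_oneElt : (coprodObj V).oneElt = (1 : CoprodAlg V) := map_one (algebraMap k _)

theorem isMonHom_coprodι (l : J) : IsMonHom (coprodι V l) :=
  isMonHom_of_map ((coprodInj_one V l).trans (coprod_oneElt V).symm) (coprodInj_mul V l)

variable {V}

/-- The map of ungraded algebras preserves degrees because the pullback along it of the grading of
`Z` is a multiplicative family, to which `coprodGrading_le` applies. -/
theorem exists_coprodDesc {Z : ColorVec φ} [MonObj Z] (f : ∀ l, V l ⟶ Z)
    (hf : ∀ l, IsMonHom (f l)) :
    ∃ F : coprodObj V ⟶ Z, IsMonHom F ∧ ∀ l, coprodι V l ≫ F = f l := by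
  obtain ⟨F, hF⟩ := exists_coprodLift V (fun l => Hom.toLin (f l))
    (fun l x y => map_mulElt (f l) x y) (fun l => map_oneElt (f l))
  refine ⟨ofLin (V := coprodObj V) F.toLinearMap fun g => coprodGrading_le V
    (𝒩 := fun g => (Z.grading g).comap F.toLinearMap) ?_ ?_ ?_ g, ?_, fun l => ?_⟩
  · change F 1 ∈ Z.grading 1
    rw [map_one]
    exact one_mem_grading
  · intro a b x hx y hy
    change F _ ∈ Z.grading _
    rw [map_mul]
    exact mul_mem_grading hx hy
  · intro l g x hx
    change F _ ∈ Z.grading _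
    rw [hF]
    exact toLin_mem _ hx
  · exact isMonHom_of_map ((congrArg F (coprod_oneElt V)).trans (map_one F)) (map_mul F)
  · exact hom_ext (LinearMap.ext (hF l))

theorem coprodObj_eq_top {N : Submodule k (coprodObj V)} (h1 : (coprodObj V).oneElt ∈ N)
    (hmul : ∀ x ∈ N, ∀ y ∈ N, (coprodObj V).mulElt x y ∈ N)
    (hq : ∀ l x, Hom.toLin (coprodι V l) x ∈ N) : N = ⊤ :=
  coprod_eq_top V (coprod_oneElt V ▸ h1) hmul hq

theorem coprodObj_hom_ext {Z : ColorVec φ} [MonObj Z] {F F' : coprodObj V ⟶ Z} (hF : IsMonHom F)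
    (hF' : IsMonHom F') (h : ∀ l, coprodι V l ≫ F = coprodι V l ≫ F') : F = F' := by
  refine hom_ext (LinearMap.eqLocus_eq_top.mp (coprodObj_eq_top ?_ ?_ ?_))
  · exact (map_oneElt F).trans (map_oneElt F').symm
  · intro x hx y hy
    refine (map_mulElt F x y).trans (Eq.trans ?_ (map_mulElt F' x y).symm)
    exact congrArg₂ Z.mulElt hx hy
  · intro l x
    exact LinearMap.congr_fun (congrArg Hom.toLin (h l)) x

theorem isTensorAlgebraQuotient_coprodι :
    IsTensorAlgebraQuotient V (coprodObj V) fun l => Hom.toLin (coprodι V l) :=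
  ⟨(coprodMk V).toLinearMap, (map_one (coprodMk V)).trans (coprod_oneElt V).symm,
    map_mul (coprodMk V), coprodMk_surjective V, fun _ => coprodMk_eq_zero V, fun _ => rfl,
    fun _ _ => rfl⟩

end CoproductMon

section CoproductBimon

/-- A bimonoid, as a comonoid in the category of monoids. -/
abbrev bimonComon (A : ColorVec φ) [BimonObj A] : Comon (Mon (ColorVec φ)) := Bimon.mk' A

/-- The structure of bimonoid on the underlying object. -/
abbrev bimonObjOfBimon (M : Bimon (ColorVec φ)) : BimonObj M.X.X := inferInstance

variable {J : Type u} (V : J → ColorVec φ) [∀ l, BimonObj (V l)]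

/-- The coprojections, in the category of graded algebras. -/
def coprodιMon (l : J) : (bimonComon (V l)).X ⟶ Mon.mk (coprodObj V) :=
  @Mon.Hom.mk _ _ _ (bimonComon (V l)).X (Mon.mk (coprodObj V)) (coprodι V l) (isMonHom_coprodι V l)

/-- The coprojections generate the coproduct as an algebra but need not span it, so they are jointly
epimorphic among algebra maps. Working in the category of monoids, the comonoid structure built from
them is automatically a bimonoid. -/
theorem jointlyEpi_coprodιMon : JointlyEpi (coprodιMon V) := fun Z f g h =>
  Mon.Hom.ext (coprodObj_hom_ext (V := V) (Z := Z.X) f.isMonHom_hom g.isMonHom_hom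
    fun l => congrArg Mon.Hom.hom (h l))

theorem exists_coprodDescMon {Z : Mon (ColorVec φ)} (f : ∀ l, (bimonComon (V l)).X ⟶ Z) :
    ∃ F : Mon.mk (coprodObj V) ⟶ Z, ∀ l, coprodιMon V l ≫ F = f l := by
  obtain ⟨F, hF, h⟩ := exists_coprodDesc (V := V) (Z := Z.X) (fun l => (f l).hom)
    (fun l => (f l).isMonHom_hom)
  exact ⟨Mon.Hom.mk (M := Mon.mk (coprodObj V)) F, fun l => Mon.Hom.ext (h l)⟩

/-- The comonoid structure on the coproduct, in the category of graded algebras. -/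
abbrev coprodComonMon : ComonObj (Mon.mk (coprodObj V)) :=
  ComonObj.ofJointlyEpi (X := fun l => (bimonComon (V l)).X) (coprodιMon V) (jointlyEpi_coprodιMon V)
    (exists_coprodDescMon V fun l =>
      Δ[(bimonComon (V l)).X] ≫ (coprodιMon V l ⊗ₘ coprodιMon V l)).choose
    (exists_coprodDescMon V _).choose_spec
    (exists_coprodDescMon V fun l => ε[(bimonComon (V l)).X]).choose
    (exists_coprodDescMon V _).choose_spec

/-- The bimonoid structure on the coproduct. -/
abbrev coprodBimon : BimonObj (coprodObj V) :=
  letI := coprodComonMon V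
  let M : Bimon (ColorVec φ) := Comon.mk (Mon.mk (coprodObj V))
  bimonObjOfBimon M

theorem isComonHom_coprodι (l : J) :
    letI := coprodBimon V
    IsComonHom (coprodι V l) :=
  letI := coprodBimon V
  { hom_counit := congrArg Mon.Hom.hom ((exists_coprodDescMon V
      fun l => ε[(bimonComon (V l)).X]).choose_spec l)
    hom_comul := congrArg Mon.Hom.hom ((exists_coprodDescMon V fun l =>
      Δ[(bimonComon (V l)).X] ≫ (coprodιMon V l ⊗ₘ coprodιMon V l)).choose_spec l) }

theorem isComonHom_of_coprodι {Z : ColorVec φ} [BimonObj Z] (F : coprodObj V ⟶ Z) (hF : IsMonHom F)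
    (h : ∀ l, IsComonHom (coprodι V l ≫ F)) :
    letI := coprodBimon V
    IsComonHom F := by
  let := coprodBimon V
  have h1 := isMonHom_counit Z
  have h2 := isMonHom_counit (coprodObj V)
  have h3 := isMonHom_comul Z
  have h4 := isMonHom_comul (coprodObj V)
  have h5 := isMonHom_tensorHom F F
  refine ⟨?_, ?_⟩
  · refine coprodObj_hom_ext (V := V) inferInstance h2 fun l => ?_
    rw [← Category.assoc, (h l).hom_counit, (isComonHom_coprodι V l).hom_counit]
  · refine coprodObj_hom_ext (V := V) inferInstance inferInstance fun l => ?_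
    rw [← Category.assoc, (h l).hom_comul, ← Category.assoc, (isComonHom_coprodι V l).hom_comul,
      Category.assoc, tensorHom_comp_tensorHom]

theorem isMonHom_braiding (A B : ColorVec φ) [MonObj A] [MonObj B] : IsMonHom (β_ A B).hom :=
  (β_ (Mon.mk A) (Mon.mk B)).hom.isMonHom_hom

/-- The braiding is an algebra map in a symmetric category, so both sides of the cocommutativity
axiom are algebra maps and can be compared on the coprojections. -/
theorem isCommComonObj_coprod [∀ l, IsCommComonObj (V l)] :
    letI := coprodBimon V
    IsCommComonObj (coprodObj V) := by
  let := coprodBimon V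
  have h4 := isMonHom_comul (coprodObj V)
  have h5 := isMonHom_braiding (coprodObj V) (coprodObj V)
  refine ⟨coprodObj_hom_ext (V := V) inferInstance inferInstance fun l => ?_⟩
  rw [← Category.assoc, (isComonHom_coprodι V l).hom_comul, Category.assoc,
    BraidedCategory.braiding_naturality, IsCommComonObj.comul_comm_assoc]

end CoproductBimon

/-! ### The antipode identity is closed under products -/

section Antipode

variable (P : ColorVec φ) [BimonObj P] (S : P ⟶ P)

theorem tensorμ_tmul {X Y Z W : ColorVec φ} {b c : G} (x : X) {y : Y} {z : Z} (w : W)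
    (hy : y ∈ Y.grading b) (hz : z ∈ Z.grading c) :
    Hom.toLin (tensorμ X Y Z W) ((x ⊗ₜ[k] y) ⊗ₜ[k] (z ⊗ₜ[k] w)) =
      (φ b c : k) • ((x ⊗ₜ[k] z) ⊗ₜ[k] (y ⊗ₜ[k] w)) := by
  have h : Hom.toLin (tensorμ X Y Z W) ((x ⊗ₜ[k] y) ⊗ₜ[k] (z ⊗ₜ[k] w)) =
    (TensorProduct.assoc k X Z (Y ⊗[k] W)).symm (((TensorProduct.assoc k Z Y W).toLinearMap ∘ₗ
      (braidLin Y Z).rTensor W).lTensor X (x ⊗ₜ[k] ((y ⊗ₜ[k] z) ⊗ₜ[k] w))) := rfl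
  rw [h, LinearMap.lTensor_tmul, LinearMap.comp_apply, LinearMap.rTensor_tmul,
    braidLin_tmul Y Z hy hz, ← TensorProduct.smul_tmul', map_smul, TensorProduct.tmul_smul,
    map_smul]
  rfl

theorem tensor_ext₄ (U V W Z : ColorVec φ) {M : Type*} [AddCommGroup M] [Module k M]
    {f g : (U ⊗[k] V) ⊗[k] (W ⊗[k] Z) →ₗ[k] M}
    (h : ∀ a, ∀ x ∈ U.grading a, ∀ b, ∀ y ∈ V.grading b, ∀ c, ∀ z ∈ W.grading c,
      ∀ d, ∀ w ∈ Z.grading d, f ((x ⊗ₜ y) ⊗ₜ (z ⊗ₜ w)) = g ((x ⊗ₜ y) ⊗ₜ (z ⊗ₜ w))) : f = g := by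
  refine TensorProduct.ext (tensor_ext U V fun a x hx b y hy => tensor_ext W Z
    fun c z hz d w hw => ?_)
  exact h a x hx b y hy c z hz d w hw

variable {P S} in
theorem antipode_mul (hS : @IsMonHom _ _ _ _ _ _ (MonObj.opposite P) S) {a b : G} {x y : P}
    (hx : x ∈ P.grading a) (hy : y ∈ P.grading b) :
    Hom.toLin S (x * y) = (φ a b : k) • (Hom.toLin S y * Hom.toLin S x) := by
  have h := LinearMap.congr_fun (congrArg Hom.toLin hS.mul_hom) (x ⊗ₜ[k] y)
  refine h.trans ?_
  change Hom.toLin μ[P] (braidLin P P (Hom.toLin S x ⊗ₜ Hom.toLin S y)) = _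
  rw [braidLin_tmul P P (toLin_mem S hx) (toLin_mem S hy), map_smul]
  rfl

/-- In Sweedler notation and up to the factors from the braiding, `S(x₁y₁) x₂y₂ = S(y₁) (S(x₁) x₂)
y₂`. This isolates the convolution at `x`, which can be replaced by a scalar once `x` satisfies the
antipode identity. -/
theorem mul_comul_antipode_left (hS : @IsMonHom _ _ _ _ _ _ (MonObj.opposite P) S) :
    μ[P] ≫ Δ[P] ≫ S ▷ P ≫ μ[P] = (Δ[P] ≫ S ▷ P ≫ μ[P]) ▷ P ≫ P ◁ Δ[P] ≫ (α_ P P P).inv ≫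
      ((β_ P P).hom ≫ S ▷ P) ▷ P ≫ μ[P] ▷ P ≫ μ[P] := by
  have h : tensorμ P P P P ≫ (μ[P] ⊗ₘ μ[P]) ≫ S ▷ P ≫ μ[P] =
      (S ▷ P ≫ μ[P]) ▷ (P ⊗ P) ≫ (α_ P P P).inv ≫
      ((β_ P P).hom ≫ S ▷ P) ▷ P ≫ μ[P] ▷ P ≫ μ[P] := by
    refine hom_ext (tensor_ext₄ P P P P fun a x hx b y hy c z hz d w hw => ?_)
    have h1 : Hom.toLin (tensorμ P P P P ≫ (μ[P] ⊗ₘ μ[P]) ≫ S ▷ P ≫ μ[P])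
        ((x ⊗ₜ[k] y) ⊗ₜ[k] (z ⊗ₜ[k] w)) = (φ b c : k) • (Hom.toLin S (x * z) * (y * w)) := by
      rw [toLin_comp, LinearMap.comp_apply, tensorμ_tmul x w hy hz, map_smul]
      rfl
    have h2 : Hom.toLin ((S ▷ P ≫ μ[P]) ▷ (P ⊗ P) ≫ (α_ P P P).inv ≫
        ((β_ P P).hom ≫ S ▷ P) ▷ P ≫ μ[P] ▷ P ≫ μ[P]) ((x ⊗ₜ[k] y) ⊗ₜ[k] (z ⊗ₜ[k] w)) =
        Hom.toLin (S ▷ P ≫ μ[P]) (braidLin P P ((Hom.toLin S x * y) ⊗ₜ[k] z)) * w := rfl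
    -- On the left the interchange contributes `φ(b, c)` and `S(xz)` contributes `φ(a, c)`; on the
    -- right, moving `z` past `S(x) y`, of degree `ab`, contributes `φ(ab, c)`.
    rw [h1, h2, braidLin_tmul P P (mul_mem_grading (toLin_mem S hx) hy) hz, map_smul,
      antipode_mul hS hx hz, smul_mul_assoc, smul_mul_assoc, smul_smul, φ.mul_left, Units.val_mul,
      mul_comm (φ a c : k)]
    change _ = _ • (Hom.toLin S z * (Hom.toLin S x * y) * w)
    simp only [mul_assoc]
  rw [BimonObj.mul_comul_assoc, h]
  rw [MonoidalCategory.tensorHom_def', Category.assoc, ← comp_whiskerRight_assoc, whisker_exchange_assoc]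

/-- The mirror image: `x₁y₁ S(x₂y₂) = x₁ (y₁ S(y₂)) S(x₂)` up to braiding factors, so here the
convolution at `y` is isolated. -/
theorem mul_comul_antipode_right (hS : @IsMonHom _ _ _ _ _ _ (MonObj.opposite P) S) :
    μ[P] ≫ Δ[P] ≫ P ◁ S ≫ μ[P] = P ◁ (Δ[P] ≫ P ◁ S ≫ μ[P]) ≫ Δ[P] ▷ P ≫ (α_ P P P).hom ≫
      P ◁ ((β_ P P).hom ≫ P ◁ S) ≫ P ◁ μ[P] ≫ μ[P] := by
  have h : tensorμ P P P P ≫ (μ[P] ⊗ₘ μ[P]) ≫ P ◁ S ≫ μ[P] =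
      (P ⊗ P) ◁ (P ◁ S ≫ μ[P]) ≫ (α_ P P P).hom ≫
      P ◁ ((β_ P P).hom ≫ P ◁ S) ≫ P ◁ μ[P] ≫ μ[P] := by
    refine hom_ext (tensor_ext₄ P P P P fun a x hx b y hy c z hz d w hw => ?_)
    have h1 : Hom.toLin (tensorμ P P P P ≫ (μ[P] ⊗ₘ μ[P]) ≫ P ◁ S ≫ μ[P])
        ((x ⊗ₜ[k] y) ⊗ₜ[k] (z ⊗ₜ[k] w)) = (φ b c : k) • (x * z * Hom.toLin S (y * w)) := by
      rw [toLin_comp, LinearMap.comp_apply, tensorμ_tmul x w hy hz, map_smul]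
      rfl
    have h2 : Hom.toLin ((P ⊗ P) ◁ (P ◁ S ≫ μ[P]) ≫ (α_ P P P).hom ≫
        P ◁ ((β_ P P).hom ≫ P ◁ S) ≫ P ◁ μ[P] ≫ μ[P]) ((x ⊗ₜ[k] y) ⊗ₜ[k] (z ⊗ₜ[k] w)) =
        x * Hom.toLin (P ◁ S ≫ μ[P]) (braidLin P P (y ⊗ₜ[k] (z * Hom.toLin S w))) := rfl
    rw [h1, h2, braidLin_tmul P P hy (mul_mem_grading hz (toLin_mem S hw)), map_smul,
      antipode_mul hS hy hw, mul_smul_comm, mul_smul_comm, smul_smul, φ.mul_right, Units.val_mul]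
    change _ = _ • (x * (z * Hom.toLin S w * Hom.toLin S y))
    simp only [mul_assoc]
  rw [BimonObj.mul_comul_assoc, h]
  rw [MonoidalCategory.tensorHom_def, Category.assoc, ← whiskerLeft_comp_assoc, ← whisker_exchange_assoc]

/-- When the inner factor `S(x₁) x₂` is a multiple of the unit, the outer expression collapses to
the convolution at the other argument. -/
theorem one_antipode_aux_left :
    η[P] ▷ P ≫ P ◁ Δ[P] ≫ (α_ P P P).inv ≫ ((β_ P P).hom ≫ S ▷ P) ▷ P ≫ μ[P] ▷ P ≫ μ[P] =
      (λ_ P).hom ≫ Δ[P] ≫ S ▷ P ≫ μ[P] := by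
  have h : η[P] ▷ P ≫ (β_ P P).hom ≫ S ▷ P ≫ μ[P] = (λ_ P).hom ≫ S := by
    rw [BraidedCategory.braiding_naturality_left_assoc, whisker_exchange_assoc, MonObj.mul_one,
      rightUnitor_naturality, braiding_rightUnitor_assoc]
  rw [← whisker_exchange_assoc, associator_inv_naturality_left_assoc, comp_whiskerRight,
    Category.assoc, ← comp_whiskerRight_assoc, ← comp_whiskerRight_assoc, ← comp_whiskerRight_assoc]
  simp only [Category.assoc]
  rw [h, comp_whiskerRight, Category.assoc, leftUnitor_whiskerRight, Category.assoc,
    Iso.inv_hom_id_assoc, leftUnitor_naturality_assoc]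

theorem one_antipode_aux_right :
    P ◁ η[P] ≫ Δ[P] ▷ P ≫ (α_ P P P).hom ≫ P ◁ ((β_ P P).hom ≫ P ◁ S) ≫ P ◁ μ[P] ≫ μ[P] =
      (ρ_ P).hom ≫ Δ[P] ≫ P ◁ S ≫ μ[P] := by
  have h : P ◁ η[P] ≫ (β_ P P).hom ≫ P ◁ S ≫ μ[P] = (ρ_ P).hom ≫ S := by
    rw [BraidedCategory.braiding_naturality_right_assoc, ← whisker_exchange_assoc, MonObj.one_mul,
      leftUnitor_naturality, braiding_leftUnitor_assoc]
  rw [whisker_exchange_assoc, associator_naturality_right_assoc, whiskerLeft_comp,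
    Category.assoc, ← whiskerLeft_comp_assoc, ← whiskerLeft_comp_assoc, ← whiskerLeft_comp_assoc]
  simp only [Category.assoc]
  rw [h, whiskerLeft_comp, Category.assoc, whiskerLeft_rightUnitor, Category.assoc,
    Iso.hom_inv_id_assoc, rightUnitor_naturality_assoc]

theorem counit_mulElt (x y : P) :
    Hom.toLin (ε[P] ≫ η[P]) (P.mulElt x y) =
      (Hom.toLin ε[P] x : k) • Hom.toLin (ε[P] ≫ η[P]) y := by
  have h := LinearMap.congr_fun (congrArg Hom.toLin (Bimon.mul_counit P)) (x ⊗ₜ[k] y)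
  refine (congrArg (Hom.toLin η[P]) h).trans ?_
  exact map_smul (Hom.toLin η[P]) (Hom.toLin ε[P] x : k) (Hom.toLin ε[P] y)

theorem counit_mulElt' (x y : P) :
    Hom.toLin (ε[P] ≫ η[P]) (P.mulElt x y) =
      (Hom.toLin ε[P] y : k) • Hom.toLin (ε[P] ≫ η[P]) x := by
  rw [counit_mulElt]
  change _ • Hom.toLin η[P] (Hom.toLin ε[P] y) = _ • Hom.toLin η[P] (Hom.toLin ε[P] x)
  refine (map_smul (Hom.toLin η[P]) (Hom.toLin ε[P] x : k) (Hom.toLin ε[P] y : k)).symm.trans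
    (Eq.trans ?_ (map_smul (Hom.toLin η[P]) (Hom.toLin ε[P] y : k) (Hom.toLin ε[P] x : k)))
  exact congrArg (Hom.toLin η[P]) (mul_comm (G := k) (Hom.toLin ε[P] x) (Hom.toLin ε[P] y))

-- The convolution at `x` becomes the scalar `ε(x)`, leaving `ε(x)` times the convolution at `y`,
-- that is `ε(x) ε(y) 1`.
variable {P S} in
theorem antipode_left_mulElt (hS : @IsMonHom _ _ _ _ _ _ (MonObj.opposite P) S) {x y : P}
    (hx : Hom.toLin (Δ[P] ≫ S ▷ P ≫ μ[P]) x = Hom.toLin (ε[P] ≫ η[P]) x)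
    (hy : Hom.toLin (Δ[P] ≫ S ▷ P ≫ μ[P]) y = Hom.toLin (ε[P] ≫ η[P]) y) :
    Hom.toLin (Δ[P] ≫ S ▷ P ≫ μ[P]) (P.mulElt x y) = Hom.toLin (ε[P] ≫ η[P]) (P.mulElt x y) := by
  have h1 := LinearMap.congr_fun (congrArg Hom.toLin (mul_comul_antipode_left P S hS))
    (x ⊗ₜ[k] y)
  have h2 := LinearMap.congr_fun (congrArg Hom.toLin (one_antipode_aux_left P S))
    ((Hom.toLin ε[P] x : k) ⊗ₜ[k] y)
  rw [counit_mulElt, ← hy]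
  refine Eq.trans h1 (Eq.trans ?_ (h2.trans
    (map_smul (Hom.toLin (Δ[P] ≫ S ▷ P ≫ μ[P])) (Hom.toLin ε[P] x : k) y)))
  exact congrArg (fun z => Hom.toLin (P ◁ Δ[P] ≫ (α_ P P P).inv ≫
    ((β_ P P).hom ≫ S ▷ P) ▷ P ≫ μ[P] ▷ P ≫ μ[P]) (z ⊗ₜ[k] y)) hx

variable {P S} in
theorem antipode_right_mulElt (hS : @IsMonHom _ _ _ _ _ _ (MonObj.opposite P) S) {x y : P}
    (hx : Hom.toLin (Δ[P] ≫ P ◁ S ≫ μ[P]) x = Hom.toLin (ε[P] ≫ η[P]) x)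
    (hy : Hom.toLin (Δ[P] ≫ P ◁ S ≫ μ[P]) y = Hom.toLin (ε[P] ≫ η[P]) y) :
    Hom.toLin (Δ[P] ≫ P ◁ S ≫ μ[P]) (P.mulElt x y) = Hom.toLin (ε[P] ≫ η[P]) (P.mulElt x y) := by
  have h1 := LinearMap.congr_fun (congrArg Hom.toLin (mul_comul_antipode_right P S hS))
    (x ⊗ₜ[k] y)
  have h2 := LinearMap.congr_fun (congrArg Hom.toLin (one_antipode_aux_right P S))
    (x ⊗ₜ[k] (Hom.toLin ε[P] y : k))
  rw [counit_mulElt', ← hx]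
  refine Eq.trans h1 (Eq.trans ?_ (h2.trans
    (map_smul (Hom.toLin (Δ[P] ≫ P ◁ S ≫ μ[P])) (Hom.toLin ε[P] y : k) x)))
  exact congrArg (fun z => Hom.toLin (Δ[P] ▷ P ≫ (α_ P P P).hom ≫
    P ◁ ((β_ P P).hom ≫ P ◁ S) ≫ P ◁ μ[P] ≫ μ[P]) (x ⊗ₜ[k] z)) hy

variable {P S} in
theorem antipode_left_oneElt (hS : @IsMonHom _ _ _ _ _ _ (MonObj.opposite P) S) :
    Hom.toLin (Δ[P] ≫ S ▷ P ≫ μ[P]) P.oneElt = Hom.toLin (ε[P] ≫ η[P]) P.oneElt := by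
  have h : η[P] ≫ Δ[P] ≫ S ▷ P ≫ μ[P] = η[P] ≫ ε[P] ≫ η[P] := by
    have h0 : η[P] ≫ S = η[P] := hS.one_hom
    rw [Bimon.one_comul_assoc, BimonObj.one_counit_assoc, ← tensorHom_id,
      tensorHom_comp_tensorHom_assoc, h0, Category.comp_id, MonoidalCategory.tensorHom_def',
      Category.assoc, MonObj.one_mul, leftUnitor_naturality, Iso.inv_hom_id_assoc]
  exact LinearMap.congr_fun (congrArg Hom.toLin h) (1 : k)

variable {P S} in
theorem antipode_right_oneElt (hS : @IsMonHom _ _ _ _ _ _ (MonObj.opposite P) S) :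
    Hom.toLin (Δ[P] ≫ P ◁ S ≫ μ[P]) P.oneElt = Hom.toLin (ε[P] ≫ η[P]) P.oneElt := by
  have h : η[P] ≫ Δ[P] ≫ P ◁ S ≫ μ[P] = η[P] ≫ ε[P] ≫ η[P] := by
    have h0 : η[P] ≫ S = η[P] := hS.one_hom
    rw [Bimon.one_comul_assoc, BimonObj.one_counit_assoc, ← id_tensorHom,
      tensorHom_comp_tensorHom_assoc, h0, Category.comp_id, MonoidalCategory.tensorHom_def',
      Category.assoc, MonObj.one_mul, leftUnitor_naturality, Iso.inv_hom_id_assoc]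
  exact LinearMap.congr_fun (congrArg Hom.toLin h) (1 : k)

end Antipode

/-! ### Coproducts of color Hopf algebras -/

section CoproductHopf

open HopfCoc

variable {J : Type u} (V : J → ColorVec φ) [∀ l, HopfObj (V l)]

/-- The antipodes of the factors are algebra maps to opposite algebras, so they assemble to an
algebra map from the coproduct to its own opposite. -/
theorem exists_coprodAntipode :
    ∃ S : coprodObj V ⟶ coprodObj V, @IsMonHom _ _ _ _ _ _ (MonObj.opposite (coprodObj V)) S ∧
      ∀ l, coprodι V l ≫ S = HopfObj.antipode ≫ coprodι V l := by
  refine @exists_coprodDesc _ _ _ _ _ _ V _ (coprodObj V) (MonObj.opposite (coprodObj V))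
    (fun l => HopfObj.antipode (X := V l) ≫ coprodι V l) fun l => ?_
  have hp := isMonHom_opposite (coprodι V l) (isMonHom_coprodι V l)
  have hs := isMonHom_antipode (V l)
  exact @IsMonHom.mk _ _ _ _ _ _ (MonObj.opposite (coprodObj V)) _
    (by rw [← Category.assoc, hs.one_hom, hp.one_hom])
    (by rw [← Category.assoc, hs.mul_hom, Category.assoc, hp.mul_hom,
          tensorHom_comp_tensorHom_assoc])

section
variable {V} {S : coprodObj V ⟶ coprodObj V}

/-- The elements satisfying the identity contain the unit and are closed under products. On the
image of a coprojection the identity is the antipode axiom of that factor. -/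
theorem coprod_antipode_left
    (hS : @IsMonHom _ _ _ _ _ _ (MonObj.opposite (coprodObj V)) S)
    (h : ∀ l, coprodι V l ≫ S = HopfObj.antipode ≫ coprodι V l) :
    letI := coprodBimon V
    Δ[coprodObj V] ≫ S ▷ coprodObj V ≫ μ = ε ≫ η := by
  let := coprodBimon V
  refine hom_ext (LinearMap.eqLocus_eq_top.mp (coprodObj_eq_top (antipode_left_oneElt hS)
    (fun x hx y hy => antipode_left_mulElt hS hx hy) fun l x => ?_))
  have key : coprodι V l ≫ Δ[coprodObj V] ≫ S ▷ coprodObj V ≫ μ = coprodι V l ≫ ε ≫ η := by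
    have h1 := (isComonHom_coprodι V l).hom_comul
    have h2 := (isComonHom_coprodι V l).hom_counit
    rw [reassoc_of% h1, reassoc_of% h2, ← tensorHom_id, tensorHom_comp_tensorHom_assoc, h l,
      Category.comp_id]
    have h3 : (HopfObj.antipode ≫ coprodι V l ⊗ₘ coprodι V l) =
        HopfObj.antipode ▷ V l ≫ (coprodι V l ⊗ₘ coprodι V l) := by
      rw [← tensorHom_id, tensorHom_comp_tensorHom, Category.id_comp]
    rw [h3, Category.assoc]
    refine (congrArg (fun f => Δ[V l] ≫ HopfObj.antipode ▷ V l ≫ f)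
      (isMonHom_coprodι V l).mul_hom.symm).trans ?_
    rw [HopfObj.antipode_left_assoc]
    exact congrArg (fun f => ε[V l] ≫ f) (isMonHom_coprodι V l).one_hom
  exact LinearMap.congr_fun (congrArg Hom.toLin key) x

theorem coprod_antipode_right
    (hS : @IsMonHom _ _ _ _ _ _ (MonObj.opposite (coprodObj V)) S)
    (h : ∀ l, coprodι V l ≫ S = HopfObj.antipode ≫ coprodι V l) :
    letI := coprodBimon V
    Δ[coprodObj V] ≫ coprodObj V ◁ S ≫ μ = ε ≫ η := by
  let := coprodBimon V
  refine hom_ext (LinearMap.eqLocus_eq_top.mp (coprodObj_eq_top (antipode_right_oneElt hS)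
    (fun x hx y hy => antipode_right_mulElt hS hx hy) fun l x => ?_))
  have key : coprodι V l ≫ Δ[coprodObj V] ≫ coprodObj V ◁ S ≫ μ = coprodι V l ≫ ε ≫ η := by
    have h1 := (isComonHom_coprodι V l).hom_comul
    have h2 := (isComonHom_coprodι V l).hom_counit
    rw [reassoc_of% h1, reassoc_of% h2, ← id_tensorHom, tensorHom_comp_tensorHom_assoc, h l,
      Category.comp_id]
    have h3 : (coprodι V l ⊗ₘ HopfObj.antipode ≫ coprodι V l) =
        V l ◁ HopfObj.antipode ≫ (coprodι V l ⊗ₘ coprodι V l) := by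
      rw [← id_tensorHom, tensorHom_comp_tensorHom, Category.id_comp]
    rw [h3, Category.assoc]
    refine (congrArg (fun f => Δ[V l] ≫ V l ◁ HopfObj.antipode ≫ f)
      (isMonHom_coprodι V l).mul_hom.symm).trans ?_
    rw [HopfObj.antipode_right_assoc]
    exact congrArg (fun f => ε[V l] ≫ f) (isMonHom_coprodι V l).one_hom
  exact LinearMap.congr_fun (congrArg Hom.toLin key) x

end

/-- The Hopf monoid structure on the coproduct. -/
abbrev coprodHopfObj : HopfObj (coprodObj V) where
  toBimonObj := coprodBimon V
  antipode := (exists_coprodAntipode V).choose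
  antipode_left := coprod_antipode_left (exists_coprodAntipode V).choose_spec.1
    (exists_coprodAntipode V).choose_spec.2
  antipode_right := coprod_antipode_right (exists_coprodAntipode V).choose_spec.1
    (exists_coprodAntipode V).choose_spec.2

variable {J : Type u} (H : J → Hopf (ColorVec φ))

/-- The coproduct of color Hopf algebras. -/
abbrev hopfCoprod : Hopf (ColorVec φ) :=
  @Hopf.mk _ _ _ _ (coprodObj fun l => (H l).X) (coprodHopfObj fun l => (H l).X)

/-- The coprojections of the coproduct of color Hopf algebras. -/
def hopfCoprodι (l : J) : H l ⟶ hopfCoprod H :=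
  letI := coprodHopfObj fun l => (H l).X
  Hopf.homMk (B := hopfCoprod H) (coprodι (fun l => (H l).X) l) (isMonHom_coprodι _ l)
    (isComonHom_coprodι (fun l => (H l).X) l)

theorem exists_hopfCoprodDesc {Z : Hopf (ColorVec φ)} (f : ∀ l, H l ⟶ Z) :
    ∃ F : hopfCoprod H ⟶ Z, ∀ l, hopfCoprodι H l ≫ F = f l := by
  let := coprodHopfObj fun l => (H l).X
  obtain ⟨F, hF, h⟩ := exists_coprodDesc (V := fun l => (H l).X) (fun l => underlying (f l))
    (fun l => isMonHom_underlying (f l))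
  exact ⟨Hopf.homMk (A := hopfCoprod H) F hF (isComonHom_of_coprodι (fun l => (H l).X) F hF
    fun l => (h l).symm ▸ isComonHom_underlying (f l)), fun l => underlying_ext (h l)⟩

theorem hopfCoprod_hom_ext {Z : Hopf (ColorVec φ)} {F F' : hopfCoprod H ⟶ Z}
    (h : ∀ l, hopfCoprodι H l ≫ F = hopfCoprodι H l ≫ F') : F = F' :=
  underlying_ext (coprodObj_hom_ext (V := fun l => (H l).X) (isMonHom_underlying F)
    (isMonHom_underlying F') fun l => congrArg underlying (h l))

theorem isColimit_hopfCoprodι : Nonempty (IsColimit (Cofan.mk _ (hopfCoprodι H))) := by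
  choose F hF using fun s : Cofan H => exists_hopfCoprodDesc H s.inj
  exact ⟨Cofan.IsColimit.mk _ F (fun s l => hF s l) fun s m hm =>
    hopfCoprod_hom_ext H fun l => (hm l).trans (hF s l).symm⟩

instance : HasColimits (Hopf (ColorVec φ)) :=
  have : HasCoproducts.{u} (Hopf (ColorVec φ)) :=
    hasCoproducts_of_colimit_cofans _ fun H => (isColimit_hopfCoprodι H).some
  has_colimits_of_hasCoequalizers_and_coproducts

end CoproductHopf

section CoproductHopfCoc

variable {J : Type u} (H : J → HopfCoc (ColorVec φ))

/-- The coproduct of cocommutative color Hopf algebras. -/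
abbrev hopfCocCoprod : HopfCoc (ColorVec φ) where
  obj := hopfCoprod fun l => (H l).obj
  property := isCommComonObj_coprod fun l => (H l).obj.X

/-- The coprojections of the coproduct of cocommutative color Hopf algebras. -/
def hopfCocCoprodι (l : J) : H l ⟶ hopfCocCoprod H :=
  ObjectProperty.homMk (hopfCoprodι (fun l => (H l).obj) l)

theorem isColimit_hopfCocCoprodι : Nonempty (IsColimit (Cofan.mk _ (hopfCocCoprodι H))) := by
  choose F hF using fun s : Cofan H => exists_hopfCoprodDesc (fun l => (H l).obj)
    fun l => (s.inj l).hom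
  exact ⟨Cofan.IsColimit.mk _ (fun s => ObjectProperty.homMk (F s))
    (fun s l => ObjectProperty.hom_ext _ (hF s l)) fun s m hm =>
    ObjectProperty.hom_ext _ (hopfCoprod_hom_ext (fun l => (H l).obj) fun l =>
      (congrArg (·.hom) (hm l)).trans (hF s l).symm)⟩

instance : HasColimits (HopfCoc (ColorVec φ)) :=
  have : HasCoproducts.{u} (HopfCoc (ColorVec φ)) :=
    hasCoproducts_of_colimit_cofans _ fun H => (isColimit_hopfCocCoprodι H).some
  has_colimits_of_hasCoequalizers_and_coproducts

end CoproductHopfCoc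

end ColorVec

/-! ### The forgetful functor to cocommutative comonoids -/

section ForgetCommComon

variable {C : Type u} [Category.{v} C] [MonoidalCategory C] [SymmetricCategory C]

namespace HopfCoc

open CommComonCartesian

/-- The underlying cocommutative comonoid, as a functor. -/
def forgetCommComon : HopfCoc C ⥤ CommComon C where
  obj H := H.toCommComon
  map {A B} f := CommComonCartesian.homMk (A := A.toCommComon) (B := B.toCommComon) (underlying f.hom)
    (isComonHom_underlying f.hom)

instance : (forgetCommComon (C := C)).ReflectsIsomorphisms where
  reflects f _ := by
    have h : IsIso (homX (forgetCommComon.map f)) :=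
      ⟨homX (inv (forgetCommComon.map f)),
        by rw [← homX_comp, IsIso.hom_inv_id]; rfl, by rw [← homX_comp, IsIso.inv_hom_id]; rfl⟩
    exact @isIso_of_underlying _ _ _ _ _ _ f h

instance (X : HopfCoc C) : GrpObj (forgetCommComon.obj X) := X.grpObj

instance {X Y : HopfCoc C} (f : X ⟶ Y) : IsMonHom (forgetCommComon.map f) :=
  (grpHom f).hom.isMonHom_hom

/-- In both categories the product is the tensor product with the same projections, so the functor
carries one limit cone to the other. -/
instance : PreservesLimitsOfShape (Discrete WalkingPair) (forgetCommComon (C := C)) where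
  preservesLimit {K} := by
    have (A B : HopfCoc C) : PreservesLimit (Limits.pair A B) (forgetCommComon (C := C)) :=
      preservesLimit_of_preserves_limit_cone
        (t := BinaryFan.mk (HopfCoc.fst A B) (HopfCoc.snd A B)) (isLimit_fst_snd A B).some
        ((isLimitMapConeBinaryFanEquiv (forgetCommComon (C := C)) _ _).symm
          (CommComon.isLimit_fst_snd A.toCommComon B.toCommComon).some)
    exact preservesLimit_of_iso_diagram _ (diagramIsoPair K).symm

instance : PreservesLimit (Functor.empty.{0} (HopfCoc C)) (forgetCommComon (C := C)) :=
  preservesLimit_of_preserves_limit_cone (isZero_unitHopf (C := C)).isTerminal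
    ((isLimitMapConeEmptyConeEquiv _ _).symm (CommComon.isTerminal_trivial (C := C)).some)

instance : HasFiniteProducts (HopfCoc C) :=
  have : HasTerminal (HopfCoc C) := (isZero_unitHopf (C := C)).isTerminal.hasTerminal
  have (A B : HopfCoc C) : HasLimit (Limits.pair A B) := (isLimit_fst_snd A B).elim fun h => HasLimit.mk ⟨_, h⟩
  have := hasBinaryProducts_of_hasLimit_pair (HopfCoc C)
  hasFiniteProducts_of_has_binary_and_terminal

instance : PreservesFiniteProducts (forgetCommComon (C := C)) :=
  have := preservesLimitsOfShape_pempty_of_preservesTerminal (forgetCommComon (C := C))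
  .of_preserves_binary_and_terminal _

end HopfCoc

end ForgetCommComon

/-! ### Finite limits and their preservation -/

namespace ColorVec

variable {k G : Type u} [Field k] [CommGroup G] {φ : CommutationFactor k G}

open HopfCoc

instance : HasEqualizers (HopfCoc (ColorVec φ)) :=
  have : ∀ {A B : HopfCoc (ColorVec φ)} {f g : A ⟶ B}, HasLimit (parallelPair f g) :=
    ⟨⟨⟨_, (isLimit_hopfEqι _ _).some⟩⟩⟩
  hasEqualizers_of_hasLimit_parallelPair _

instance : HasFiniteLimits (HopfCoc (ColorVec φ)) :=
  hasFiniteLimits_of_hasEqualizers_and_finite_products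

/-- Both equalizers were constructed on the same subspace with the same comonoid structure. -/
instance : PreservesLimitsOfShape WalkingParallelPair (forgetCommComon (C := ColorVec φ)) where
  preservesLimit {K} := by
    have {A B : HopfCoc (ColorVec φ)} (f g : A ⟶ B) :
        PreservesLimit (parallelPair f g) (forgetCommComon (C := ColorVec φ)) :=
      preservesLimit_of_preserves_limit_cone (isLimit_hopfEqι f g).some
        ((isLimitMapConeForkEquiv _ _).symm
          (isLimit_commComonEqι (forgetCommComon.map f) (forgetCommComon.map g)).some)
    exact preservesLimit_of_iso_diagram _ (diagramIsoParallelPair K).symm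

instance : PreservesFiniteLimits (forgetCommComon (C := ColorVec φ)) :=
  preservesFiniteLimits_of_preservesEqualizers_and_finiteProducts _

end ColorVec

/-! ### Protomodularity through the short five lemma -/

section ShortFive

variable {C : Type w} [Category.{v} C] {D : Type*} [Category* D] [CartesianMonoidalCategory D]

open MonObj

/-- A category with pullbacks and a conservative functor to a cartesian monoidal category which preserves
pullbacks and factors through group objects is protomodular. -/
theorem isProtomodular_of_grpObj [HasPullbacks C] (F : C ⥤ D) [F.ReflectsIsomorphisms]
    [PreservesLimitsOfShape WalkingCospan F] [∀ X, GrpObj (F.obj X)]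
    [∀ {X Y : C} (f : X ⟶ Y), IsMonHom (F.map f)] : IsProtomodular C where
  hasPullback _ _ := inferInstance
  reflectsIsomorphisms {A B} f := by
    have : HasPullbacksOfSplitEpis C := ⟨fun _ _ => inferInstance⟩
    refine ⟨fun {P Q} g hg => ?_⟩
    let g' := PointOver.pullbackMap f g
    have hg' : IsIso g' := by
      obtain ⟨i, hi, hi'⟩ := hg
      exact ⟨i.f, congrArg PointOver.Hom.f hi, congrArg PointOver.Hom.f hi'⟩
    have hlim (R : PointOver B) := isLimitPullbackConeMapOfIsLimit F _
      (pullbackIsPullback R.p f)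
    -- Generalized elements of the kernel of `R.p` lift to the pullback along `f`, paired with the
    -- trivial element over `A`: the pullback has the same kernel.
    have hex (R : PointOver B) {T : D} (d : T ⟶ F.obj R.X) (hd : d ≫ F.map R.p = 1) :
        ∃ t : T ⟶ F.obj (pullback R.p f), t ≫ F.map (pullback.fst R.p f) = d ∧
          t ≫ F.map (pullback.snd R.p f) = 1 := by
      have h : d ≫ F.map R.p = (1 : T ⟶ F.obj A) ≫ F.map f := by rw [hd, one_comp]
      exact ⟨PullbackCone.IsLimit.lift (hlim R) d 1 h, PullbackCone.IsLimit.lift_fst _ _ _ _,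
        PullbackCone.IsLimit.lift_snd _ _ _ _⟩
    have hfst : F.map g' ≫ F.map (pullback.fst Q.p f) = F.map (pullback.fst P.p f) ≫ F.map g.f := by
      rw [← F.map_comp, ← F.map_comp, PointOver.pullbackMap_fst]
    have hsnd : F.map g' ≫ F.map (pullback.snd Q.p f) = F.map (pullback.snd P.p f) := by
      rw [← F.map_comp, PointOver.pullbackMap_snd]
    have hgp : F.map g.f ≫ F.map Q.p = F.map P.p := by rw [← F.map_comp, g.f_p]
    have hsg : F.map P.s ≫ F.map g.f = F.map Q.s := by rw [← F.map_comp, g.s_f]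
    have hfac (R : PointOver B) : F.map R.s ≫ F.map R.p = 𝟙 _ := by
      rw [← F.map_comp, R.fac, F.map_id]
    -- An element killed by `g` lies over the trivial element of `B`, so it lifts to the pullback,
    -- where the induced map is invertible.
    have hker {T : D} (d : T ⟶ F.obj P.X) (hd : d ≫ F.map g.f = 1) : d = 1 := by
      obtain ⟨t, ht, ht'⟩ := hex P d (by rw [← hgp, ← Category.assoc, hd, one_comp])
      have : t ≫ F.map g' = 1 ≫ F.map g' := by
        refine PullbackCone.IsLimit.hom_ext (hlim Q) ?_ ?_
        · change (t ≫ F.map g') ≫ F.map _ = (1 ≫ F.map g') ≫ F.map _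
          rw [Category.assoc, Category.assoc, hfst, ← Category.assoc, ht, hd, one_comp]
        · change (t ≫ F.map g') ≫ F.map _ = (1 ≫ F.map g') ≫ F.map _
          rw [Category.assoc, Category.assoc, hsnd, ht', one_comp]
      rw [← ht, (cancel_mono (F.map g')).mp this, one_comp]
    have hinj {T : D} (d d' : T ⟶ F.obj P.X) (h : d ≫ F.map g.f = d' ≫ F.map g.f) : d = d' := by
      rw [← mul_inv_eq_one]
      refine hker _ ?_
      rw [mul_comp, GrpObj.inv_comp, h, mul_inv_cancel]
    -- The section of `P` provides `x₀` whose image has the same projection to `B` as `y`. The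
    -- quotient of `y` by this image lies in the kernel of `Q.p`, hence comes from `P` through the
    -- pullbacks.
    have hsurj {T : D} (y : T ⟶ F.obj Q.X) : ∃ x, x ≫ F.map g.f = y := by
      let x₀ := (y ≫ F.map Q.p) ≫ F.map P.s
      have hx₀ : (x₀ ≫ F.map g.f) ≫ F.map Q.p = y ≫ F.map Q.p := by
        rw [Category.assoc, hgp, Category.assoc, hfac, Category.comp_id]
      obtain ⟨t, ht, ht'⟩ := hex Q (y * (x₀ ≫ F.map g.f)⁻¹) (by
        rw [mul_comp, GrpObj.inv_comp, hx₀, mul_inv_cancel])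
      refine ⟨(t ≫ inv (F.map g') ≫ F.map (pullback.fst P.p f)) * x₀, ?_⟩
      rw [mul_comp, Category.assoc, Category.assoc, ← hfst, IsIso.inv_hom_id_assoc, ht,
        inv_mul_cancel_right]
    obtain ⟨h, hh⟩ := hsurj (𝟙 _)
    have : IsIso (F.map g.f) := ⟨h, hinj _ _ (by rw [Category.assoc, hh]; simp), hh⟩
    have : IsIso g.f := isIso_of_reflects_iso g.f F
    exact ⟨⟨inv g.f, by rw [IsIso.inv_comp_eq, g.f_p], by rw [IsIso.comp_inv_eq, g.s_f]⟩,
      PointOver.Hom.ext (IsIso.hom_inv_id g.f), PointOver.Hom.ext (IsIso.inv_hom_id g.f)⟩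

end ShortFive

/-- The functor to cocommutative comonoids is conservative, preserves finite limits and takes values
in group objects and their homomorphisms. -/
instance {k G : Type u} [Field k] [CommGroup G] {φ : CommutationFactor k G} :
    IsProtomodular (HopfCoc (ColorVec φ)) :=
  isProtomodular_of_grpObj HopfCoc.forgetCommComon

/-! ### Filtered colimits of vector spaces and tensor products -/

namespace ColorVec

variable {k G : Type u} [Field k] [CommGroup G] {φ : CommutationFactor k G}
variable {J : Type u} [SmallCategory J]

/-- The maps `p j` to `Z` are a filtered colimit, in elementary terms: every element of `Z` comes
from some `F.obj j`, and an element of `F.obj j` which vanishes in `Z` vanishes at a later stage. -/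
structure IsFilteredColimit (F : J ⥤ ColorVec φ) {Z : Type u} [AddCommGroup Z] [Module k Z]
    (p : ∀ j, F.obj j →ₗ[k] Z) : Prop where
  naturality : ∀ {i j : J} (f : i ⟶ j) (x : F.obj i), p j (Hom.toLin (F.map f) x) = p i x
  surjective : ∀ z, ∃ j x, p j x = z
  eventually_zero : ∀ {j : J} (x : F.obj j), p j x = 0 →
    ∃ (i : J) (f : j ⟶ i), Hom.toLin (F.map f) x = 0

theorem map_comp_apply (F : J ⥤ ColorVec φ) {i j l : J} (f : i ⟶ j) (g : j ⟶ l) (x : F.obj i) :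
    Hom.toLin (F.map (f ≫ g)) x = Hom.toLin (F.map g) (Hom.toLin (F.map f) x) := by
  rw [F.map_comp]
  rfl

namespace IsFilteredColimit

variable {F : J ⥤ ColorVec φ} {Z : Type u} [AddCommGroup Z] [Module k Z]
  {p : ∀ j, F.obj j →ₗ[k] Z} (h : IsFilteredColimit F p)

section
variable [IsFiltered J]

theorem exists_rep₂ (h : IsFilteredColimit F p) (z w : Z) : ∃ j x y, p j x = z ∧ p j y = w := by
  obtain ⟨i, x, rfl⟩ := h.surjective z
  obtain ⟨j, y, rfl⟩ := h.surjective w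
  exact ⟨IsFiltered.max i j, _, _, h.naturality (IsFiltered.leftToMax i j) x,
    h.naturality (IsFiltered.rightToMax i j) y⟩

theorem exists_linear_desc (h : IsFilteredColimit F p) {T : Type*} [AddCommGroup T] [Module k T]
    (s : ∀ j, F.obj j →ₗ[k] T)
    (hs : ∀ {i j : J} (f : i ⟶ j) (x : F.obj i), s j (Hom.toLin (F.map f) x) = s i x) :
    ∃ l : Z →ₗ[k] T, ∀ j x, l (p j x) = s j x := by
  choose i r hr using h.surjective
  -- The chosen representative and `x` have the same image in `Z`, so they agree at a later stage;
  -- hence `s` does not see the choice.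
  have key : ∀ j x, s (i (p j x)) (r (p j x)) = s j x := by
    intro j x
    let i' := i (p j x)
    let a := IsFiltered.leftToMax i' j
    let b := IsFiltered.rightToMax i' j
    obtain ⟨m, c, hc⟩ := h.eventually_zero
      (Hom.toLin (F.map a) (r (p j x)) - Hom.toLin (F.map b) x) (by
        rw [map_sub, h.naturality, h.naturality, hr, sub_self])
    rw [map_sub, sub_eq_zero] at hc
    rw [← hs a, ← hs c, hc, hs, hs]
  refine ⟨{ toFun := fun z => s (i z) (r z), map_add' := ?_, map_smul' := ?_ }, key⟩
  · intro z w
    obtain ⟨j, x, y, rfl, rfl⟩ := h.exists_rep₂ z w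
    rw [← map_add, key, key, key, map_add]
  · intro c z
    obtain ⟨j, x, rfl⟩ := h.surjective z
    rw [← map_smul, key, key, map_smul]
    rfl

end

theorem linear_ext (h : IsFilteredColimit F p) {T : Type*} [AddCommGroup T] [Module k T]
    {l m : Z →ₗ[k] T} (hlm : ∀ j x, l (p j x) = m (p j x)) : l = m := by
  refine LinearMap.ext fun z => ?_
  obtain ⟨j, x, rfl⟩ := h.surjective z
  exact hlm j x

/-- The elements of `F.obj j` which vanish at a later stage. -/
def eventualKer [IsFiltered J] (F : J ⥤ ColorVec φ) (j : J) : Submodule k (F.obj j) where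
  carrier := {x | ∃ (i : J) (f : j ⟶ i), Hom.toLin (F.map f) x = 0}
  zero_mem' := ⟨j, 𝟙 j, map_zero _⟩
  add_mem' := by
    rintro x y ⟨i, f, hf⟩ ⟨i', f', hf'⟩
    obtain ⟨m, a, b, hab⟩ := IsFiltered.span f f'
    refine ⟨m, f ≫ a, ?_⟩
    rw [map_add, map_comp_apply, hf, map_zero, hab, map_comp_apply, hf', map_zero, add_zero]
  smul_mem' := by
    rintro c x ⟨i, f, hf⟩
    exact ⟨i, f, by rw [map_smul, hf, smul_zero]⟩

end IsFilteredColimit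

/-- The tensor product of two functors. -/
abbrev tensorFunctor (F F' : J ⥤ ColorVec φ) : J ⥤ ColorVec φ where
  obj j := F.obj j ⊗ F'.obj j
  map f := F.map f ⊗ₘ F'.map f
  map_id j := by rw [F.map_id, F'.map_id, id_tensorHom_id]
  map_comp f g := by rw [F.map_comp, F'.map_comp, tensorHom_comp_tensorHom]

/-- Over a field each map may be replaced by its corestriction to its image, since the tensor
product of the inclusions stays injective. For surjections, right exactness shows that the kernel is
generated by pure tensors with a factor in a kernel. -/
theorem map_eq_zero_cases {V W V' W' : Type*} [AddCommGroup V] [Module k V] [AddCommGroup W]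
    [Module k W] [AddCommGroup V'] [Module k V'] [AddCommGroup W']
    [Module k W'] (p : V →ₗ[k] V') (q : W →ₗ[k] W') {N : Submodule k (V ⊗[k] W)}
    (h1 : ∀ x y, p x = 0 → x ⊗ₜ y ∈ N) (h2 : ∀ x y, q y = 0 → x ⊗ₜ y ∈ N) :
    LinearMap.ker (TensorProduct.map p q) ≤ N := by
  have hpq : TensorProduct.map p q = TensorProduct.map (LinearMap.range p).subtype
      (LinearMap.range q).subtype ∘ₗ TensorProduct.map p.rangeRestrict q.rangeRestrict := by
    rw [← TensorProduct.map_comp]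
    rfl
  have hinj : Function.Injective (TensorProduct.map (LinearMap.range p).subtype
      (LinearMap.range q).subtype) :=
    TensorProduct.map_injective_of_flat_flat _ _ (Submodule.subtype_injective _)
      (Submodule.subtype_injective _)
  rw [hpq, LinearMap.ker_comp_of_ker_eq_bot _ (LinearMap.ker_eq_bot.mpr hinj),
    TensorProduct.map_ker (p.rangeRestrict.exact_subtype_ker_map) p.surjective_rangeRestrict
      (q.rangeRestrict.exact_subtype_ker_map) q.surjective_rangeRestrict, sup_le_iff]
  constructor
  · rintro _ ⟨t, rfl⟩
    have : N.mkQ ∘ₗ (LinearMap.ker q.rangeRestrict).subtype.lTensor V = 0 :=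
      TensorProduct.ext' fun x y => (Submodule.Quotient.mk_eq_zero _).mpr
        (h2 x y (congrArg Subtype.val y.2))
    exact (Submodule.Quotient.mk_eq_zero _).mp (LinearMap.congr_fun this t)
  · rintro _ ⟨t, rfl⟩
    have : N.mkQ ∘ₗ (LinearMap.ker p.rangeRestrict).subtype.rTensor W = 0 :=
      TensorProduct.ext' fun x y => (Submodule.Quotient.mk_eq_zero _).mpr
        (h1 x y (congrArg Subtype.val x.2))
    exact (Submodule.Quotient.mk_eq_zero _).mp (LinearMap.congr_fun this t)

theorem IsFilteredColimit.tensor_naturality {F F' : J ⥤ ColorVec φ} {Z Z' : Type u} [AddCommGroup Z]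
    [Module k Z] [AddCommGroup Z'] [Module k Z'] {p : ∀ j, F.obj j →ₗ[k] Z}
    {p' : ∀ j, F'.obj j →ₗ[k] Z'} (h : IsFilteredColimit F p) (h' : IsFilteredColimit F' p')
    {i j : J} (f : i ⟶ j) (t : F.obj i ⊗[k] F'.obj i) :
    TensorProduct.map (p j) (p' j) (Hom.toLin (F.map f ⊗ₘ F'.map f) t) =
      TensorProduct.map (p i) (p' i) t := by
  have : TensorProduct.map (p j) (p' j) ∘ₗ Hom.toLin (F.map f ⊗ₘ F'.map f) =
      TensorProduct.map (p i) (p' i) :=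
    TensorProduct.ext' fun x y => by
      change p j (Hom.toLin (F.map f) x) ⊗ₜ[k] p' j (Hom.toLin (F'.map f) y) = p i x ⊗ₜ p' i y
      rw [h.naturality, h'.naturality]
  exact LinearMap.congr_fun this t

section
variable [IsFiltered J]

/-- A tensor involves finitely many elements, so it comes from a single stage. If it vanishes in the
limit, it is a combination of pure tensors with a factor vanishing in the limit, and each of these
vanishes at a later stage. -/
theorem IsFilteredColimit.tensor {F F' : J ⥤ ColorVec φ} {Z Z' : Type u} [AddCommGroup Z]
    [Module k Z] [AddCommGroup Z'] [Module k Z'] {p : ∀ j, F.obj j →ₗ[k] Z}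
    {p' : ∀ j, F'.obj j →ₗ[k] Z'} (h : IsFilteredColimit F p) (h' : IsFilteredColimit F' p') :
    IsFilteredColimit (tensorFunctor F F') (fun j => TensorProduct.map (p j) (p' j)) where
  naturality f x := h.tensor_naturality h' f x
  surjective z := by
    induction z using TensorProduct.induction_on with
    | zero => exact ⟨IsFiltered.nonempty.some, 0, map_zero _⟩
    | tmul z w =>
      obtain ⟨i, x, rfl⟩ := h.surjective z
      obtain ⟨j, y, rfl⟩ := h'.surjective w
      refine ⟨IsFiltered.max i j, Hom.toLin (F.map (IsFiltered.leftToMax i j)) x ⊗ₜ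
        Hom.toLin (F'.map (IsFiltered.rightToMax i j)) y, ?_⟩
      refine (TensorProduct.map_tmul _ _ _ _).trans ?_
      rw [h.naturality, h'.naturality]
    | add z w hz hw =>
      obtain ⟨i, x, rfl⟩ := hz
      obtain ⟨j, y, rfl⟩ := hw
      refine ⟨IsFiltered.max i j, Hom.toLin (F.map (IsFiltered.leftToMax i j) ⊗ₘ
        F'.map (IsFiltered.leftToMax i j)) x + Hom.toLin (F.map (IsFiltered.rightToMax i j) ⊗ₘ
        F'.map (IsFiltered.rightToMax i j)) y, ?_⟩
      refine (map_add (TensorProduct.map _ _) _ _).trans ?_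
      rw [h.tensor_naturality h', h.tensor_naturality h']
  eventually_zero {j} t ht := by
    refine map_eq_zero_cases (p j) (p' j)
      (N := IsFilteredColimit.eventualKer (tensorFunctor F F') j) ?_ ?_ ht
    · intro x y hx
      obtain ⟨i, f, hf⟩ := h.eventually_zero x hx
      refine ⟨i, f, ?_⟩
      change Hom.toLin (F.map f) x ⊗ₜ Hom.toLin (F'.map f) y = 0
      rw [hf, TensorProduct.zero_tmul]
    · intro x y hy
      obtain ⟨i, f, hf⟩ := h'.eventually_zero y hy
      refine ⟨i, f, ?_⟩
      change Hom.toLin (F.map f) x ⊗ₜ Hom.toLin (F'.map f) y = 0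
      rw [hf, TensorProduct.tmul_zero]

/-- The underlying vector space, as a functor. -/
abbrev toModuleCat : ColorVec φ ⥤ ModuleCat.{u} k where
  obj V := ModuleCat.of k V
  map f := ModuleCat.ofHom (Hom.toLin f)

theorem exists_isFilteredColimit (F : J ⥤ ColorVec φ) :
    ∃ (Z : Type u) (_ : AddCommGroup Z) (_ : Module k Z) (p : ∀ j, F.obj j →ₗ[k] Z),
      IsFilteredColimit F p := by
  let D := F ⋙ toModuleCat
  refine ⟨(colimit D : ModuleCat.{u} k), inferInstance, inferInstance, fun j => (colimit.ι D j).hom, ?_, ?_, ?_⟩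
  · intro i j f x
    exact LinearMap.congr_fun (congrArg ModuleCat.Hom.hom (colimit.w D f)) x
  · intro z
    exact Concrete.colimit_exists_rep D z
  · intro j x hx
    obtain ⟨l, f, g, hfg⟩ := Concrete.colimit_exists_of_rep_eq D x (0 : F.obj j)
      (hx.trans (map_zero _).symm)
    exact ⟨l, f, hfg.trans (map_zero _)⟩

end

end ColorVec

/-! ### Filtered colimits of color Hopf algebras -/

namespace ColorVec

variable {k G : Type u} [Field k] [CommGroup G] {φ : CommutationFactor k G}
variable {J : Type u} [SmallCategory J]

theorem jointlyEpi_of_isFilteredColimit {F : J ⥤ ColorVec φ} {Z : ColorVec φ}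
    {p : ∀ j, F.obj j ⟶ Z} (h : IsFilteredColimit F fun j => Hom.toLin (p j)) : JointlyEpi p :=
  fun _ _ _ hfg => hom_ext (h.linear_ext fun j x =>
    LinearMap.congr_fun (congrArg Hom.toLin (hfg j)) x)

section
variable [IsFiltered J]

theorem exists_filteredDesc {F : J ⥤ ColorVec φ} {Z : ColorVec φ} {p : ∀ j, F.obj j ⟶ Z}
    (h : IsFilteredColimit F fun j => Hom.toLin (p j)) {T : ColorVec φ} (s : ∀ j, F.obj j ⟶ T)
    (hs : ∀ {i j : J} (f : i ⟶ j), F.map f ≫ s j = s i) :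
    ∃ l : Z ⟶ T, ∀ j, p j ≫ l = s j := by
  obtain ⟨l, hl⟩ := h.exists_linear_desc (fun j => Hom.toLin (s j))
    (fun f x => LinearMap.congr_fun (congrArg Hom.toLin (hs f)) x)
  refine ⟨ofLin l fun g z hz => ?_, fun j => hom_ext (LinearMap.ext fun x => hl j x)⟩
  obtain ⟨j, x, rfl⟩ := h.surjective z
  -- A homogeneous element of `Z` is the image of the component of that degree of any
  -- representative.
  rw [← proj_of_mem hz, ← toLin_proj, hl]
  exact toLin_mem _ ((F.obj j).proj_mem g x)

/-- The grading of a filtered colimit. -/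
def filteredGrading (F : J ⥤ ColorVec φ) {Z : Type u} [AddCommGroup Z] [Module k Z]
    {p : ∀ j, F.obj j →ₗ[k] Z} (h : IsFilteredColimit F p) (g : G) : Submodule k Z where
  carrier := {z | ∃ j, ∃ x ∈ (F.obj j).grading g, p j x = z}
  zero_mem' := ⟨IsFiltered.nonempty.some, 0, Submodule.zero_mem _, map_zero _⟩
  add_mem' := by
    rintro _ _ ⟨i, x, hx, rfl⟩ ⟨j, y, hy, rfl⟩
    refine ⟨IsFiltered.max i j, _, Submodule.add_mem _
      (toLin_mem (F.map (IsFiltered.leftToMax i j)) hx)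
      (toLin_mem (F.map (IsFiltered.rightToMax i j)) hy), ?_⟩
    rw [map_add, h.naturality, h.naturality]
  smul_mem' := by
    rintro c _ ⟨i, x, hx, rfl⟩
    exact ⟨i, c • x, Submodule.smul_mem _ c hx, map_smul _ _ _⟩

open Classical in
theorem isInternal_filteredGrading (F : J ⥤ ColorVec φ) {Z : Type u} [AddCommGroup Z] [Module k Z]
    {p : ∀ j, F.obj j →ₗ[k] Z} (h : IsFilteredColimit F p) :
    DirectSum.IsInternal (filteredGrading F h) := by
  have hpr (g : G) := h.exists_linear_desc (fun j => p j ∘ₗ (F.obj j).proj g) fun {i j} f x => by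
    rw [LinearMap.comp_apply, ← toLin_proj, h.naturality]
    rfl
  choose pr hpr using hpr
  refine isInternal_of_proj _ pr ?_ ?_ ?_
  · rintro g _ ⟨j, x, hx, rfl⟩
    rw [hpr, LinearMap.comp_apply, proj_of_mem hx]
  · rintro g g' hg _ ⟨j, x, hx, rfl⟩
    rw [hpr, LinearMap.comp_apply, proj_of_mem_ne hx hg, map_zero]
  · rw [eq_top_iff]
    intro z _
    obtain ⟨j, x, rfl⟩ := h.surjective z
    have : Submodule.span k {x : F.obj j | ∃ g, x ∈ (F.obj j).grading g} ≤
        (⨆ g, filteredGrading F h g).comap (p j) := by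
      rw [Submodule.span_le]
      rintro x ⟨g, hx⟩
      exact Submodule.mem_iSup_of_mem g ⟨j, x, hx, rfl⟩
    rw [span_homogeneous] at this
    exact this (Submodule.mem_top (x := x))

theorem exists_gradedFilteredColimit (F : J ⥤ ColorVec φ) :
    ∃ (Z : ColorVec φ) (p : ∀ j, F.obj j ⟶ Z), IsFilteredColimit F fun j => Hom.toLin (p j) := by
  obtain ⟨Z, _, _, p, h⟩ := exists_isFilteredColimit F
  let Z' : ColorVec φ :=
    { carrier := Z
      grading := filteredGrading F h
      isInternal := isInternal_filteredGrading F h }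
  exact ⟨Z', fun j => ofLin (W := Z') (p j) fun _ x hx => ⟨j, x, hx, rfl⟩, h⟩

end

section Hopf

open HopfCoc

variable (φ) in
/-- The underlying graded vector space, as a functor. -/
abbrev forgetHopf : HopfCoc (ColorVec φ) ⥤ ColorVec φ where
  obj H := H.obj.X
  map f := underlying f.hom

variable {F : J ⥤ HopfCoc (ColorVec φ)} {Z : ColorVec φ} {p : ∀ j, (F.obj j).obj.X ⟶ Z}

/-- The morphism underlying a component of a cocone. -/
abbrev coconeMap (c : Cocone F) (j : J) : (F.obj j).obj.X ⟶ c.pt.obj.X :=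
  underlying (c.ι.app j).hom

theorem map_comp_of_isFilteredColimit
    (h : IsFilteredColimit (F ⋙ forgetHopf φ) fun j => Hom.toLin (p j)) {i j : J} (f : i ⟶ j) :
    underlying (F.map f).hom ≫ p j = p i :=
  hom_ext (LinearMap.ext fun x => h.naturality f x)

/-- Tensoring with the unit object is isomorphic to the identity, so joint epimorphy transfers along
the unitor. -/
theorem jointlyEpi_unit_whiskerLeft {F : J ⥤ ColorVec φ} {p : ∀ j, F.obj j ⟶ Z}
    (h : IsFilteredColimit F fun j => Hom.toLin (p j)) :
    JointlyEpi fun j => 𝟙_ (ColorVec φ) ◁ p j := fun _ f g hfg => by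
  rw [← cancel_epi (λ_ Z).inv]
  refine jointlyEpi_of_isFilteredColimit h _ _ fun j => ?_
  rw [leftUnitor_inv_naturality_assoc, leftUnitor_inv_naturality_assoc, hfg]

theorem jointlyEpi_unit_whiskerRight {F : J ⥤ ColorVec φ} {p : ∀ j, F.obj j ⟶ Z}
    (h : IsFilteredColimit F fun j => Hom.toLin (p j)) :
    JointlyEpi fun j => p j ▷ 𝟙_ (ColorVec φ) := fun _ f g hfg => by
  rw [← cancel_epi (ρ_ Z).inv]
  refine jointlyEpi_of_isFilteredColimit h _ _ fun j => ?_
  rw [rightUnitor_inv_naturality_assoc, rightUnitor_inv_naturality_assoc, hfg]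

theorem isCommComonObj_filtered [ComonObj Z]
    (h : IsFilteredColimit (F ⋙ forgetHopf φ) fun j => Hom.toLin (p j))
    (hp : ∀ j, IsComonHom (p j)) : IsCommComonObj Z where
  comul_comm := jointlyEpi_of_isFilteredColimit h _ _ fun j => by
    rw [reassoc_of% (hp j).hom_comul, BraidedCategory.braiding_naturality,
      (hp j).hom_comul]
    exact IsCommComonObj.comul_comm_assoc (F.obj j).obj.X _

variable [IsFiltered J]

theorem exists_filteredHopf_data
    (h : IsFilteredColimit (F ⋙ forgetHopf φ) fun j => Hom.toLin (p j)) :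
    (∃ d : Z ⟶ Z ⊗ Z, ∀ j, p j ≫ d = Δ[(F.obj j).obj.X] ≫ (p j ⊗ₘ p j)) ∧
    (∃ c : Z ⟶ 𝟙_ _, ∀ j, p j ≫ c = ε[(F.obj j).obj.X]) ∧
    (∃ m : Z ⊗ Z ⟶ Z, ∀ j, (p j ⊗ₘ p j) ≫ m = μ[(F.obj j).obj.X] ≫ p j) ∧
    (∃ e : 𝟙_ _ ⟶ Z, ∀ j, η[(F.obj j).obj.X] ≫ p j = e) ∧
    (∃ s : Z ⟶ Z, ∀ j, p j ≫ s = HopfObj.antipode (X := (F.obj j).obj.X) ≫ p j) := by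
  have hp {i j : J} (f : i ⟶ j) := map_comp_of_isFilteredColimit h f
  have h2 : IsFilteredColimit (tensorFunctor (F ⋙ forgetHopf φ) (F ⋙ forgetHopf φ))
    fun j => Hom.toLin (p j ⊗ₘ p j) := h.tensor h
  have hmon {i j : J} (f : i ⟶ j) := isMonHom_underlying (F.map f).hom
  have hcomon {i j : J} (f : i ⟶ j) := isComonHom_underlying (F.map f).hom
  refine ⟨?_, ?_, ?_, ?_, ?_⟩
  · refine exists_filteredDesc h (fun j => Δ[(F.obj j).obj.X] ≫ (p j ⊗ₘ p j)) fun {i j} f => ?_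
    change underlying (F.map f).hom ≫ _ = _
    rw [reassoc_of% (hcomon f).hom_comul, tensorHom_comp_tensorHom, hp]
  · exact exists_filteredDesc h (fun j => ε[(F.obj j).obj.X]) fun f => (hcomon f).hom_counit
  · refine exists_filteredDesc h2 (fun j => μ[(F.obj j).obj.X] ≫ p j) fun {i j} f => ?_
    change (underlying (F.map f).hom ⊗ₘ underlying (F.map f).hom) ≫ _ = _
    rw [← reassoc_of% (hmon f).mul_hom, hp]
  · have he {i j : J} (f : i ⟶ j) : η[(F.obj i).obj.X] ≫ p i = η[(F.obj j).obj.X] ≫ p j := by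
      rw [← hp f, reassoc_of% (hmon f).one_hom]
    -- Any two stages map to a common one, so the image of the unit in `Z` does not depend on the
    -- stage.
    have j₀ : J := IsFiltered.nonempty.some
    exact ⟨η[(F.obj j₀).obj.X] ≫ p j₀, fun j => (he (IsFiltered.leftToMax j j₀)).trans
      (he (IsFiltered.rightToMax j j₀)).symm⟩
  · refine exists_filteredDesc h (fun j => HopfObj.antipode (X := (F.obj j).obj.X) ≫ p j)
      fun {i j} f => ?_
    change underlying (F.map f).hom ≫ _ = _
    have : IsBimonHom (underlying (F.map f).hom) := { __ := hmon f, __ := hcomon f }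
    rw [← Category.assoc, HopfObj.hom_antipode, Category.assoc, hp]

theorem exists_filteredHopf
    (h : IsFilteredColimit (F ⋙ forgetHopf φ) fun j => Hom.toLin (p j)) :
    ∃ _ : HopfObj Z, (∀ j, IsMonHom (p j)) ∧ ∀ j, IsComonHom (p j) := by
  have h2 : IsFilteredColimit (tensorFunctor (F ⋙ forgetHopf φ) (F ⋙ forgetHopf φ))
    fun j => Hom.toLin (p j ⊗ₘ p j) := h.tensor h
  have h3 : IsFilteredColimit (tensorFunctor (tensorFunctor (F ⋙ forgetHopf φ)
    (F ⋙ forgetHopf φ)) (F ⋙ forgetHopf φ)) fun j => Hom.toLin ((p j ⊗ₘ p j) ⊗ₘ p j) := h2.tensor h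
  have e1 := jointlyEpi_of_isFilteredColimit h
  have e2 := jointlyEpi_of_isFilteredColimit h2
  have e3 := jointlyEpi_of_isFilteredColimit h3
  have el := jointlyEpi_unit_whiskerLeft h
  have er := jointlyEpi_unit_whiskerRight h
  obtain ⟨⟨d, hd⟩, ⟨c, hc⟩, ⟨m, hm⟩, ⟨e, he⟩, ⟨s, hs⟩⟩ := exists_filteredHopf_data h
  let _i : HopfObj Z := HopfObj.ofJointlyEpi (X := fun j => (F.obj j).obj.X) p
    e1 e2 e3 el er d hd c hc m hm e he IsFiltered.nonempty s hs
  exact ⟨_i, fun j => ⟨he j, (hm j).symm⟩, fun j => ⟨hc j, hd j⟩⟩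

/-- The map induced on underlying spaces respects the structure because `Z` and `Z ⊗ Z`, for `Z` the
space of `c.pt`, are jointly covered by the stages and their tensor squares, where the axioms hold.
-/
theorem isColimit_of_isFilteredColimit (c : Cocone F)
    (h : IsFilteredColimit (F ⋙ forgetHopf φ) fun j => Hom.toLin (coconeMap c j)) :
    Nonempty (IsColimit c) := by
  have key (s : Cocone F) : ∃ l : c.pt ⟶ s.pt, ∀ j, c.ι.app j ≫ l = s.ι.app j := by
    obtain ⟨l, hl⟩ := exists_filteredDesc h (fun j => coconeMap s j)
      fun f => congrArg (fun t => underlying t.hom) (s.w f)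
    have h2 : IsFilteredColimit (tensorFunctor (F ⋙ forgetHopf φ) (F ⋙ forgetHopf φ))
      fun j => Hom.toLin (coconeMap c j ⊗ₘ coconeMap c j) := h.tensor h
    have hm (j) := isMonHom_underlying (c.ι.app j).hom
    have hm' (j) := isMonHom_underlying (s.ι.app j).hom
    have hc (j) := isComonHom_underlying (c.ι.app j).hom
    have hc' (j) := isComonHom_underlying (s.ι.app j).hom
    refine ⟨HopfCoc.homMk l ⟨?_, ?_⟩ ⟨?_, ?_⟩, fun j => HopfCoc.hom_ext (hl j)⟩
    · have j₀ : J := IsFiltered.nonempty.some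
      rw [← (hm j₀).one_hom, Category.assoc]
      exact (congrArg _ (hl j₀)).trans (hm' j₀).one_hom
    · refine jointlyEpi_of_isFilteredColimit h2 _ _ fun j => ?_
      rw [← reassoc_of% (hm j).mul_hom, tensorHom_comp_tensorHom_assoc]
      refine (congrArg _ (hl j)).trans ((hm' j).mul_hom.trans ?_)
      exact congrArg (fun t => (t ⊗ₘ t) ≫ μ[s.pt.obj.X]) (hl j).symm
    · refine jointlyEpi_of_isFilteredColimit h _ _ fun j => ?_
      rw [(hc j).hom_counit, ← Category.assoc]
      exact (congrArg (· ≫ ε[s.pt.obj.X]) (hl j)).trans (hc' j).hom_counit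
    · refine jointlyEpi_of_isFilteredColimit h _ _ fun j => ?_
      rw [reassoc_of% (hc j).hom_comul, tensorHom_comp_tensorHom, ← Category.assoc]
      refine (congrArg (· ≫ Δ[s.pt.obj.X]) (hl j)).trans ((hc' j).hom_comul.trans ?_)
      exact congrArg (fun t => Δ[(F.obj j).obj.X] ≫ (t ⊗ₘ t)) (hl j).symm
  choose l hl using key
  refine ⟨⟨l, hl, fun s m hm => HopfCoc.hom_ext (jointlyEpi_of_isFilteredColimit h _ _ fun j => ?_)⟩⟩
  exact congrArg (fun t => underlying t.hom) ((hm j).trans (hl s j).symm)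

/-- The colimit of the underlying spaces carries a Hopf structure making it a colimit of Hopf
algebras. An arbitrary colimit cocone is isomorphic to this one. -/
theorem isFilteredColimit_of_isColimit {c : Cocone F} (hc : IsColimit c) :
    IsFilteredColimit (F ⋙ forgetHopf φ) fun j => Hom.toLin (coconeMap c j) := by
  obtain ⟨Z, p, h⟩ := exists_gradedFilteredColimit (F ⋙ forgetHopf φ)
  obtain ⟨i, hm, hcm⟩ := exists_filteredHopf (F := F) h
  let c' : Cocone F :=
    Cocone.mk (HopfCoc.of i (isCommComonObj_filtered (F := F) h hcm))
      { app := fun j => HopfCoc.homMk (B := HopfCoc.of i _) (p j) (hm j) (hcm j)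
        naturality := fun i j f => HopfCoc.hom_ext
          ((map_comp_of_isFilteredColimit (F := F) h f).trans (Category.comp_id _).symm) }
  obtain ⟨hc'⟩ := isColimit_of_isFilteredColimit c' h
  let e := hc'.coconePointUniqueUpToIso hc
  have he (j : J) : p j ≫ underlying e.hom.hom = coconeMap c j :=
    congrArg (fun t => underlying t.hom) (hc'.comp_coconePointUniqueUpToIso_hom hc j)
  have he' (j : J) (x : (F.obj j).obj.X) : Hom.toLin (coconeMap c j) x =
      Hom.toLin (underlying e.hom.hom) (Hom.toLin (p j) x) :=
    (LinearMap.congr_fun (congrArg Hom.toLin (he j)) x).symm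
  have e1 : underlying e.hom.hom ≫ underlying e.inv.hom = 𝟙 _ :=
    congrArg (fun t => underlying t.hom) e.hom_inv_id
  have e2 : underlying e.inv.hom ≫ underlying e.hom.hom = 𝟙 _ :=
    congrArg (fun t => underlying t.hom) e.inv_hom_id
  refine ⟨fun {i j} f x => ?_, fun z => ?_, fun {j} x hx => h.eventually_zero x ?_⟩
  · exact LinearMap.congr_fun (congrArg (fun t => Hom.toLin (underlying t.hom)) (c.w f)) x
  · obtain ⟨j, x, hx⟩ := h.surjective (Hom.toLin (underlying e.inv.hom) z)
    refine ⟨j, x, ?_⟩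
    rw [he', hx]
    exact LinearMap.congr_fun (congrArg Hom.toLin e2) z
  · rw [he'] at hx
    have := congrArg (Hom.toLin (underlying e.inv.hom)) hx
    rw [map_zero] at this
    rw [← this]
    exact (LinearMap.congr_fun (congrArg Hom.toLin e1) _).symm

end Hopf

end ColorVec

/-! ### Small dimension implies presentability -/

namespace ColorVec

variable {k G : Type u} [Field k] [CommGroup G] {φ : CommutationFactor k G}

theorem exists_homogeneous_basis (V : ColorVec φ) :
    ∃ (I : Type u) (b : Module.Basis I k V) (d : I → G), ∀ i, b i ∈ V.grading (d i) := by
  obtain ⟨B, hB, hspan, hind⟩ := exists_linearIndependent k {x : V | ∃ g, x ∈ V.grading g}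
  let b : Module.Basis B k V := Module.Basis.mk hind (by
    rw [Subtype.range_coe, hspan, V.span_homogeneous])
  choose d hd using fun i : B => hB i.2
  exact ⟨B, b, d, fun i => by
    rw [Module.Basis.mk_apply]
    exact hd i⟩

/-- Commutation with the projections can be tested on a basis of homogeneous vectors. -/
theorem mem_grading_of_basis {V W : ColorVec φ} {I : Type*} (b : Module.Basis I k V) (d : I → G)
    (hb : ∀ i, b i ∈ V.grading (d i)) (f : V →ₗ[k] W) (hf : ∀ i, f (b i) ∈ W.grading (d i))
    (g : G) (x : V) (hx : x ∈ V.grading g) : f x ∈ W.grading g := by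
  have h : f ∘ₗ V.proj g = W.proj g ∘ₗ f := b.ext fun i => by
    rw [LinearMap.comp_apply, LinearMap.comp_apply]
    by_cases hi : g = d i
    · rw [hi, proj_of_mem (hb i), proj_of_mem (hf i)]
    · rw [proj_of_mem_ne (hb i) hi, proj_of_mem_ne (hf i) hi, map_zero]
  have h' := LinearMap.congr_fun h x
  rw [LinearMap.comp_apply, proj_of_mem hx] at h'
  rw [h']
  exact W.proj_mem g _

theorem hasCardinalLT_basis {κ : Cardinal.{u}} {V : ColorVec φ} (hV : Module.rank k V < κ)
    {I : Type u} (b : Module.Basis I k V) : HasCardinalLT I κ := by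
  rwa [hasCardinalLT_iff_cardinal_mk_lt, b.mk_eq_rank'']

theorem comp_map_eq_of_comp_map_eq {J : Type*} [Category* J] {C : Type*} [Category* C] (F : J ⥤ C)
    {V : C} {i j l : J} {f g : V ⟶ F.obj i} {a : i ⟶ j} (h : f ≫ F.map a = g ≫ F.map a)
    (b : j ⟶ l) : f ≫ F.map (a ≫ b) = g ≫ F.map (a ≫ b) := by
  rw [F.map_comp, ← Category.assoc, h, Category.assoc]

section

variable {κ : Cardinal.{u}} [Fact κ.IsRegular]
variable {J : Type u} [SmallCategory J] [IsCardinalFiltered J κ]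

theorem rank_tensor_lt {V W : ColorVec φ} (hV : Module.rank k V < κ) (hW : Module.rank k W < κ) :
    Module.rank k (V ⊗ W : ColorVec φ) < κ := by
  refine (rank_tensorProduct' (R := k) (S := k) (M := V) (M₁ := W)).trans_lt ?_
  exact Cardinal.mul_lt_of_lt (Cardinal.IsRegular.aleph0_le Fact.out) hV hW

theorem rank_unit_lt : Module.rank k (𝟙_ (ColorVec φ) : ColorVec φ) < κ :=
  (Module.rank_self k).trans_lt (Cardinal.one_lt_aleph0.trans_le (Cardinal.IsRegular.aleph0_le Fact.out))

namespace IsFilteredColimit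

/-- Each of the fewer than `κ` basis vectors needs a stage of its own; `κ`-filteredness provides one
that serves them all. -/
theorem exists_map_eq {F : J ⥤ ColorVec φ} {Z : Type u} [AddCommGroup Z] [Module k Z]
    {p : ∀ j, F.obj j →ₗ[k] Z} (h : IsFilteredColimit F p) {V : ColorVec φ}
    (hV : Module.rank k V < κ) {j : J} {f g : V ⟶ F.obj j}
    (hfg : ∀ x, p j (Hom.toLin f x) = p j (Hom.toLin g x)) :
    ∃ (l : J) (a : j ⟶ l), f ≫ F.map a = g ≫ F.map a := by
  obtain ⟨I, b, -, -⟩ := V.exists_homogeneous_basis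
  choose m a ha using fun i => h.eventually_zero (Hom.toLin f (b i) - Hom.toLin g (b i))
    (by rw [map_sub, hfg, sub_self])
  obtain ⟨l, c, e, hc⟩ := IsCardinalFiltered.wideSpan a (hasCardinalLT_basis hV b)
  refine ⟨l, e, hom_ext (b.ext fun i => ?_)⟩
  have := congrArg (Hom.toLin (F.map (c i))) (ha i)
  rw [map_zero, map_sub, map_sub, sub_eq_zero, ← map_comp_apply, ← map_comp_apply, hc] at this
  exact this

theorem exists_lift_hom {F : J ⥤ ColorVec φ} {Z : ColorVec φ} {p : ∀ j, F.obj j ⟶ Z}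
    (h : IsFilteredColimit F fun j => Hom.toLin (p j)) {V : ColorVec φ}
    (hV : Module.rank k V < κ) (f : V ⟶ Z) : ∃ (j : J) (g : V ⟶ F.obj j), g ≫ p j = f := by
  obtain ⟨I, b, d, hb⟩ := V.exists_homogeneous_basis
  have hI := hasCardinalLT_basis hV b
  choose j x hx using fun i => h.surjective (Hom.toLin f (b i))
  let l := IsCardinalFiltered.max j hI
  -- Taking the component of degree `d i` makes the lift homogeneous; its image is unchanged because
  -- `f (b i)` has that degree.
  let y (i : I) : F.obj l :=
    Hom.toLin (F.map (IsCardinalFiltered.toMax j hI i)) ((F.obj (j i)).proj (d i) (x i))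
  let g := b.constr k y
  have hg (i : I) : g (b i) = y i := b.constr_basis k y i
  refine ⟨l, ofLin g (mem_grading_of_basis b d hb g fun i => ?_), hom_ext (b.ext fun i => ?_)⟩
  · rw [hg]
    exact toLin_mem _ (proj_mem _ _ _)
  · change Hom.toLin (p l) (g (b i)) = _
    rw [hg, h.naturality, toLin_proj, hx, proj_of_mem (toLin_mem f (hb i))]

end IsFilteredColimit

open HopfCoc

/-- A linear lift to some stage exists. The identities making it a Hopf morphism hold in the
colimit, and their sources `A ⊗ A`, `𝟙_` and `A` have dimension less than `κ`, so they hold at a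
later stage. -/
theorem exists_factorization {F : J ⥤ HopfCoc (ColorVec φ)} {c : Cocone F} (hc : IsColimit c)
    {A : HopfCoc (ColorVec φ)} (hA : Module.rank k A.obj.X < κ) (f : A ⟶ c.pt) :
    ∃ (j : J) (g : A ⟶ F.obj j), g ≫ c.ι.app j = f := by
  have := isFiltered_of_isCardinalFiltered J κ
  have h := isFilteredColimit_of_isColimit hc
  have h2 : IsFilteredColimit (tensorFunctor (F ⋙ forgetHopf φ) (F ⋙ forgetHopf φ))
    fun j => Hom.toLin (coconeMap c j ⊗ₘ coconeMap c j) := h.tensor h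
  obtain ⟨j, g, hg⟩ := h.exists_lift_hom hA (underlying f.hom)
  have hm := isMonHom_underlying f.hom
  have hm' : IsMonHom (coconeMap c j) := isMonHom_underlying (c.ι.app j).hom
  have hd := isComonHom_underlying f.hom
  have hd' : IsComonHom (coconeMap c j) := isComonHom_underlying (c.ι.app j).hom
  have e1 : (μ[A.obj.X] ≫ g) ≫ coconeMap c j = ((g ⊗ₘ g) ≫ μ[(F.obj j).obj.X]) ≫ coconeMap c j := by
    rw [Category.assoc, hg, hm.mul_hom, Category.assoc, hm'.mul_hom, tensorHom_comp_tensorHom_assoc,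
      hg]
  have e2 : (η[A.obj.X] ≫ g) ≫ coconeMap c j = η[(F.obj j).obj.X] ≫ coconeMap c j := by
    rw [Category.assoc, hg, hm.one_hom, hm'.one_hom]
  have e3 : (g ≫ Δ[(F.obj j).obj.X]) ≫ (coconeMap c j ⊗ₘ coconeMap c j) =
      (Δ[A.obj.X] ≫ (g ⊗ₘ g)) ≫ (coconeMap c j ⊗ₘ coconeMap c j) := by
    rw [Category.assoc, ← hd'.hom_comul, reassoc_of% hg, hd.hom_comul, Category.assoc,
      tensorHom_comp_tensorHom, hg]
  obtain ⟨l₁, a₁, h₁⟩ := h.exists_map_eq (κ := κ) (rank_tensor_lt hA hA)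
    fun x => LinearMap.congr_fun (congrArg Hom.toLin e1) x
  obtain ⟨l₂, a₂, h₂⟩ := h.exists_map_eq (rank_unit_lt (κ := κ))
    fun x => LinearMap.congr_fun (congrArg Hom.toLin e2) x
  obtain ⟨l₃, a₃, h₃⟩ := h2.exists_map_eq hA
    fun x => LinearMap.congr_fun (congrArg Hom.toLin e3) x
  -- All three identities must hold after one and the same transition morphism out of `j`, so the
  -- stages are merged by spans, which also equalize the composites.
  obtain ⟨l₄, b₁, b₂, hb⟩ := IsFiltered.span a₁ a₂
  obtain ⟨l, b₄, b₃, hb'⟩ := IsFiltered.span (a₁ ≫ b₁) a₃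
  let a := (a₁ ≫ b₁) ≫ b₄
  let t : (F.obj j).obj.X ⟶ (F.obj l).obj.X := underlying (F.map a).hom
  have ht : t ≫ coconeMap c l = coconeMap c j :=
    congrArg (fun t => underlying t.hom) (c.w a)
  have htm : IsMonHom t := isMonHom_underlying (F.map a).hom
  have htd : IsComonHom t := isComonHom_underlying (F.map a).hom
  have k1 : (μ[A.obj.X] ≫ g) ≫ t = ((g ⊗ₘ g) ≫ μ[(F.obj j).obj.X]) ≫ t := by
    have := comp_map_eq_of_comp_map_eq (F ⋙ forgetHopf φ) h₁ (b₁ ≫ b₄)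
    rwa [← Category.assoc] at this
  have k2 : (η[A.obj.X] ≫ g) ≫ t = η[(F.obj j).obj.X] ≫ t := by
    have := comp_map_eq_of_comp_map_eq (F ⋙ forgetHopf φ) h₂ (b₂ ≫ b₄)
    rwa [← Category.assoc, ← hb] at this
  have k3 : (g ≫ Δ[(F.obj j).obj.X]) ≫ (t ⊗ₘ t) = (Δ[A.obj.X] ≫ (g ⊗ₘ g)) ≫ (t ⊗ₘ t) := by
    have := comp_map_eq_of_comp_map_eq
      (tensorFunctor (F ⋙ forgetHopf φ) (F ⋙ forgetHopf φ)) h₃ b₃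
    rwa [← hb'] at this
  refine ⟨l, HopfCoc.homMk (g ≫ t) ⟨?_, ?_⟩ ⟨?_, ?_⟩, HopfCoc.hom_ext ?_⟩
  · rw [← Category.assoc, k2, htm.one_hom]
  · rw [← Category.assoc, k1, Category.assoc, htm.mul_hom, tensorHom_comp_tensorHom_assoc]
  -- Compatibility with the counit needs no later stage: the counit of `F.obj j` already factors
  -- through the colimit.
  · rw [Category.assoc, htd.hom_counit, ← hd'.hom_counit, reassoc_of% hg]
    exact hd.hom_counit
  · rw [Category.assoc, htd.hom_comul, ← Category.assoc, k3, Category.assoc,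
      tensorHom_comp_tensorHom]
  · change (g ≫ t) ≫ coconeMap c l = _
    rw [Category.assoc, ht, hg]

theorem isCardinalPresentable_of_rank_lt {A : HopfCoc (ColorVec φ)}
    (hA : Module.rank k A.obj.X < κ) : IsCardinalPresentable A κ where
  preservesColimitOfShape J _ _ :=
    ⟨fun {F} => ⟨fun {c} hc => ⟨by
      have := isFiltered_of_isCardinalFiltered J κ
      refine Types.FilteredColimit.isColimitOf' _ _ (fun f => ?_) fun j f g h => ?_
      · obtain ⟨j, g, hg⟩ := exists_factorization hc hA f
        exact ⟨j, g, hg.symm⟩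
      · have h' : f ≫ c.ι.app j = g ≫ c.ι.app j := h
        obtain ⟨l, a, ha⟩ := (isFilteredColimit_of_isColimit hc).exists_map_eq hA
          (f := underlying f.hom) (g := underlying g.hom) fun x =>
          LinearMap.congr_fun (congrArg (fun t => Hom.toLin (underlying t.hom)) h') x
        exact ⟨l, a, HopfCoc.hom_ext ha⟩⟩⟩⟩

end

end ColorVec

/-! ### Hopf subalgebras of countable dimension -/

theorem Set.exists_countable_closure {α : Type*} (K : α → α → Set α)
    (hK : ∀ x y, (K x y).Countable) {A : Set α} (hA : A.Countable) :
    ∃ T : Set α, A ⊆ T ∧ T.Countable ∧ ∀ x ∈ T, ∀ y ∈ T, K x y ⊆ T := by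
  let s (n : ℕ) : Set α := Nat.rec A (fun _ B => B ∪ ⋃ x ∈ B, ⋃ y ∈ B, K x y) n
  have hs (n : ℕ) : s (n + 1) = s n ∪ ⋃ x ∈ s n, ⋃ y ∈ s n, K x y := rfl
  have hmono : Monotone s := monotone_nat_of_le_succ fun n => hs n ▸ Set.subset_union_left
  refine ⟨⋃ n, s n, Set.subset_iUnion s 0, Set.countable_iUnion fun n => ?_, ?_⟩
  · induction n with
    | zero => exact hA
    | succ n ih => exact hs n ▸ ih.union (ih.biUnion fun x _ => ih.biUnion fun y _ => hK x y)
  · intro x hx y hy z hz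
    obtain ⟨m, hm⟩ := Set.mem_iUnion.mp hx
    obtain ⟨n, hn⟩ := Set.mem_iUnion.mp hy
    -- Both elements are present at stage `max m n`, and the values of `K` on them are added at the
    -- next stage.
    refine Set.mem_iUnion.mpr ⟨max m n + 1, hs _ ▸ Or.inr ?_⟩
    exact Set.mem_biUnion (hmono (le_max_left m n) hm)
      (Set.mem_biUnion (hmono (le_max_right m n) hn) hz)

theorem TensorProduct.exists_finset_mem_map₂_span {k M : Type*} [Field k] [AddCommGroup M]
    [Module k M] (t : M ⊗[k] M) : ∃ D : Finset M, t ∈ Submodule.map₂ (TensorProduct.mk k M M)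
      (Submodule.span k D) (Submodule.span k D) := by
  classical
  obtain ⟨S, rfl⟩ := TensorProduct.exists_finset t
  refine ⟨S.image Prod.fst ∪ S.image Prod.snd, Submodule.sum_mem _ fun i hi => ?_⟩
  refine Submodule.apply_mem_map₂ _ (Submodule.subset_span ?_) (Submodule.subset_span ?_)
  · exact Finset.mem_union_left _ (Finset.mem_image_of_mem _ hi)
  · exact Finset.mem_union_right _ (Finset.mem_image_of_mem _ hi)

namespace ColorVec

variable {k G : Type u} [Field k] [CommGroup G] {φ : CommutationFactor k G}

/-- A graded subspace of a color Hopf algebra which is closed under all operations. -/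
structure IsHopfSub (X : ColorVec φ) [HopfObj X] (W : Submodule k X) : Prop where
  homogeneous : X.IsHomogeneous W
  one_mem : X.oneElt ∈ W
  mul_mem : ∀ x ∈ W, ∀ y ∈ W, X.mulElt x y ∈ W
  antipode_mem : ∀ x ∈ W, Hom.toLin (HopfObj.antipode (X := X)) x ∈ W
  comul_mem : ∀ x ∈ W, X.comulLin x ∈ Submodule.map₂ (TensorProduct.mk k X X) W W

theorem isHopfSub_top (X : ColorVec φ) [HopfObj X] : IsHopfSub X ⊤ where
  homogeneous _ _ _ := trivial
  one_mem := trivial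
  mul_mem _ _ _ _ := trivial
  antipode_mem _ _ := trivial
  comul_mem _ _ := by
    rw [TensorProduct.map₂_mk_top_top_eq_top]
    trivial

/-- The closure conditions are linear or bilinear, so they need only be imposed on a spanning set.
Each element requires countably many others, including a finite set whose span contains both legs of
its comultiplication. -/
theorem exists_countable_isHopfSub (X : ColorVec φ) [HopfObj X] {A : Set X} (hA : A.Countable) :
    ∃ T : Set X, A ⊆ T ∧ T.Countable ∧ IsHopfSub X (Submodule.span k T) := by
  choose D hD using fun x : X => TensorProduct.exists_finset_mem_map₂_span (X.comulLin x)
  let S : X →ₗ[k] X := Hom.toLin (HopfObj.antipode (X := X))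
  have hproj (x : X) : (Set.range fun g => X.proj g x).Countable := by
    obtain ⟨s, hs⟩ := X.exists_sum_proj x
    refine ((s.finite_toSet.image fun g => X.proj g x).insert 0).countable.mono ?_
    rintro _ ⟨g, rfl⟩
    by_cases hg : g ∈ s
    · exact Or.inr ⟨g, hg, rfl⟩
    · classical
      -- Adding `g` to `s` does not change the sum of the components, so the component of degree `g`
      -- is zero.
      have h := hs (insert g s) (Finset.subset_insert _ _)
      rw [Finset.sum_insert hg, hs s subset_rfl] at h
      exact Or.inl (add_eq_right.mp h)
  obtain ⟨T, hAT, hT, hTK⟩ := Set.exists_countable_closure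
    -- Operations in one variable are recorded in the same set-valued function and ignore the second
    -- argument.
    (fun x y => {X.mulElt x y, S x} ∪ (D x ∪ Set.range fun g => X.proj g x))
    (fun x y => ((Set.countable_singleton _).insert _).union
      ((D x).countable_toSet.union (hproj x))) (hA.insert X.oneElt)
  refine ⟨T, (Set.subset_insert _ _).trans hAT, hT, ?_, ?_, ?_, ?_, ?_⟩
  · intro g x hx
    have : Submodule.span k T ≤ (Submodule.span k T).comap (X.proj g) :=
      Submodule.span_le.mpr fun y hy =>
        Submodule.subset_span (hTK y hy y hy (Or.inr (Or.inr ⟨g, rfl⟩)))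
    exact this hx
  · exact Submodule.subset_span (hAT (Set.mem_insert _ _))
  · intro x hx y hy
    have h := Submodule.apply_mem_map₂ (TensorProduct.mk k X X) hx hy
    rw [Submodule.map₂_span_span] at h
    have : Submodule.span k (Set.image2 (fun m n => TensorProduct.mk k X X m n) T T) ≤
        (Submodule.span k T).comap (Hom.toLin μ[X] : X ⊗[k] X →ₗ[k] X) := by
      rw [Submodule.span_le]
      rintro _ ⟨a, ha, b, hb, rfl⟩
      exact Submodule.subset_span (hTK a ha b hb (Or.inl (Or.inl rfl)))
    exact this h
  · intro x hx
    have : Submodule.span k T ≤ (Submodule.span k T).comap S :=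
      Submodule.span_le.mpr fun y hy =>
        Submodule.subset_span (hTK y hy y hy (Or.inl (Or.inr rfl)))
    exact this hx
  · intro x hx
    have : Submodule.span k T ≤ (Submodule.map₂ (TensorProduct.mk k X X) (Submodule.span k T)
        (Submodule.span k T)).comap X.comulLin :=
      Submodule.span_le.mpr fun y hy => by
        have h : Submodule.span k (D y : Set X) ≤ Submodule.span k T :=
          Submodule.span_mono fun z hz => hTK y hy y hy (Or.inr (Or.inl hz))
        exact Submodule.map₂_le_map₂ h h (hD y)
    exact this hx

/-- The closure conditions say that every operation of `X`, restricted along `i`, factors through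
`i` or `i ⊗ i`; the axioms are inherited because these are monomorphisms. -/
theorem exists_hopfObj_of_injective {K X : ColorVec φ} [HopfObj X] {i : K ⟶ X}
    (hi : Function.Injective (Hom.toLin i)) (hW : IsHopfSub X (LinearMap.range (Hom.toLin i))) :
    ∃ _ : HopfObj K, IsMonHom i ∧ IsComonHom i := by
  obtain ⟨d, hd⟩ := exists_lift (injective_tensorHom hi hi) (i ≫ Δ[X]) fun t => by
    have h := hW.comul_mem _ ⟨t, rfl⟩
    rw [← TensorProduct.range_map] at h
    exact h
  obtain ⟨m, hm⟩ := exists_lift hi ((i ⊗ₘ i) ≫ μ[X]) fun t => by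
    have : (⊤ : Submodule k (K ⊗[k] K)) ≤ (LinearMap.range (Hom.toLin i)).comap
        (Hom.toLin ((i ⊗ₘ i) ≫ μ[X]) : K ⊗[k] K →ₗ[k] X) := by
      rw [← TensorProduct.map₂_mk_top_top_eq_top, Submodule.map₂_le]
      exact fun x _ y _ => hW.mul_mem _ ⟨x, rfl⟩ _ ⟨y, rfl⟩
    exact this (Submodule.mem_top (x := t))
  obtain ⟨e, he⟩ := exists_lift hi η[X] fun (t : k) => by
    have h := Submodule.smul_mem _ t hW.one_mem
    have h1 : t • X.oneElt = Hom.toLin η[X] t :=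
      ((Hom.toLin η[X]).map_smul t (1 : k)).symm.trans
        (congrArg (Hom.toLin η[X]) (mul_one t))
    rw [h1] at h
    exact h
  obtain ⟨s, hs⟩ := exists_lift hi (i ≫ HopfObj.antipode) fun t => hW.antipode_mem _ ⟨t, rfl⟩
  let h : HopfObj K := HopfObj.ofMono i (mono_of_injective _ hi) (mono_of_injective₂ hi)
    (mono_of_injective₃ hi) (mono_of_injective _ (injective_whiskerLeft hi _))
    (mono_of_injective _ (injective_whiskerRight hi _)) d hd m hm e he s hs
  exact ⟨h, ⟨he, hm⟩, ⟨rfl, hd.symm⟩⟩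

open HopfCoc

theorem exists_hopfCoc_of_injective {K : ColorVec φ} {H : HopfCoc (ColorVec φ)}
    {i : K ⟶ H.obj.X} (hi : Function.Injective (Hom.toLin i))
    (hW : IsHopfSub H.obj.X (LinearMap.range (Hom.toLin i))) :
    ∃ (h : HopfObj K) (hc : HopfIsCocommutative h) (f : HopfCoc.of h hc ⟶ H),
      underlying f.hom = i := by
  obtain ⟨h, hm, hd⟩ := exists_hopfObj_of_injective hi hW
  have := mono_of_injective _ hi
  have hc : HopfIsCocommutative h :=
    isCommComonObj_of_mono i (mono_of_injective₂ hi) hd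
  exact ⟨h, hc, HopfCoc.homMk (A := HopfCoc.of h hc) i hm hd, rfl⟩

theorem mono_of_underlying_injective {A H : HopfCoc (ColorVec φ)} {f : A ⟶ H}
    (hf : Function.Injective (Hom.toLin (underlying f.hom))) : Mono f :=
  ⟨fun g h hgh => HopfCoc.hom_ext (by
    have := mono_of_injective _ hf
    rw [← cancel_mono (underlying f.hom)]
    exact congrArg (fun t => underlying t.hom) hgh)⟩

theorem exists_hopf_lift {A B H : HopfCoc (ColorVec φ)} {f : A ⟶ H}
    (hf : Function.Injective (Hom.toLin (underlying f.hom))) (g : B ⟶ H)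
    (hg : LinearMap.range (Hom.toLin (underlying g.hom)) ≤
      LinearMap.range (Hom.toLin (underlying f.hom))) : ∃ l : B ⟶ A, l ≫ f = g := by
  obtain ⟨l, hl⟩ := exists_lift hf (underlying g.hom) fun t => hg ⟨t, rfl⟩
  exact ⟨HopfCoc.homMk l
    (isMonHom_of_comp_mono hf (isMonHom_underlying f.hom) (hl ▸ isMonHom_underlying g.hom))
    (isComonHom_of_comp_mono hf (isComonHom_underlying f.hom) (hl ▸ isComonHom_underlying g.hom)),
    HopfCoc.hom_ext hl⟩

end ColorVec

/-! ### Local presentability -/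

namespace ColorVec

open HopfCoc Cardinal

variable {k G : Type u} [Field k] [CommGroup G] {φ : CommutationFactor k G}

section Countable

variable (H : HopfCoc (ColorVec φ))

/-- The color Hopf subalgebras of countable dimension. -/
abbrev CountableSub : Type u :=
  {W : Submodule k H.obj.X //
    IsHopfSub H.obj.X W ∧ ∃ T : Set H.obj.X, T.Countable ∧ Submodule.span k T = W}

theorem exists_countableSub {A : Set H.obj.X} (hA : A.Countable) :
    ∃ W : CountableSub H, A ⊆ W.1 := by
  obtain ⟨T, hAT, hT, h⟩ := exists_countable_isHopfSub H.obj.X hA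
  exact ⟨⟨Submodule.span k T, h, T, hT, rfl⟩, hAT.trans Submodule.subset_span⟩

/-- A union of countably many countable spanning sets is countable, so it lies in a further Hopf
subalgebra of countable dimension. -/
theorem isCardinalFiltered_countableSub [Fact (ℵ₁ : Cardinal.{u}).IsRegular] :
    IsCardinalFiltered (CountableSub H) (ℵ₁ : Cardinal.{u}) :=
  isCardinalFiltered_preorder _ _ fun K s hK => by
    rw [lt_aleph_one_iff, mk_le_aleph0_iff] at hK
    choose T hT hTs using fun i => (s i).2.2
    obtain ⟨W, hW⟩ := exists_countableSub H (Set.countable_iUnion hT)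
    refine ⟨W, fun i => ?_⟩
    change (s i).1 ≤ W.1
    rw [← hTs i, Submodule.span_le]
    exact (Set.subset_iUnion T i).trans hW

theorem exists_countableSub_obj (W : CountableSub H) : ∃ (A : HopfCoc (ColorVec φ)) (f : A ⟶ H),
    Function.Injective (Hom.toLin (underlying f.hom)) ∧
      LinearMap.range (Hom.toLin (underlying f.hom)) = W.1 := by
  obtain ⟨h, hc, f, hf⟩ := exists_hopfCoc_of_injective (H := H)
    (i := subι H.obj.X W.1 W.2.1.homogeneous) (Submodule.subtype_injective _)
    (by
      have : LinearMap.range (Hom.toLin (subι H.obj.X W.1 W.2.1.homogeneous)) = W.1 :=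
        Submodule.range_subtype _
      rw [this]
      exact W.2.1)
  refine ⟨_, f, ?_, ?_⟩
  · rw [hf]
    exact Submodule.subtype_injective _
  · rw [hf]
    exact Submodule.range_subtype _

theorem rank_lt_of_countable_span {V : ColorVec φ} {X : ColorVec φ} {f : V ⟶ X}
    (hf : Function.Injective (Hom.toLin f)) {T : Set X} (hT : T.Countable)
    (hr : LinearMap.range (Hom.toLin f) = Submodule.span k T) :
    Module.rank k V < (ℵ₁ : Cardinal.{u}) := by
  rw [lt_aleph_one_iff, (LinearEquiv.ofInjective _ hf).rank_eq, hr]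
  exact (rank_span_le T).trans (le_aleph0_iff_set_countable.mpr hT)

/-- Every element lies in a Hopf subalgebra of countable dimension, so `H` is the union of these,
and a directed union is a filtered colimit of the underlying spaces. -/
theorem exists_countable_presentation [Fact (ℵ₁ : Cardinal.{u}).IsRegular] :
    ObjectProperty.colimitsOfShape
      (fun A : HopfCoc (ColorVec φ) => Module.rank k A.obj.X < (ℵ₁ : Cardinal.{u}))
      (CountableSub H) H := by
  choose A f hf hr using exists_countableSub_obj H
  have hm (W) : Mono (f W) := mono_of_underlying_injective (hf W)
  have hl (W W' : CountableSub H) (a : W ⟶ W') : ∃ l : A W ⟶ A W', l ≫ f W' = f W :=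
    exists_hopf_lift (hf W') (f W) (by
      rw [hr, hr]
      exact leOfHom a)
  choose l hl using hl
  let F : CountableSub H ⥤ HopfCoc (ColorVec φ) :=
    { obj := A
      map := fun {W W'} a => l W W' a
      map_id := fun W => by rw [← cancel_mono (f W), hl, Category.id_comp]
      map_comp := fun {W W' W''} a b => by
        rw [← cancel_mono (f W''), hl, Category.assoc, hl, hl] }
  let p : F ⟶ (Functor.const _).obj H :=
    { app := f
      naturality := fun W W' a => (hl W W' a).trans (Category.comp_id _).symm }
  have := isCardinalFiltered_countableSub H
  have := isFiltered_of_isCardinalFiltered (CountableSub H) (ℵ₁ : Cardinal.{u})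
  have hF : IsFilteredColimit (F ⋙ forgetHopf φ)
      fun W => Hom.toLin (coconeMap (Cocone.mk H p) W) :=
    { naturality := fun {W W'} a x =>
        LinearMap.congr_fun (congrArg (fun t => Hom.toLin (underlying t.hom)) (hl W W' a)) x
      surjective := fun z => by
        obtain ⟨W, hW⟩ := exists_countableSub H (Set.countable_singleton z)
        have hz : z ∈ W.1 := hW rfl
        rw [← hr W] at hz
        exact ⟨W, hz⟩
      -- The inclusions into `H` are injective, so no later stage is needed.
      eventually_zero := fun {W} x hx =>
        ⟨W, 𝟙 W, by rw [hf W (hx.trans (map_zero _).symm), map_zero]⟩ }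
  obtain ⟨hc⟩ := isColimit_of_isFilteredColimit (Cocone.mk H p) hF
  refine ⟨{ toColimitPresentation := ⟨F, p, hc⟩, prop_diag_obj := fun W => ?_ }⟩
  obtain ⟨-, T, hT, hTW⟩ := W.2
  exact rank_lt_of_countable_span (hf W) hT ((hr W).trans hTW.symm)

end Countable

section Small

open Classical in
theorem isInternal_map_equiv (V : ColorVec φ) {M : Type*} [AddCommGroup M] [Module k M]
    (e : V ≃ₗ[k] M) : DirectSum.IsInternal fun g => (V.grading g).map e.toLinearMap := by
  refine isInternal_of_proj _ (fun g => e.toLinearMap ∘ₗ V.proj g ∘ₗ e.symm.toLinearMap) ?_ ?_ ?_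
  · rintro g _ ⟨x, hx, rfl⟩
    simp [proj_of_mem hx]
  · rintro g g' hg _ ⟨x, hx, rfl⟩
    simp [proj_of_mem_ne hx hg]
  · rw [← Submodule.map_iSup, V.isInternal.submodule_iSup_eq_top, Submodule.map_top]
    exact LinearEquiv.range e

open Classical in
/-- Cocommutative color Hopf algebras whose underlying space consists of the finitely supported
functions on a subset of a fixed set. -/
structure FinsuppHopf (φ : CommutationFactor k G) (B : Type u) : Type u where
  index : Set B
  grading : G → Submodule k (index →₀ k)
  isInternal : DirectSum.IsInternal grading
  hopf : HopfObj (C := ColorVec φ) ⟨index →₀ k, grading, isInternal⟩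
  cocomm : HopfIsCocommutative hopf

/-- The corresponding object. -/
abbrev FinsuppHopf.toHopfCoc {B : Type u} (D : FinsuppHopf φ B) : HopfCoc (ColorVec φ) :=
  HopfCoc.of D.hopf D.cocomm

/-- A basis indexed by a subset of `B` transports the whole structure to finitely supported
functions on that subset, and the structures on such spaces form a small type. -/
theorem exists_iso_toHopfCoc {B : Type u} {A : HopfCoc (ColorVec φ)}
    (hA : Module.rank k A.obj.X ≤ #B) : ∃ D : FinsuppHopf φ B, Nonempty (A ≅ D.toHopfCoc) := by
  obtain ⟨I, b, -, -⟩ := A.obj.X.exists_homogeneous_basis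
  rw [← b.mk_eq_rank''] at hA
  obtain ⟨i⟩ := hA
  let e : A.obj.X ≃ₗ[k] (Set.range i →₀ k) :=
    b.repr.trans (Finsupp.domLCongr (Equiv.ofInjective i i.injective))
  let K : ColorVec φ := ⟨Set.range i →₀ k, _, isInternal_map_equiv A.obj.X e⟩
  let j : K ⟶ A.obj.X := ofLin e.symm.toLinearMap (by
    rintro g _ ⟨x, hx, rfl⟩
    simpa using hx)
  have hj : Function.Injective (Hom.toLin j) := e.symm.injective
  have hj' : LinearMap.range (Hom.toLin j) = ⊤ := LinearEquiv.range e.symm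
  obtain ⟨h, hc, f, hf⟩ := exists_hopfCoc_of_injective hj (by
    rw [hj']
    exact isHopfSub_top _)
  have hfj : Function.Injective (Hom.toLin (underlying f.hom)) := by
    rw [hf]
    exact hj
  have := mono_of_underlying_injective hfj
  obtain ⟨l, hl⟩ := exists_hopf_lift hfj (𝟙 A) (by
    rw [hf, hj']
    exact le_top)
  exact ⟨⟨Set.range i, _, isInternal_map_equiv A.obj.X e, h, hc⟩,
    ⟨⟨l, f, hl, by rw [← cancel_mono f, Category.assoc, hl, Category.comp_id, Category.id_comp]⟩⟩⟩

theorem essentiallySmall_rank_lt (κ : Cardinal.{u}) :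
    ObjectProperty.EssentiallySmall.{u}
      (fun A : HopfCoc (ColorVec φ) => Module.rank k A.obj.X < κ) where
  exists_small_le' := by
    refine ⟨ObjectProperty.ofObj (FinsuppHopf.toHopfCoc (φ := φ) (B := κ.out)), inferInstance,
      fun A hA => ?_⟩
    obtain ⟨D, hD⟩ := exists_iso_toHopfCoc (B := κ.out) (A := A) (by
      rw [mk_out]
      exact le_of_lt hA)
    exact ⟨_, ⟨D⟩, hD⟩

end Small

instance : IsLocallyPresentable.{u} (HopfCoc (ColorVec φ)) where
  exists_cardinal := by
    -- The cardinal `ℵ₁` fits because closing a countable set under the operations leaves it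
    -- countable, and countable dimension means dimension less than `ℵ₁`.
    have hκ : Fact (ℵ₁ : Cardinal.{u}).IsRegular := ⟨isRegular_aleph_one⟩
    have := essentiallySmall_rank_lt (φ := φ) ℵ₁
    have hP : ObjectProperty.IsCardinalFilteredGenerator
        (fun A : HopfCoc (ColorVec φ) => Module.rank k A.obj.X < (ℵ₁ : Cardinal.{u})) ℵ₁ :=
      { le_isCardinalPresentable := fun A hA => isCardinalPresentable_of_rank_lt hA
        exists_colimitsOfShape := fun H => ⟨CountableSub H, inferInstance,
          isCardinalFiltered_countableSub H, exists_countable_presentation H⟩ }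
    have := hP.hasCardinalFilteredGenerator
    exact ⟨ℵ₁, hκ, { }⟩

theorem hasLimits_hopfCoc : HasLimits (HopfCoc (ColorVec φ)) :=
  hasLimits_of_isLocallyPresentable _

end ColorVec

end

/-! ### Assembly of the results -/

theorem mainTheorem7 {k G : Type u} [Field k] [CommGroup G] (φ : CommutationFactor k G) :
    -- pointed, with zero object `k` concentrated in trivial degree
    (HasZeroObject (HopfCoc (ColorVec φ)) ∧
      ∃ (h : HopfObj (𝟙_ (ColorVec φ))) (hc : HopfIsCocommutative h),
        IsUnitHopf h ∧ IsZero (HopfCoc.of h hc)) ∧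
    -- finitely complete, and even complete
    HasFiniteLimits (HopfCoc (ColorVec φ)) ∧
    HasLimits (HopfCoc (ColorVec φ)) ∧
    -- explicit equalizers
    (∀ {A B : HopfCoc (ColorVec φ)} (f g : A ⟶ B),
      ∃ (K : HopfCoc (ColorVec φ)) (i : K ⟶ A) (w : i ≫ f = i ≫ g),
        Nonempty (IsLimit (Fork.ofι i w)) ∧
        ColorVec.IsGradedSubspace (ColorHopf.lin i.hom)
          (ColorVec.equalizerSubspace A.obj.X (ColorHopf.lin f.hom) (ColorHopf.lin g.hom))) ∧
    -- explicit binary products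
    (∀ A B : HopfCoc (ColorVec φ),
      ∃ (h : HopfObj (A.obj.X ⊗ B.obj.X)) (hc : HopfIsCocommutative h)
        (p₁ : HopfCoc.of h hc ⟶ A) (p₂ : HopfCoc.of h hc ⟶ B),
        IsTensorHopf A.obj.X B.obj.X h ∧
        HopfCoc.underlying p₁.hom = (A.obj.X ◁ ε[B.obj.X]) ≫ (ρ_ A.obj.X).hom ∧
        HopfCoc.underlying p₂.hom = (ε[A.obj.X] ▷ B.obj.X) ≫ (λ_ B.obj.X).hom ∧
        Nonempty (IsLimit (BinaryFan.mk p₁ p₂)) ∧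
        ∀ (T : HopfCoc (ColorVec φ)) (m : T ⟶ HopfCoc.of h hc),
          HopfCoc.underlying m.hom = Δ[T.obj.X] ≫
            (HopfCoc.underlying (m ≫ p₁).hom ⊗ₘ HopfCoc.underlying (m ≫ p₂).hom)) ∧
    -- cocomplete, and so is the category of all color Hopf algebras
    HasColimits (HopfCoc (ColorVec φ)) ∧
    HasColimits (Hopf (ColorVec φ)) ∧
    -- explicit coequalizers, in both categories
    (∀ {A B : HopfCoc (ColorVec φ)} (f g : A ⟶ B),
      ∃ (Q : HopfCoc (ColorVec φ)) (p : B ⟶ Q) (w : f ≫ p = g ≫ p),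
        Nonempty (IsColimit (Cofork.ofπ p w)) ∧
        ColorVec.IsGradedQuotient (ColorHopf.lin p.hom) (ColorVec.idealGenerated B.obj.X
          {b | ∃ a, b = ColorHopf.lin f.hom a - ColorHopf.lin g.hom a})) ∧
    (∀ {A B : Hopf (ColorVec φ)} (f g : A ⟶ B),
      ∃ (Q : Hopf (ColorVec φ)) (p : B ⟶ Q) (w : f ≫ p = g ≫ p),
        Nonempty (IsColimit (Cofork.ofπ p w)) ∧
        ColorVec.IsGradedQuotient (ColorHopf.lin p) (ColorVec.idealGenerated B.X
          {b | ∃ a, b = ColorHopf.lin f a - ColorHopf.lin g a})) ∧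
    -- explicit small coproducts, in both categories
    (∀ {J : Type u} (H : J → HopfCoc (ColorVec φ)),
      ∃ (P : HopfCoc (ColorVec φ)) (q : ∀ l, H l ⟶ P),
        Nonempty (IsColimit (Cofan.mk P q)) ∧
        ColorVec.IsTensorAlgebraQuotient (fun l => (H l).obj.X) P.obj.X
          (fun l => ColorHopf.lin (q l).hom)) ∧
    (∀ {J : Type u} (H : J → Hopf (ColorVec φ)),
      ∃ (P : Hopf (ColorVec φ)) (q : ∀ l, H l ⟶ P),
        Nonempty (IsColimit (Cofan.mk P q)) ∧
        ColorVec.IsTensorAlgebraQuotient (fun l => (H l).X) P.X (fun l => ColorHopf.lin (q l))) ∧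
    -- locally presentable
    IsLocallyPresentable.{u} (HopfCoc (ColorVec φ)) ∧
    -- cocommutative graded coalgebras are finitely complete, with the same equalizers; they are a
    -- cartesian category, with the tensor product as binary product and the unit object as terminal
    -- object
    HasFiniteLimits (CommComon (ColorVec φ)) ∧
    (∀ {A B : CommComon (ColorVec φ)} (f g : A ⟶ B),
      ∃ (K : CommComon (ColorVec φ)) (i : K ⟶ A) (w : i ≫ f = i ≫ g),
        Nonempty (IsLimit (Fork.ofι i w)) ∧
        ColorVec.IsGradedSubspace (ColorVec.Hom.toLin (CommComonCartesian.homX i))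
          (ColorVec.equalizerSubspace A.X (ColorVec.Hom.toLin (CommComonCartesian.homX f))
            (ColorVec.Hom.toLin (CommComonCartesian.homX g)))) ∧
    Nonempty (IsTerminal (CommComon.trivial (ColorVec φ))) ∧
    (∀ A B : CommComon (ColorVec φ), Nonempty (IsLimit
      (BinaryFan.mk (CommComonCartesian.fst A B) (CommComonCartesian.snd A B)))) ∧
    -- cocommutative color Hopf algebras are the internal groups in cocommutative graded
    -- coalgebras (an isomorphism of categories)
    ((HopfCoc.toGrp (C := ColorVec φ)).IsEquivalence ∧
      Function.Bijective (HopfCoc.toGrp (C := ColorVec φ)).obj) ∧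
    -- protomodular
    IsProtomodular (HopfCoc (ColorVec φ)) := by
  refine ⟨⟨⟨_, isZero_unitHopf⟩, unitHopf _, isCocommutative_unitHopf, isUnitHopf_unitHopf,
    isZero_unitHopf⟩, inferInstance, ColorVec.hasLimits_hopfCoc, ?_, ?_, inferInstance,
    inferInstance, ?_, ?_, ?_, ?_, inferInstance, inferInstance, ?_,
    CommComon.isTerminal_trivial, CommComon.isLimit_fst_snd,
    ⟨HopfCoc.toGrp_isEquivalence, HopfCoc.toGrp_bijective⟩, inferInstance⟩
  · exact fun f g => ⟨_, _, _, ColorVec.isLimit_hopfEqι f g, ColorVec.isGradedSubspace_hopfEqι f g⟩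
  · exact fun A B => ⟨tensorHopf A.obj.X B.obj.X, _, HopfCoc.fst A B, HopfCoc.snd A B,
      isTensorHopf_tensorHopf _ _, rfl, rfl, HopfCoc.isLimit_fst_snd A B, fun T m =>
      congrArg (fun t => HopfCoc.underlying t.hom) (HopfCoc.pair_eta m)⟩
  · exact fun f g => ⟨_, _, _, ColorVec.isColimit_hopfCocCoeqπ f g,
      ColorVec.isGradedQuotient_hopfCoeqπ f.hom g.hom⟩
  · exact fun f g => ⟨_, _, _, ColorVec.isColimit_hopfCoeqπ f g,
      ColorVec.isGradedQuotient_hopfCoeqπ f g⟩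
  · exact fun H => ⟨_, _, ColorVec.isColimit_hopfCocCoprodι H,
      ColorVec.isTensorAlgebraQuotient_coprodι (V := fun l => (H l).obj.X)⟩
  · exact fun H => ⟨_, _, ColorVec.isColimit_hopfCoprodι H,
      ColorVec.isTensorAlgebraQuotient_coprodι (V := fun l => (H l).X)⟩
  · exact fun f g => ⟨_, _, _, ColorVec.isLimit_commComonEqι f g,
      ColorVec.isGradedSubspace_commComonEqι f g⟩
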